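/- For a rational number $t=a/b$ in lowest terms let $H(t)=\max(|a|,|b|)$ be its naive height, and for real $B$ let \[N(B)=\#\{t\in\mathbb{Q} : H(t)\le B,\ t=x^2+y^2 \text{ for some } x,y\in\mathbb{Q}\}.\] The Euler product \[\kappa=\prod_{p\equiv 1 \bmod 4}\left(1+\frac1p\right)\prod_{p\equiv 3\bmod 4}\left(1-\frac{p-1}{p(p+1)}\right),\] understood as the limit as $n\to\infty$ of the products over all primes $p\le n$ of both residue classes together, converges (conditionally) to a positive real number, and as $B\to\infty$ \[N(B)=\frac{3}{2\pi}\,\kappa\,\frac{B^2}{\log B}+O\left(\frac{B^2}{(\log B)^2}\right).\] -/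

import Mathlib

open Filter Topology Asymptotics

/-- The rational numbers of naive height at most `B` that are sums of two rational squares.
Here `Height.mulHeight₁ t = max |a| |b|` for `t = a / b` in lowest terms
(`Rat.mulHeight₁_eq_max`). -/
def sumTwoSquaresSet (B : ℝ) : Set ℚ :=
  {t : ℚ | Height.mulHeight₁ t ≤ B ∧ ∃ x y : ℚ, t = x ^ 2 + y ^ 2}

/-- The set being counted is finite, so that `Set.ncard` is its true cardinality. -/
theorem sumTwoSquaresSet_finite (B : ℝ) : (sumTwoSquaresSet B).Finite := by
  have hfin : ((Set.Icc (-(⌊B⌋₊ : ℤ)) (⌊B⌋₊ : ℤ)) ×ˢ (Set.Iic ⌊B⌋₊ : Set ℕ)).Finite :=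
    (Set.finite_Icc _ _).prod (Set.finite_Iic _)
  refine Set.Finite.of_finite_image (f := fun t : ℚ => (t.num, t.den)) (hfin.subset ?_) ?_
  · rintro _ ⟨t, ⟨ht, -⟩, rfl⟩
    rw [Rat.mulHeight₁_eq_max] at ht
    have h : max t.num.natAbs t.den ≤ ⌊B⌋₊ := Nat.le_floor (by exact_mod_cast ht)
    have h1 : t.num.natAbs ≤ ⌊B⌋₊ := (le_max_left _ _).trans h
    have h2 : t.den ≤ ⌊B⌋₊ := (le_max_right _ _).trans h
    refine ⟨⟨?_, ?_⟩, h2⟩ <;> dsimp only <;> omega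
  · intro a _ b _ hab
    simp only [Prod.mk.injEq] at hab
    exact Rat.ext hab.1 hab.2

/-- `N(B)`: the number of rationals of naive height at most `B` that are sums of two
rational squares. -/
noncomputable def sumTwoSquaresCount (B : ℝ) : ℕ := (sumTwoSquaresSet B).ncard

/-- The Euler product truncated to the primes `p ≤ n`. Both residue classes are truncated at the
same point, since the full product converges only conditionally. -/
noncomputable def eulerPartialProduct (n : ℕ) : ℝ :=
  (∏ p ∈ (Finset.Icc 1 n).filter (fun p => p.Prime ∧ p % 4 = 1), (1 + 1 / (p : ℝ))) *
    ∏ p ∈ (Finset.Icc 1 n).filter (fun p => p.Prime ∧ p % 4 = 3),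
      (1 - ((p : ℝ) - 1) / ((p : ℝ) * ((p : ℝ) + 1)))

/-!
Apart from `0`, the rationals counted by `sumTwoSquaresCount` are the quotients `a / b` of coprime
positive integers, and `a / b` is a sum of two rational squares if and only if both `a` and `b` are
sums of two integral squares (`rat_sum_two_squares_iff`). The problem is thus to count coprime pairs
of sums of two squares. Let `sos` be the indicator of the positive sums of two squares, which is
multiplicative, `sosInv` its Dirichlet inverse, and `S(x) = ∑_{n ≤ x} sos n` (`sosCount`). Removing
greatest common divisors, the number of pairs is `∑_g sosInv(g) S(x / g)²`
(`coprimePairCount_floor_eq_tsum`), so that everything rests on Landau's theorem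
`S(x) = c x / √log x + O(x / (log x)^(3/2))` (`exists_abs_sosCount_sub_le`).

The Dirichlet series `F(s) = ∑ sos(n) n^(-s)` satisfies `(s - 1) F(s)² = W(s)`, where `W`
(`regularPart`) is the product of `(s - 1) L(s, χ₀)`, `L(s, χ)` for the two characters modulo `4`,
and factors that are regular and nonvanishing for `re s ≥ 1` (`sosSeries_sq`). On the closed
half-plane `re s ≥ 1`, `W` and its derivatives grow at most slightly faster than linearly
(truncation of the Dirichlet series at the height of `s` and Cauchy's estimate,
`exists_norm_le_of_partial_sums`), and `W` is not much smaller than that (a quantitative form of the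
argument with `3 + 4 cos θ + cos 2θ ≥ 0`, `exists_lower_bound_of_three_four_one`). No zero-free
region is needed. It follows that
`F''(s) = 3/4 c₀ (s - 1)^(-5/2) + O(|s - 1|^(-3/2) + (1 + |im s|)^(1/4))` for `1 < re s ≤ 2`, where
`c₀² = W(1)` (`exists_deriv_deriv_sosSeries_bound`).

The function `3/4 c₀ (s - 1)^(-5/2)` is itself the transform of a positive density, namely
`c (log y)^(3/2)` for `y ≥ 1`, with `c = c₀ / √π`. Instead of moving a contour around the
singularity, the weighted sum `∑_{n ≤ x} sos(n) (log n)²`, which belongs to `F''`, is compared with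
this density: Perron's formula with the weight `max (X - y) 0` applies to both, on the line
`re s = 1 + 1 / log x`, and only the difference of the transforms has to be integrated. Taking the
difference quotient over an interval of length of order `x / log x` removes the weight
(`exists_count_le_count`, `exists_sum_sos_mul_log_sq`). The reason for passing to the second
derivative is that the difference of the transforms still has a singularity of order `3/2` at `1`,
so that its integral is of order `x (log x)^(1/2)` already by a bound of its absolute value, which
is smaller than the main term by the factor `log x`. Removing the logarithms `(log n)²` afterwards
is elementary.

The sum over `g` then gives `c² / F(2) · x² / log x` as the main term
(`exists_abs_coprimePairCount_sub_le`, `sosSeries_two_mul_tsum_sosInv`). As for the constant, each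
factor of the truncated Euler product is the factor of `L(1, χ)` times factors of two products that
converge absolutely at `2`, up to a correction for the prime `2` (`eulerPartialProduct_eq`). The
Euler product of `L(s, χ)` converges at `s = 1`, to `L(1, χ)`, by Mertens' bound for
`∑ χ(p) log p / p`, Dirichlet's test and Abel's theorem (`tendsto_prod_prime_chi4`). Since `c²` is a
multiple of `W(1)` and hence of `L(1, χ)` (`sosDensity_sq`), the two constants agree, without the
value of `L(1, χ)` being used.
-/

/-! ### Multiplicative functions given by local data -/

/-- The multiplicative function with prescribed values `g p k` at the prime powers `p ^ k`,
`k ≥ 1`. -/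
noncomputable def ofLocal (g : ℕ → ℕ → ℝ) : ArithmeticFunction ℝ :=
  ⟨fun n => if n = 0 then 0 else n.factorization.prod g, by simp⟩

theorem ofLocal_apply (g : ℕ → ℕ → ℝ) {n : ℕ} (hn : n ≠ 0) :
    ofLocal g n = n.factorization.prod g := by
  simp [ofLocal, hn]

theorem ofLocal_one (g : ℕ → ℕ → ℝ) : ofLocal g 1 = 1 := by
  simp [ofLocal_apply]

theorem ofLocal_isMultiplicative (g : ℕ → ℕ → ℝ) : (ofLocal g).IsMultiplicative := by
  refine ⟨ofLocal_one g, ?_⟩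
  intro m n h
  rcases eq_or_ne m 0 with rfl | hm
  · simp
  rcases eq_or_ne n 0 with rfl | hn
  · simp
  rw [ofLocal_apply g hm, ofLocal_apply g hn, ofLocal_apply g (mul_ne_zero hm hn),
    Nat.factorization_mul_of_coprime h, Finsupp.prod_add_index_of_disjoint]
  simpa using h.disjoint_primeFactors

theorem ofLocal_prime_pow {g : ℕ → ℕ → ℝ} (hg : ∀ p, g p 0 = 1) {p : ℕ} (hp : p.Prime) (k : ℕ) :
    ofLocal g (p ^ k) = g p k := by
  rw [ofLocal_apply g (pow_ne_zero _ hp.ne_zero), hp.factorization_pow,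
    Finsupp.prod_single_index (hg p)]

theorem abs_ofLocal_le_one {g : ℕ → ℕ → ℝ} (hg : ∀ p k, |g p k| ≤ 1) (n : ℕ) :
    |ofLocal g n| ≤ 1 := by
  rcases eq_or_ne n 0 with rfl | hn
  · simp
  rw [ofLocal_apply g hn, Finsupp.prod, Finset.abs_prod]
  exact Finset.prod_le_one (fun _ _ => abs_nonneg _) fun _ _ => hg _ _

/-! ### Sums of two squares and the Dirichlet inverse of their indicator -/

/-- Local data of the indicator of the positive sums of two squares: even exponents at the primes
congruent to `3` modulo `4`. -/
noncomputable def sosLocal (p k : ℕ) : ℝ := if p % 4 = 3 ∧ ¬ Even k then 0 else 1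

/-- The indicator function of the positive integers that are sums of two squares. -/
noncomputable def sos : ArithmeticFunction ℝ := ofLocal sosLocal

/-- Local data of the Dirichlet inverse of `sos`. -/
noncomputable def sosInvLocal (p k : ℕ) : ℝ :=
  if k = 0 then 1 else if k = (if p % 4 = 3 then 2 else 1) then -1 else 0

/-- The Dirichlet inverse of `sos`. -/
noncomputable def sosInv : ArithmeticFunction ℝ := ofLocal sosInvLocal

theorem sosLocal_zero (p : ℕ) : sosLocal p 0 = 1 := by simp [sosLocal]

theorem sosInvLocal_zero (p : ℕ) : sosInvLocal p 0 = 1 := by simp [sosInvLocal]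

theorem sos_one : sos 1 = 1 := ofLocal_one _

theorem sos_eq_one_iff {n : ℕ} (hn : n ≠ 0) :
    sos n = 1 ↔ ∀ p : ℕ, p.Prime → p % 4 = 3 → Even (n.factorization p) := by
  rw [sos, ofLocal_apply _ hn, Finsupp.prod]
  constructor
  · intro h p hp hp4
    by_contra hodd
    have hmem : p ∈ n.factorization.support := by
      rw [Finsupp.mem_support_iff]
      rintro h0
      simp [h0] at hodd
    rw [Finset.prod_eq_zero hmem (by simp [sosLocal, hp4, hodd])] at h
    exact zero_ne_one h
  · intro h
    refine Finset.prod_eq_one fun p hp => ?_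
    have hp' : p.Prime := Nat.prime_of_mem_primeFactors (by simpa using hp)
    simp only [sosLocal]
    rw [if_neg]
    rintro ⟨h4, hodd⟩
    exact hodd (h p hp' h4)

theorem sos_eq_zero_or_one (n : ℕ) : sos n = 0 ∨ sos n = 1 := by
  rcases eq_or_ne n 0 with rfl | hn
  · simp
  rw [sos, ofLocal_apply _ hn, Finsupp.prod]
  by_cases h : ∃ p ∈ n.factorization.support, sosLocal p (n.factorization p) = 0
  · obtain ⟨p, hp, h0⟩ := h
    exact Or.inl (Finset.prod_eq_zero hp h0)
  · push Not at h
    refine Or.inr (Finset.prod_eq_one fun p hp => ?_)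
    have := h p hp
    unfold sosLocal at this ⊢
    split_ifs at this ⊢ <;> simp_all

theorem sos_nonneg (n : ℕ) : 0 ≤ sos n := by
  rcases sos_eq_zero_or_one n with h | h <;> simp [h]

theorem sos_le_one (n : ℕ) : sos n ≤ 1 := by
  rcases sos_eq_zero_or_one n with h | h <;> simp [h]

/-- The two-squares theorem, in terms of `sos`. -/
theorem sos_eq_one_iff_exists {n : ℕ} (hn : n ≠ 0) :
    sos n = 1 ↔ ∃ x y : ℕ, n = x ^ 2 + y ^ 2 := by
  rw [Nat.eq_sq_add_sq_iff, sos_eq_one_iff hn]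
  constructor
  · intro h q hq h4
    have hq' := Nat.prime_of_mem_primeFactors hq
    have := h q hq' h4
    rwa [Nat.factorization_def _ hq'] at this
  · intro h p hp h4
    by_cases hmem : p ∈ n.primeFactors
    · rw [Nat.factorization_def _ hp]
      exact h p hmem h4
    · have : n.factorization p = 0 := by
        rwa [← Finsupp.notMem_support_iff, Nat.support_factorization]
      simp [this]

theorem abs_sosInv_le_one (n : ℕ) : |sosInv n| ≤ 1 := by
  refine abs_ofLocal_le_one (fun p k => ?_) n
  unfold sosInvLocal
  split_ifs <;> simp

/-- Both sides are multiplicative, and at each prime the local series is a geometric series in `x`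
or in `x ^ 2`, with inverse `1 - x` or `1 - x ^ 2`. -/
theorem sos_mul_sosInv : sos * sosInv = 1 := by
  have h1 : (sos * sosInv).IsMultiplicative :=
    (ofLocal_isMultiplicative _).mul (ofLocal_isMultiplicative _)
  rw [ArithmeticFunction.IsMultiplicative.eq_iff_eq_on_prime_powers _ h1 _
    ArithmeticFunction.isMultiplicative_one]
  intro p i hp
  rw [ArithmeticFunction.mul_apply, Nat.sum_divisorsAntidiagonal (fun a b => sos a * sosInv b),
    Nat.sum_divisors_prime_pow hp]
  have h2 : ∀ k ∈ Finset.range (i + 1), sos (p ^ k) * sosInv (p ^ i / p ^ k)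
      = sosLocal p k * sosInvLocal p (i - k) := by
    intro k hk
    have hk' : k ≤ i := Nat.lt_succ_iff.1 (Finset.mem_range.1 hk)
    rw [Nat.pow_div hk' hp.pos, sos, sosInv, ofLocal_prime_pow sosLocal_zero hp,
      ofLocal_prime_pow sosInvLocal_zero hp]
  rw [Finset.sum_congr rfl h2]
  rcases i with _ | _ | i
  · simp [sosLocal, sosInvLocal]
  · have : p ≠ 1 := hp.one_lt.ne'
    by_cases h4 : p % 4 = 3 <;>
      simp [Finset.sum_range_succ, sosLocal, sosInvLocal, h4, this]
  · rw [ArithmeticFunction.one_apply_ne (by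
      exact (Nat.one_lt_pow (by omega) hp.one_lt).ne')]
    rw [Finset.sum_range_succ, Finset.sum_range_succ, Finset.sum_range_succ,
      Finset.sum_eq_zero]
    · rw [show i + 1 + 1 - i = 2 by omega, show i + 1 + 1 - (i + 1) = 1 by omega, Nat.sub_self]
      by_cases h4 : p % 4 = 3
      · by_cases hi : Even i <;> simp [sosLocal, sosInvLocal, h4, Nat.even_add_one, hi]
      · simp [sosLocal, sosInvLocal, h4]
    · intro k hk
      have hk' := Finset.mem_range.1 hk
      simp only [sosInvLocal]
      rw [if_neg (by omega), if_neg (by split_ifs <;> omega), mul_zero]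

/-! ### Counting coprime pairs of sums of two squares -/

/-- The number of positive sums of two squares up to `x`. -/
noncomputable def sosCount (x : ℝ) : ℝ := ∑ n ∈ Finset.Icc 1 ⌊x⌋₊, sos n

/-- The number of coprime pairs of positive sums of two squares up to `n`. -/
noncomputable def coprimePairCount (n : ℕ) : ℝ :=
  ∑ a ∈ Finset.Icc 1 n, ∑ b ∈ Finset.Icc 1 n, if a.Coprime b then sos a * sos b else 0

theorem sos_mul_of_coprime {a b : ℕ} (h : a.Coprime b) : sos (a * b) = sos a * sos b :=
  (ofLocal_isMultiplicative sosLocal).2 h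

theorem sos_mul_sq {n k : ℕ} (hn : n ≠ 0) (hk : k ≠ 0) : sos (n * k ^ 2) = 1 ↔ sos n = 1 := by
  rw [sos_eq_one_iff (by positivity), sos_eq_one_iff hn]
  refine forall_congr' fun p => forall_congr' fun _ => forall_congr' fun _ => ?_
  rw [Nat.factorization_mul hn (by positivity), Nat.factorization_pow]
  simp [Nat.even_add]

/-- Splitting off the greatest common divisor of a pair of sums of two squares. -/
theorem sos_mul_mul {g a b : ℕ} (hg : g ≠ 0) (ha : a ≠ 0) (hb : b ≠ 0) (h : a.Coprime b) :
    sos (g * a) * sos (g * b) = sos g * (sos a * sos b) := by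
  have key : sos (g * a) = 1 ∧ sos (g * b) = 1 ↔ sos g = 1 ∧ sos a = 1 ∧ sos b = 1 := by
    rw [sos_eq_one_iff (by positivity), sos_eq_one_iff (by positivity), sos_eq_one_iff hg,
      sos_eq_one_iff ha, sos_eq_one_iff hb]
    simp only [Nat.factorization_mul hg ha, Nat.factorization_mul hg hb, Finsupp.add_apply,
      Nat.even_add]
    have hz : ∀ p : ℕ, a.factorization p = 0 ∨ b.factorization p = 0 := by
      intro p
      by_contra! hcon
      have h1 : p ∈ a.primeFactors := by
        rw [← Nat.support_factorization, Finsupp.mem_support_iff]; exact hcon.1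
      have h2 : p ∈ b.primeFactors := by
        rw [← Nat.support_factorization, Finsupp.mem_support_iff]; exact hcon.2
      exact Finset.disjoint_left.1 h.disjoint_primeFactors h1 h2
    constructor
    · rintro ⟨h1, h2⟩
      have : ∀ p : ℕ, p.Prime → p % 4 = 3 → Even (g.factorization p) := by
        intro p hp h4
        rcases hz p with h0 | h0
        · exact (h1 p hp h4).2 (by simp [h0])
        · exact (h2 p hp h4).2 (by simp [h0])
      exact ⟨this, fun p hp h4 => (h1 p hp h4).1 (this p hp h4),
        fun p hp h4 => (h2 p hp h4).1 (this p hp h4)⟩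
    · rintro ⟨h0, h1, h2⟩
      exact ⟨fun p hp h4 => iff_of_true (h0 p hp h4) (h1 p hp h4),
        fun p hp h4 => iff_of_true (h0 p hp h4) (h2 p hp h4)⟩
  rcases sos_eq_zero_or_one (g * a) with h1 | h1 <;>
  rcases sos_eq_zero_or_one (g * b) with h2 | h2 <;>
  rcases sos_eq_zero_or_one g with h3 | h3 <;> rcases sos_eq_zero_or_one a with h4 | h4 <;>
  rcases sos_eq_zero_or_one b with h5 | h5 <;> simp [h1, h2, h3, h4, h5] at key ⊢

/-- Clearing denominators multiplies `n` by a square, which does not affect the parity of the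
exponents in its factorization. -/
theorem exists_rat_sq_add_sq_iff {n : ℕ} (hn : n ≠ 0) :
    (∃ x y : ℚ, (n : ℚ) = x ^ 2 + y ^ 2) ↔ sos n = 1 := by
  rw [sos_eq_one_iff_exists hn]
  constructor
  · rintro ⟨x, y, h⟩
    have hk : x.den * y.den ≠ 0 := mul_ne_zero x.den_ne_zero y.den_ne_zero
    rw [← sos_eq_one_iff_exists hn, ← sos_mul_sq hn hk, sos_eq_one_iff_exists (by positivity)]
    refine ⟨(x.num * y.den).natAbs, (y.num * x.den).natAbs, ?_⟩
    zify
    rw [sq_abs, sq_abs]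
    have hx : (x.den : ℚ) ≠ 0 := by exact_mod_cast x.den_ne_zero
    have hy : (y.den : ℚ) ≠ 0 := by exact_mod_cast y.den_ne_zero
    have h1 : x = x.num / x.den := (Rat.num_div_den x).symm
    have h2 : y = y.num / y.den := (Rat.num_div_den y).symm
    rw [h1, h2] at h
    field_simp at h
    have h3 : ((n * (x.den * y.den) ^ 2 : ℤ) : ℚ) =
        ((x.num * y.den) ^ 2 + (y.num * x.den) ^ 2 : ℤ) := by
      push_cast
      linarith
    exact_mod_cast h3
  · rintro ⟨x, y, h⟩
    exact ⟨x, y, by exact_mod_cast h⟩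

/-- Since `a / b = (a * b) / b ^ 2`, the quotient is represented if and only if `a * b` is; for
coprime `a` and `b` the exponents in `a * b` are those of `a` and of `b`. -/
theorem rat_sum_two_squares_iff {a b : ℕ} (ha : a ≠ 0) (hb : b ≠ 0) (h : a.Coprime b) :
    (∃ x y : ℚ, (a / b : ℚ) = x ^ 2 + y ^ 2) ↔ sos a = 1 ∧ sos b = 1 := by
  have hb' : (b : ℚ) ≠ 0 := by exact_mod_cast hb
  have h1 : (∃ x y : ℚ, (a / b : ℚ) = x ^ 2 + y ^ 2) ↔
      ∃ x y : ℚ, ((a * b : ℕ) : ℚ) = x ^ 2 + y ^ 2 := by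
    constructor
    · rintro ⟨x, y, h⟩
      refine ⟨x * b, y * b, ?_⟩
      push_cast
      rw [mul_pow, mul_pow, ← add_mul, ← h]
      field_simp
    · rintro ⟨x, y, h⟩
      refine ⟨x / b, y / b, ?_⟩
      push_cast at h
      field_simp
      linarith
  rw [h1, exists_rat_sq_add_sq_iff (mul_ne_zero ha hb), sos_mul_of_coprime h]
  rcases sos_eq_zero_or_one a with h2 | h2 <;> rcases sos_eq_zero_or_one b with h3 | h3 <;>
    simp [h2, h3]

/-- The summand `1` accounts for the rational number `0`; every other number counted is positive and
is the quotient of a unique coprime pair. -/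
theorem sumTwoSquaresCount_eq {B : ℝ} (hB : 1 ≤ B) :
    (sumTwoSquaresCount B : ℝ) = 1 + coprimePairCount ⌊B⌋₊ := by
  classical
  set n := ⌊B⌋₊ with hn
  set P : Finset (ℕ × ℕ) := (Finset.Icc 1 n ×ˢ Finset.Icc 1 n).filter
    (fun q => q.1.Coprime q.2 ∧ sos q.1 = 1 ∧ sos q.2 = 1) with hP
  have h1 : coprimePairCount n = (P.card : ℝ) := by
    rw [coprimePairCount, ← Finset.sum_product', hP, Finset.card_filter]
    push_cast
    refine Finset.sum_congr rfl fun q _ => ?_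
    rcases sos_eq_zero_or_one q.1 with h2 | h2 <;> rcases sos_eq_zero_or_one q.2 with h3 | h3 <;>
      simp [h2, h3]
  have hheight : ∀ t : ℚ, Height.mulHeight₁ t ≤ B ↔ t.num.natAbs ≤ n ∧ t.den ≤ n := by
    intro t
    rw [Rat.mulHeight₁_eq_max, ← max_le_iff, hn, Nat.le_floor_iff (by linarith)]
  have h2 : sumTwoSquaresSet B =
      insert 0 ((fun q : ℕ × ℕ => (q.1 / q.2 : ℚ)) '' (P : Set (ℕ × ℕ))) := by
    ext t
    constructor
    · rintro ⟨hH, x, y, hxy⟩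
      rcases eq_or_ne t 0 with rfl | ht
      · exact Set.mem_insert _ _
      · have htpos : 0 < t := lt_of_le_of_ne (by rw [hxy]; positivity) ht.symm
        have hnum : 0 < t.num := Rat.num_pos.2 htpos
        have hcast : ((t.num.natAbs : ℕ) : ℚ) = t.num := by
          have : ((t.num.natAbs : ℕ) : ℤ) = t.num := Int.natAbs_of_nonneg hnum.le
          conv_rhs => rw [← this, Int.cast_natCast]
        have hteq : ((t.num.natAbs : ℕ) : ℚ) / (t.den : ℚ) = t := by
          rw [hcast, Rat.num_div_den]
        refine Set.mem_insert_of_mem _ ⟨(t.num.natAbs, t.den), ?_, hteq⟩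
        have h3 := (rat_sum_two_squares_iff (a := t.num.natAbs) (b := t.den) (by omega)
          t.den_ne_zero t.reduced).1 ⟨x, y, by rw [hteq, hxy]⟩
        obtain ⟨h4, h5⟩ := (hheight t).1 hH
        have h6 := t.den_pos
        simp only [hP, Finset.coe_filter, Set.mem_ofPred_eq, Finset.mem_product, Finset.mem_Icc]
        exact ⟨⟨⟨by omega, h4⟩, ⟨h6, h5⟩⟩, t.reduced, h3⟩
    · rintro (rfl | ⟨q, hq, rfl⟩)
      · refine ⟨?_, 0, 0, by simp⟩
        rw [hheight]
        simp only [Rat.num_zero, Int.natAbs_zero, zero_le, Rat.den_zero, true_and, hn]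
        exact Nat.le_floor (by simpa using hB)
      · simp only [hP, Finset.coe_filter, Set.mem_ofPred_eq, Finset.mem_product,
          Finset.mem_Icc] at hq
        obtain ⟨⟨⟨ha, ha'⟩, hb, hb'⟩, hc, hs⟩ := hq
        refine ⟨?_, (rat_sum_two_squares_iff (by omega) (by omega) hc).2 hs⟩
        rw [hheight]
        have hb0 : (0 : ℤ) < q.2 := by exact_mod_cast hb
        have e1 := Rat.num_div_eq_of_coprime (a := q.1) (b := q.2) hb0 (by simpa using hc)
        have e2 := Rat.den_div_eq_of_coprime (a := q.1) (b := q.2) hb0 (by simpa using hc)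
        simp only [Int.cast_natCast] at e1 e2
        dsimp only
        rw [e1]
        constructor
        · simpa using ha'
        · exact_mod_cast (by rw [e2]; exact_mod_cast hb' : (((q.1 / q.2 : ℚ).den : ℕ) : ℤ) ≤ n)
  have hinj : Set.InjOn (fun q : ℕ × ℕ => (q.1 / q.2 : ℚ)) (P : Set (ℕ × ℕ)) := by
    rintro ⟨a, b⟩ hq ⟨a', b'⟩ hq' h
    simp only [hP, Finset.coe_filter, Set.mem_ofPred_eq, Finset.mem_product,
      Finset.mem_Icc] at hq hq'
    obtain ⟨⟨⟨ha, -⟩, hb, -⟩, hc, -⟩ := hq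
    obtain ⟨⟨⟨ha', -⟩, hb', -⟩, hc', -⟩ := hq'
    have := Rat.div_int_inj (a := a) (b := b) (c := a') (d := b') (by exact_mod_cast hb)
      (by exact_mod_cast hb') (by simpa using hc) (by simpa using hc') (by simpa using h)
    simp only [Prod.mk.injEq]
    exact ⟨by exact_mod_cast this.1, by exact_mod_cast this.2⟩
  have h0 : (0 : ℚ) ∉ (fun q : ℕ × ℕ => (q.1 / q.2 : ℚ)) '' (P : Set (ℕ × ℕ)) := by
    rintro ⟨q, hq, h⟩
    simp only [hP, Finset.coe_filter, Set.mem_ofPred_eq, Finset.mem_product, Finset.mem_Icc] at hq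
    have h1 : (q.1 : ℚ) ≠ 0 := by exact_mod_cast (by omega : q.1 ≠ 0)
    have h2 : (q.2 : ℚ) ≠ 0 := by exact_mod_cast (by omega : q.2 ≠ 0)
    exact div_ne_zero h1 h2 h
  rw [sumTwoSquaresCount, h2, Set.ncard_insert_of_notMem h0 (P.finite_toSet.image _),
    hinj.ncard_image, Set.ncard_coe_finset, h1]
  push_cast
  ring

/-- Möbius inversion over the sums of two squares: the function `sosInv` detects that a common
divisor is trivial. -/
theorem sum_divisors_gcd_sosInv {a b : ℕ} (ha : a ≠ 0) (hb : b ≠ 0) :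
    (if a.Coprime b then sos a * sos b else 0) =
      ∑ g ∈ (a.gcd b).divisors, sosInv g * (sos (a / g) * sos (b / g)) := by
  obtain ⟨d, a', b', hd, hc, rfl, rfl⟩ := Nat.exists_coprime' (Nat.gcd_pos_of_pos_left b ha.bot_lt)
  have ha' : a' ≠ 0 := left_ne_zero_of_mul ha
  have hb' : b' ≠ 0 := left_ne_zero_of_mul hb
  have hg : (a' * d).gcd (b' * d) = d := by
    rw [Nat.gcd_mul_right, hc.gcd_eq_one, one_mul]
  simp only [Nat.coprime_iff_gcd_eq_one, hg]
  have h1 : ∀ g ∈ d.divisors, sosInv g * (sos (a' * d / g) * sos (b' * d / g)) =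
      sos (d / g) * sosInv g * (sos a' * sos b') := by
    intro g hg
    have hgd := Nat.dvd_of_mem_divisors hg
    rw [Nat.mul_div_assoc _ hgd, Nat.mul_div_assoc _ hgd, mul_comm a', mul_comm b',
      sos_mul_mul (Nat.div_pos (Nat.le_of_dvd hd hgd) (Nat.pos_of_mem_divisors hg)).ne' ha' hb' hc]
    ring
  rw [Finset.sum_congr rfl h1, ← Finset.sum_mul,
    ← Nat.sum_divisorsAntidiagonal' (fun x y => sos x * sosInv y), ← ArithmeticFunction.mul_apply,
    sos_mul_sosInv, ArithmeticFunction.one_apply]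
  split_ifs with h
  · rw [h]; simp
  · simp

theorem sum_Icc_dvd {n g : ℕ} (hg : 0 < g) (u : ℕ → ℝ) :
    ∑ a ∈ (Finset.Icc 1 n).filter (g ∣ ·), u (a / g) = ∑ a ∈ Finset.Icc 1 (n / g), u a := by
  refine Finset.sum_nbij' (· / g) (· * g) ?_ ?_ ?_ ?_ ?_
  · intro a ha
    simp only [Finset.mem_filter, Finset.mem_Icc] at ha ⊢
    obtain ⟨⟨h1, h2⟩, h3⟩ := ha
    exact ⟨Nat.div_pos (Nat.le_of_dvd h1 h3) hg, Nat.div_le_div_right h2⟩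
  · intro a ha
    simp only [Finset.mem_filter, Finset.mem_Icc] at ha ⊢
    exact ⟨⟨Nat.mul_pos ha.1 hg, (Nat.le_div_iff_mul_le hg).1 ha.2⟩, Nat.dvd_mul_left _ _⟩
  · intro a ha
    exact Nat.div_mul_cancel (Finset.mem_filter.1 ha).2
  · intro a _
    exact Nat.mul_div_cancel _ hg
  · intro a _
    rfl

theorem coprimePairCount_eq_sum (n : ℕ) :
    coprimePairCount n =
      ∑ g ∈ Finset.Icc 1 n, sosInv g * (∑ a ∈ Finset.Icc 1 (n / g), sos a) ^ 2 := by
  have h1 : ∀ a ∈ Finset.Icc 1 n, ∀ b ∈ Finset.Icc 1 n,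
      (if a.Coprime b then sos a * sos b else 0) = ∑ g ∈ Finset.Icc 1 n,
        sosInv g * ((if g ∣ a then sos (a / g) else 0) * (if g ∣ b then sos (b / g) else 0)) := by
    intro a ha b hb
    rw [Finset.mem_Icc] at ha hb
    rw [sum_divisors_gcd_sosInv (by omega) (by omega)]
    refine Finset.sum_subset_zero_on_sdiff ?_ ?_ ?_
    · intro g hg
      have := Nat.dvd_gcd_iff.1 (Nat.dvd_of_mem_divisors hg)
      exact Finset.mem_Icc.2 ⟨Nat.pos_of_mem_divisors hg, (Nat.le_of_dvd ha.1 this.1).trans ha.2⟩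
    · intro g hg
      have h2 : ¬ (g ∣ a ∧ g ∣ b) := by
        intro h
        exact (Finset.mem_sdiff.1 hg).2 (Nat.mem_divisors.2
          ⟨Nat.dvd_gcd h.1 h.2, (Nat.gcd_pos_of_pos_left b ha.1).ne'⟩)
      by_cases h3 : g ∣ a
      · have h4 : ¬ g ∣ b := fun h => h2 ⟨h3, h⟩
        simp [h4]
      · simp [h3]
    · intro g hg
      have := Nat.dvd_gcd_iff.1 (Nat.dvd_of_mem_divisors hg)
      rw [if_pos this.1, if_pos this.2]
  rw [coprimePairCount, Finset.sum_congr rfl fun a ha => Finset.sum_congr rfl (h1 a ha)]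
  rw [Finset.sum_congr rfl fun a _ => Finset.sum_comm, Finset.sum_comm]
  refine Finset.sum_congr rfl fun g hg => ?_
  have hg' := (Finset.mem_Icc.1 hg).1
  rw [← sum_Icc_dvd hg' (fun k => sos k), Finset.sum_filter, sq, Finset.sum_mul_sum,
    Finset.mul_sum]
  exact Finset.sum_congr rfl fun a _ => (Finset.mul_sum _ _ _).symm

/-- The coprime pairs counted through `sosCount`; the sum is finite since `sosCount` vanishes
below `1`. -/
theorem coprimePairCount_floor_eq_tsum (x : ℝ) :
    coprimePairCount ⌊x⌋₊ = ∑' g : ℕ, sosInv g * sosCount (x / g) ^ 2 := by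
  rw [coprimePairCount_eq_sum, tsum_eq_sum (s := Finset.Icc 1 ⌊x⌋₊)]
  · refine Finset.sum_congr rfl fun g _ => ?_
    rw [sosCount, Nat.floor_div_natCast]
  · intro g hg
    rcases Nat.eq_zero_or_pos g with rfl | hg0
    · simp
    · have : ⌊x / g⌋₊ = 0 := by
        rw [Nat.floor_div_natCast, Nat.div_eq_zero_iff]
        right
        simp only [Finset.mem_Icc, not_and, not_le] at hg
        exact hg hg0
      simp [sosCount, this]

/-! ### The Dirichlet series of the sums of two squares -/

/-- The nontrivial Dirichlet character modulo `4`. -/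
noncomputable def chi4 : DirichletCharacter ℂ 4 := ZMod.χ₄.ringHomComp (Int.castRingHom ℂ)

theorem chi4_apply (n : ℕ) :
    chi4 n = if n % 2 = 0 then 0 else if n % 4 = 1 then 1 else -1 := by
  have : chi4 n = ((ZMod.χ₄ (n : ZMod 4) : ℤ) : ℂ) := rfl
  rw [this, ZMod.χ₄_nat_eq_if_mod_four]
  split_ifs <;> simp

theorem one_apply_four (n : ℕ) :
    (1 : DirichletCharacter ℂ 4) n = if n % 2 = 0 then 0 else 1 := by
  split_ifs with h
  · rw [MulChar.map_nonunit]
    rw [ZMod.isUnit_iff_coprime]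
    intro hc
    have h2 : 2 ∣ Nat.gcd n 4 := Nat.dvd_gcd (Nat.dvd_of_mod_eq_zero h) (by norm_num)
    rw [hc.gcd_eq_one] at h2
    omega
  · rw [MulChar.one_apply]
    rw [ZMod.isUnit_iff_coprime]
    exact Nat.Coprime.pow_right 2 (Nat.coprime_two_right.2 (Nat.odd_iff.2 (by omega)))

theorem chi4_ne_one : chi4 ≠ 1 := by
  intro h
  have h1 := chi4_apply 3
  rw [h, one_apply_four] at h1
  norm_num at h1

theorem chi4_sq : chi4 ^ 2 = 1 := by
  ext a
  have key : ∀ n : ℕ, (chi4 ^ 2) (n : ZMod 4) = (1 : DirichletCharacter ℂ 4) n := by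
    intro n
    rw [MulChar.pow_apply' _ two_ne_zero, chi4_apply, one_apply_four]
    split_ifs <;> simp
  have := key (a : ZMod 4).val
  simpa using this

/-- The indicator of the positive integers all of whose prime factors are congruent to `3`
modulo `4`. -/
noncomputable def threeModFour : ℕ →*₀ ℂ where
  toFun n := if n ≠ 0 ∧ ∀ p ∈ n.primeFactors, p % 4 = 3 then 1 else 0
  map_zero' := by simp
  map_one' := by simp
  map_mul' m n := by
    rcases eq_or_ne m 0 with rfl | hm
    · simp
    rcases eq_or_ne n 0 with rfl | hn
    · simp
    rw [Nat.primeFactors_mul hm hn]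
    simp only [Finset.mem_union, or_imp, forall_and, ne_eq, mul_eq_zero, hm, hn, or_self,
      not_false_eq_true, true_and]
    split_ifs <;> simp_all

theorem threeModFour_prime {p : ℕ} (hp : p.Prime) :
    threeModFour p = if p % 4 = 3 then 1 else 0 := by
  change (if p ≠ 0 ∧ ∀ q ∈ p.primeFactors, q % 4 = 3 then (1 : ℂ) else 0) = _
  rw [hp.primeFactors]
  simp [hp.ne_zero]

theorem norm_threeModFour_le_one (n : ℕ) : ‖threeModFour n‖ ≤ 1 := by
  change ‖(if n ≠ 0 ∧ ∀ q ∈ n.primeFactors, q % 4 = 3 then (1 : ℂ) else 0)‖ ≤ 1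
  split_ifs <;> simp

theorem LSeriesSummable_of_norm_le_one {f : ℕ → ℂ} (hf : ∀ n, ‖f n‖ ≤ 1) {s : ℂ}
    (hs : 1 < s.re) : LSeriesSummable f s :=
  LSeriesSummable_of_le_const_mul_rpow (x := 1) hs ⟨1, fun n _ => by simpa using hf n⟩

theorem abscissaOfAbsConv_le_one {f : ℕ → ℂ} (hf : ∀ n, ‖f n‖ ≤ 1) :
    LSeries.abscissaOfAbsConv f ≤ 1 :=
  LSeries.abscissaOfAbsConv_le_of_le_const ⟨1, fun n _ => hf n⟩

theorem norm_sos_le_one (n : ℕ) : ‖(sos n : ℂ)‖ ≤ 1 := by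
  rw [Complex.norm_real, Real.norm_of_nonneg (sos_nonneg n)]
  exact sos_le_one n

/-- The Dirichlet series of the sums of two squares. -/
noncomputable def sosSeries (s : ℂ) : ℂ := LSeries (fun n => (sos n : ℂ)) s

theorem norm_prime_cpow_lt_one {s : ℂ} (hs : 0 < s.re) {p : ℕ} (hp : p.Prime) :
    ‖(p : ℂ) ^ (-s)‖ < 1 := by
  rw [Complex.norm_natCast_cpow_of_pos hp.pos, Complex.neg_re]
  exact Real.rpow_lt_one_of_one_lt_of_neg (by exact_mod_cast hp.one_lt) (by linarith)

theorem term_eq_mul_cpow (f : ℕ → ℂ) (h0 : f 0 = 0) (s : ℂ) (n : ℕ) :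
    LSeries.term f s n = f n * (n : ℂ) ^ (-s) := by
  rcases eq_or_ne n 0 with rfl | hn
  · simp [h0]
  · rw [LSeries.term_of_ne_zero hn, Complex.cpow_neg, div_eq_mul_inv]

/-- The Euler product of the Dirichlet series of the sums of two squares. -/
theorem sosSeries_hasProd {s : ℂ} (hs : 1 < s.re) :
    HasProd (fun p : Nat.Primes => if (p : ℕ) % 4 = 3 then (1 - ((p : ℂ) ^ (-s)) ^ 2)⁻¹
      else (1 - (p : ℂ) ^ (-s))⁻¹) (sosSeries s) := by
  have hterm := term_eq_mul_cpow (fun n => (sos n : ℂ)) (by simp) s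
  have h := EulerProduct.eulerProduct_hasProd (f := LSeries.term (fun n => (sos n : ℂ)) s)
    (by simp [sos_one]) ?_ (LSeriesSummable_of_norm_le_one norm_sos_le_one hs).norm
    (by simp)
  · refine Eq.mp (congrArg (HasProd · _) (funext fun p => ?_)) h
    have hp := p.prop
    set x : ℂ := (p : ℂ) ^ (-s) with hx
    have hx1 : ‖x‖ < 1 := norm_prime_cpow_lt_one (by linarith) hp
    have he : ∀ e : ℕ, LSeries.term (fun n => (sos n : ℂ)) s ((p : ℕ) ^ e) =
        (sosLocal p e : ℂ) * x ^ e := by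
      intro e
      rw [hterm, sos, ofLocal_prime_pow sosLocal_zero hp, hx, Nat.cast_pow,
        ← Complex.natCast_cpow_natCast_mul, ← Complex.cpow_nat_mul, mul_comm]
    simp_rw [he]
    split_ifs with h4
    · have h1 := hasSum_geometric_of_norm_lt_one hx1
      have h2 := hasSum_geometric_of_norm_lt_one (ξ := -x) (by rwa [norm_neg])
      have h3 := (h1.add h2).div_const 2
      have h5 : ∀ e : ℕ, (sosLocal p e : ℂ) * x ^ e = (x ^ e + (-x) ^ e) / 2 := by
        intro e
        by_cases hev : Even e
        · simp [sosLocal, hev, hev.neg_pow]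
        · simp [sosLocal, hev, h4, (Nat.not_even_iff_odd.1 hev).neg_pow]
      simp_rw [h5]
      rw [h3.tsum_eq]
      have e1 : (1 : ℂ) - x ≠ 0 := fun h => by
        rw [← sub_eq_zero.1 h] at hx1; simp at hx1
      have e2 : (1 : ℂ) - -x ≠ 0 := fun h => by
        have : x = -1 := by linear_combination h
        rw [this] at hx1; simp at hx1
      have e3 : (1 : ℂ) - x ^ 2 ≠ 0 := by
        have : (1 : ℂ) - x ^ 2 = (1 - x) * (1 - -x) := by ring
        rw [this]; exact mul_ne_zero e1 e2
      field_simp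
      ring
    · have : ∀ e : ℕ, (sosLocal p e : ℂ) * x ^ e = x ^ e := by
        intro e; simp [sosLocal, h4]
      simp_rw [this]
      exact tsum_geometric_of_norm_lt_one hx1
  · intro m n hmn
    rw [hterm, hterm, hterm, sos_mul_of_coprime hmn]
    push_cast
    rw [Complex.natCast_mul_natCast_cpow]
    ring

/-- The Euler product over the primes congruent to `3` modulo `4`. -/
theorem threeModFour_hasProd {s : ℂ} (hs : 1 < s.re) :
    HasProd (fun p : Nat.Primes => (1 - (if (p : ℕ) % 4 = 3 then (p : ℂ) ^ (-s) else 0))⁻¹)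
      (LSeries threeModFour s) := by
  have hterm := term_eq_mul_cpow threeModFour (by simp) s
  have h := EulerProduct.eulerProduct_hasProd (f := LSeries.term threeModFour s)
    (by simp) ?_ (LSeriesSummable_of_norm_le_one norm_threeModFour_le_one hs).norm
    (by simp)
  · refine Eq.mp (congrArg (HasProd · _) (funext fun p => ?_)) h
    have hp := p.prop
    have hx1 : ‖(p : ℂ) ^ (-s)‖ < 1 := norm_prime_cpow_lt_one (by linarith) hp
    have he : ∀ e : ℕ, LSeries.term threeModFour s ((p : ℕ) ^ e) =
        (if (p : ℕ) % 4 = 3 then (p : ℂ) ^ (-s) else 0) ^ e := by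
      intro e
      rw [hterm, map_pow, threeModFour_prime hp, Nat.cast_pow,
        ← Complex.natCast_cpow_natCast_mul, mul_comm (e : ℂ), Complex.cpow_mul_nat, ← mul_pow]
      split_ifs <;> simp
    simp_rw [he]
    refine tsum_geometric_of_norm_lt_one ?_
    split_ifs
    · exact hx1
    · simp
  · intro m n _
    rw [hterm, hterm, hterm, map_mul]
    push_cast
    rw [Complex.natCast_mul_natCast_cpow]
    ring

/-- The square of the Dirichlet series of the sums of two squares is, up to factors that are
regular and nonvanishing on `1 ≤ re s`, the product of the two `L`-functions modulo `4`. -/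
theorem sosSeries_sq {s : ℂ} (hs : 1 < s.re) :
    sosSeries s ^ 2 = DirichletCharacter.LFunctionTrivChar 4 s *
      DirichletCharacter.LFunction chi4 s * ((1 - (2 : ℂ) ^ (-s))⁻¹) ^ 2 *
      LSeries threeModFour (2 * s) := by
  have h1 := (sosSeries_hasProd hs).mul (sosSeries_hasProd hs)
  have h2 := DirichletCharacter.LSeries_eulerProduct_hasProd (1 : DirichletCharacter ℂ 4) hs
  have h3 := DirichletCharacter.LSeries_eulerProduct_hasProd chi4 hs
  have h4 : HasProd (fun p : Nat.Primes => if (p : ℕ) = 2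
      then ((1 - (2 : ℂ) ^ (-s))⁻¹) ^ 2 else 1) (((1 - (2 : ℂ) ^ (-s))⁻¹) ^ 2) := by
    convert! hasProd_single (⟨2, Nat.prime_two⟩ : Nat.Primes) ?_ using 1
    intro p hp
    rw [if_neg fun h => hp (Subtype.ext h)]
  have h5 := threeModFour_hasProd (s := 2 * s) (by simp; linarith)
  rw [← DirichletCharacter.LFunction_eq_LSeries _ hs] at h2 h3
  have h6 := ((h2.mul h3).mul h4).mul h5
  rw [sq]
  refine h1.unique ?_
  convert h6 using 1
  ext p
  have hp := p.prop
  have hx1 : ‖(p : ℂ) ^ (-s)‖ < 1 := norm_prime_cpow_lt_one (by linarith) hp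
  rw [one_apply_four, chi4_apply, show -(2 * s) = ((2 : ℕ) : ℂ) * (-s) by push_cast; ring,
    Complex.cpow_nat_mul]
  rcases hp.eq_two_or_odd with h7 | h7
  · simp only [h7]
    norm_num
    rw [← mul_inv, sq]
  · have h72 : ¬ (p : ℕ) % 2 = 0 := by omega
    have h73 : ¬ (p : ℕ) = 2 := by omega
    simp only [if_neg h72, if_neg h73]
    set x : ℂ := (p : ℂ) ^ (-s) with hx
    have e1 : (1 : ℂ) - x ≠ 0 := fun h => by
      rw [← sub_eq_zero.1 h] at hx1; simp at hx1
    have e2 : (1 : ℂ) + x ≠ 0 := fun h => by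
      have : x = -1 := by linear_combination h
      rw [this] at hx1; simp at hx1
    have e3 : (1 : ℂ) - x ^ 2 ≠ 0 := by
      have : (1 : ℂ) - x ^ 2 = (1 - x) * (1 + x) := by ring
      rw [this]; exact mul_ne_zero e1 e2
    by_cases h8 : (p : ℕ) % 4 = 3
    · have h9 : ¬ (p : ℕ) % 4 = 1 := by omega
      simp only [if_pos h8, if_neg h9]
      have : (1 - x ^ 2) = (1 - x) * (1 + x) := by ring
      rw [this]
      rw [show (1 : ℂ) - -1 * x = 1 + x by ring]
      field_simp
    · have h9 : (p : ℕ) % 4 = 1 := by omega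
      simp [h9]

/-! ### Growth of Dirichlet series with regular partial sums near the line `re s = 1` -/

open MeasureTheory in
/-- The contribution of the regular part `c (t - N)` of the partial sums beyond `N`. -/
theorem integral_Ioi_sub_mul_cpow {N : ℝ} (hN : 0 < N) {s : ℂ} (hs : 1 < s.re) :
    IntegrableOn (fun t : ℝ => ((t - N : ℝ) : ℂ) * (t : ℂ) ^ (-(s + 1))) (Set.Ioi N) ∧
    ∫ t in Set.Ioi N, ((t - N : ℝ) : ℂ) * (t : ℂ) ^ (-(s + 1)) =
      (N : ℂ) ^ (1 - s) / (s * (s - 1)) := by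
  have hN' : (N : ℂ) ≠ 0 := by exact_mod_cast hN.ne'
  have hs0 : s ≠ 0 := fun h => by simp [h] at hs; linarith
  have hs1 : s - 1 ≠ 0 := fun h => by rw [sub_eq_zero.1 h] at hs; simp at hs
  have h1 : Set.EqOn (fun t : ℝ => ((t - N : ℝ) : ℂ) * (t : ℂ) ^ (-(s + 1)))
      (fun t : ℝ => (t : ℂ) ^ (-s) - N * (t : ℂ) ^ (-(s + 1))) (Set.Ioi N) := by
    intro t ht
    have ht' : (t : ℂ) ≠ 0 := by exact_mod_cast (hN.trans ht).ne'
    have : (t : ℂ) ^ (-s) = t * (t : ℂ) ^ (-(s + 1)) := by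
      rw [show -(s + 1) = -s - 1 by ring, Complex.cpow_sub _ _ ht', Complex.cpow_one]
      field_simp
    simp only [this]
    push_cast
    ring
  have i1 : IntegrableOn (fun t : ℝ => (t : ℂ) ^ (-s)) (Set.Ioi N) :=
    integrableOn_Ioi_cpow_of_lt (by simpa using hs) hN
  have i2 : IntegrableOn (fun t : ℝ => (t : ℂ) ^ (-(s + 1))) (Set.Ioi N) :=
    integrableOn_Ioi_cpow_of_lt (by simp; linarith) hN
  refine ⟨(integrableOn_congr_fun h1 measurableSet_Ioi).2 (i1.sub (i2.const_mul _)), ?_⟩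
  rw [setIntegral_congr_fun measurableSet_Ioi h1, integral_sub i1 (i2.const_mul _),
    integral_const_mul, integral_Ioi_cpow_of_lt (by simpa using hs) hN,
    integral_Ioi_cpow_of_lt (by simp; linarith) hN]
  have e1 : (N : ℂ) ^ (1 - s) = N * (N : ℂ) ^ (-s) := by
    rw [show (1 : ℂ) - s = 1 + -s by ring, Complex.cpow_add _ _ hN', Complex.cpow_one]
  rw [show -s + 1 = 1 - s by ring, show -(s + 1) + 1 = -s by ring, e1]
  have : (1 : ℂ) - s ≠ 0 := fun h => hs1 (by linear_combination -h)
  field_simp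
  ring

/-- The remainder `∑_{N < n ≤ t} a n - c (t - N)` for `t > N`, extended by zero. -/
noncomputable def partialSumRemainder (a : ℕ → ℂ) (c : ℂ) (N : ℕ) (t : ℝ) : ℂ :=
  if (N : ℝ) < t then ∑ k ∈ Finset.Icc 1 ⌊t⌋₊, a k - ∑ k ∈ Finset.Icc 1 N, a k - c * (t - N) else 0

theorem measurable_partialSumRemainder (a : ℕ → ℂ) (c : ℂ) (N : ℕ) :
    Measurable (partialSumRemainder a c N) := by
  refine Measurable.ite measurableSet_Ioi ?_ measurable_const
  refine (Measurable.sub ?_ measurable_const).sub (by fun_prop)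
  exact (measurable_from_nat (f := fun n : ℕ => ∑ k ∈ Finset.Icc 1 n, a k)).comp
    Nat.measurable_floor

theorem norm_partialSumRemainder_le {a : ℕ → ℂ} {c : ℂ} {C : ℝ}
    (hA : ∀ N : ℕ, ‖∑ n ∈ Finset.Icc 1 N, a n - c * N‖ ≤ C) (N : ℕ) (t : ℝ) :
    ‖partialSumRemainder a c N t‖ ≤ 2 * C + ‖c‖ := by
  have hC : 0 ≤ C := (norm_nonneg _).trans (hA 0)
  unfold partialSumRemainder
  split_ifs with h
  · have ht : 0 ≤ t := (Nat.cast_nonneg N).trans h.le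
    have e : ∑ k ∈ Finset.Icc 1 ⌊t⌋₊, a k - ∑ k ∈ Finset.Icc 1 N, a k - c * (t - N) =
        (∑ k ∈ Finset.Icc 1 ⌊t⌋₊, a k - c * ⌊t⌋₊) - (∑ k ∈ Finset.Icc 1 N, a k - c * N)
          - c * ((t - ⌊t⌋₊ : ℝ) : ℂ) := by push_cast; ring
    have h2 : ‖((t - ⌊t⌋₊ : ℝ) : ℂ)‖ ≤ 1 := by
      rw [Complex.norm_real, Real.norm_eq_abs, abs_le]
      constructor <;> linarith [Nat.floor_le ht, Nat.lt_floor_add_one t]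
    rw [e]
    calc _ ≤ ‖∑ k ∈ Finset.Icc 1 ⌊t⌋₊, a k - c * ⌊t⌋₊‖ + ‖∑ k ∈ Finset.Icc 1 N, a k - c * N‖
          + ‖c * ((t - ⌊t⌋₊ : ℝ) : ℂ)‖ := norm_sub_le_of_le (norm_sub_le _ _) le_rfl
      _ ≤ C + C + ‖c‖ * 1 := by
          rw [norm_mul]
          gcongr
          · exact hA _
          · exact hA _
      _ = _ := by ring
  · simp only [norm_zero]; positivity

open MeasureTheory in
/-- Partial summation beyond `N`. Multiplying by `s - 1` makes the right-hand side regular on `0 <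
re s`. -/
theorem LSeries_eq_truncated {a : ℕ → ℂ} (ha : ∀ n, ‖a n‖ ≤ 1) {c : ℂ} {C : ℝ}
    (hA : ∀ N : ℕ, ‖∑ n ∈ Finset.Icc 1 N, a n - c * N‖ ≤ C) {N : ℕ} (hN : 1 ≤ N) {s : ℂ}
    (hs : 1 < s.re) :
    (s - 1) * LSeries a s = (s - 1) * ∑ n ∈ Finset.Icc 1 N, a n * (n : ℂ) ^ (-s)
      + c * (N : ℂ) ^ (1 - s) + s * (s - 1) * mellin (partialSumRemainder a c N) (-s) := by
  set aN : ℕ → ℂ := fun n => if n ≤ N then 0 else a n with haN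
  have hN0 : (0 : ℝ) < N := by exact_mod_cast hN
  have hs0 : s ≠ 0 := fun h => by simp [h] at hs; linarith
  have hs1 : s - 1 ≠ 0 := fun h => by rw [sub_eq_zero.1 h] at hs; simp at hs
  have haN1 : ∀ n, ‖aN n‖ ≤ 1 := by
    intro n
    simp only [haN]
    split_ifs
    · simp
    · exact ha n
  have hsum1 := LSeriesSummable_of_norm_le_one ha hs
  have hsum2 := LSeriesSummable_of_norm_le_one haN1 hs
  have h1 : LSeries a s = ∑ n ∈ Finset.Icc 1 N, a n * (n : ℂ) ^ (-s) + LSeries aN s := by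
    rw [← sub_eq_iff_eq_add, LSeries, LSeries, ← hsum1.tsum_sub hsum2,
      tsum_eq_sum (s := Finset.Icc 1 N)]
    · refine Finset.sum_congr rfl fun n hn => ?_
      obtain ⟨h1, h2⟩ := Finset.mem_Icc.1 hn
      rw [LSeries.term_of_ne_zero (by omega), LSeries.term_of_ne_zero (by omega),
        Complex.cpow_neg]
      simp [haN, h2, div_eq_mul_inv]
    · intro n hn
      rcases Nat.eq_zero_or_pos n with rfl | hn0
      · simp
      · have : ¬ n ≤ N := fun h => hn (Finset.mem_Icc.2 ⟨hn0, h⟩)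
        rw [LSeries.term_of_ne_zero (by omega), LSeries.term_of_ne_zero (by omega)]
        simp [haN, this]
  have h2 : LSeries aN s = s * ∫ t in Set.Ioi (1 : ℝ),
      (∑ k ∈ Finset.Icc 1 ⌊t⌋₊, aN k) * (t : ℂ) ^ (-(s + 1)) := by
    refine LSeries_eq_mul_integral aN zero_le_one hs hsum2 ?_
    refine Asymptotics.IsBigO.of_bound 1 (Eventually.of_forall fun n => ?_)
    rw [one_mul, Real.rpow_one]
    calc _ ≤ ∑ k ∈ Finset.Icc 1 n, ‖aN k‖ := norm_sum_le _ _
      _ ≤ ∑ k ∈ Finset.Icc 1 n, 1 := Finset.sum_le_sum fun k _ => haN1 k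
      _ = _ := by simp
  have hsumN : ∀ m, ∑ k ∈ Finset.Icc 1 m, aN k =
      if N ≤ m then ∑ k ∈ Finset.Icc 1 m, a k - ∑ k ∈ Finset.Icc 1 N, a k else 0 := by
    intro m
    split_ifs with h
    · have hsub : Finset.Icc 1 N ⊆ Finset.Icc 1 m := Finset.Icc_subset_Icc le_rfl h
      rw [← Finset.sum_sdiff hsub, ← Finset.sum_sdiff (f := a) hsub, add_sub_cancel_right]
      rw [Finset.sum_eq_zero (s := Finset.Icc 1 N), add_zero]
      · refine Finset.sum_congr rfl fun k hk => ?_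
        have : ¬ k ≤ N := by
          intro hkN
          simp only [Finset.mem_sdiff, Finset.mem_Icc] at hk
          omega
        simp [haN, this]
      · intro k hk
        simp [haN, (Finset.mem_Icc.1 hk).2]
    · refine Finset.sum_eq_zero fun k hk => ?_
      have := Finset.mem_Icc.1 hk
      simp only [haN]
      rw [if_pos (by omega)]
  have hfloor : ∀ t : ℝ, ∑ k ∈ Finset.Icc 1 ⌊t⌋₊, aN k =
      partialSumRemainder a c N t +
        Set.indicator (Set.Ioi (N : ℝ)) (fun t : ℝ => c * ((t - N : ℝ) : ℂ)) t := by
    intro t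
    rw [hsumN, partialSumRemainder]
    by_cases h : (N : ℝ) < t
    · have h' : N ≤ ⌊t⌋₊ := Nat.le_floor h.le
      rw [if_pos h, if_pos h', Set.indicator_of_mem (by exact h)]
      push_cast
      ring
    · rw [if_neg h, Set.indicator_of_notMem (by exact h), zero_add]
      split_ifs with h2
      · have : ⌊t⌋₊ = N := by
          refine le_antisymm ?_ h2
          have := Nat.floor_le_floor (not_lt.1 h)
          simpa using this
        rw [this, sub_self]
      · rfl
  have i1 : IntegrableOn (fun t : ℝ => partialSumRemainder a c N t * (t : ℂ) ^ (-(s + 1)))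
      (Set.Ioi 1) := by
    refine Integrable.bdd_mul (c := 2 * C + ‖c‖) ?_ ?_ ?_
    · exact integrableOn_Ioi_cpow_of_lt (by simp; linarith) one_pos
    · exact (measurable_partialSumRemainder a c N).aestronglyMeasurable
    · exact Eventually.of_forall fun t => norm_partialSumRemainder_le hA N t
  obtain ⟨i2, e2⟩ := integral_Ioi_sub_mul_cpow hN0 hs
  have e3 : ∀ t : ℝ, Set.indicator (Set.Ioi (N : ℝ)) (fun t : ℝ => c * ((t - N : ℝ) : ℂ)) t *
      (t : ℂ) ^ (-(s + 1)) = Set.indicator (Set.Ioi (N : ℝ))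
        (fun t : ℝ => c * (((t - N : ℝ) : ℂ) * (t : ℂ) ^ (-(s + 1)))) t := by
    intro t
    by_cases h : t ∈ Set.Ioi (N : ℝ)
    · rw [Set.indicator_of_mem h, Set.indicator_of_mem h, mul_assoc]
    · rw [Set.indicator_of_notMem h, Set.indicator_of_notMem h, zero_mul]
  have hsub : Set.Ioi (N : ℝ) ⊆ Set.Ioi 1 := Set.Ioi_subset_Ioi (by exact_mod_cast hN)
  have h3 : ∫ t in Set.Ioi (1 : ℝ), (∑ k ∈ Finset.Icc 1 ⌊t⌋₊, aN k) * (t : ℂ) ^ (-(s + 1)) =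
      (∫ t in Set.Ioi (1 : ℝ), partialSumRemainder a c N t * (t : ℂ) ^ (-(s + 1))) +
        c * ((N : ℂ) ^ (1 - s) / (s * (s - 1))) := by
    simp_rw [hfloor, add_mul, e3]
    rw [integral_add i1, setIntegral_indicator measurableSet_Ioi,
      Set.inter_eq_self_of_subset_right hsub, integral_const_mul, e2]
    · push_cast; rfl
    · exact ((integrable_indicator_iff measurableSet_Ioi).2 (i2.const_mul c)).integrableOn
  have h4 : mellin (partialSumRemainder a c N) (-s) =
      ∫ t in Set.Ioi (1 : ℝ), partialSumRemainder a c N t * (t : ℂ) ^ (-(s + 1)) := by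
    rw [mellin]
    simp only [smul_eq_mul, show -s - 1 = -(s + 1) by ring]
    simp_rw [mul_comm _ (partialSumRemainder a c N _)]
    refine setIntegral_eq_of_subset_of_forall_sdiff_eq_zero measurableSet_Ioi
      (Set.Ioi_subset_Ioi zero_le_one) ?_
    rintro t ⟨-, ht⟩
    have : ¬ (N : ℝ) < t := fun h => ht (hsub h)
    simp [partialSumRemainder, this]
  rw [h1, h2, h3, h4]
  field_simp
  ring

theorem differentiableAt_mellin_remainder {a : ℕ → ℂ} {c : ℂ} {C : ℝ}
    (hA : ∀ N : ℕ, ‖∑ n ∈ Finset.Icc 1 N, a n - c * N‖ ≤ C) {N : ℕ} (hN : 1 ≤ N) {s : ℂ}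
    (hs : 0 < s.re) : DifferentiableAt ℂ (mellin (partialSumRemainder a c N)) (-s) := by
  refine mellin_differentiableAt_of_isBigO_rpow (a := 0) (b := -s.re - 1) ?_ ?_ (by simpa using hs)
    ?_ (by simp)
  · refine MeasureTheory.LocallyIntegrable.locallyIntegrableOn ?_ _
    refine MeasureTheory.LocallyIntegrable.mono
      (MeasureTheory.locallyIntegrable_const (2 * C + ‖c‖)) 
      (measurable_partialSumRemainder a c N).aestronglyMeasurable
      (Eventually.of_forall fun t => (norm_partialSumRemainder_le hA N t).trans (le_abs_self _))
  · refine Asymptotics.IsBigO.of_bound (2 * C + ‖c‖) (Eventually.of_forall fun t => ?_)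
    simpa using norm_partialSumRemainder_le hA N t
  · refine Asymptotics.IsBigO.of_bound 0 ?_
    have : Set.Iio (N : ℝ) ∈ 𝓝 (0 : ℝ) := Iio_mem_nhds (by exact_mod_cast hN)
    filter_upwards [mem_nhdsWithin_of_mem_nhds this] with t ht
    have : ¬ (N : ℝ) < t := not_lt.2 (le_of_lt ht)
    simp [partialSumRemainder, this]

/-- The truncated formula persists on `0 < re s`, where both sides are holomorphic, for the analytic
continuation `V` of `(s - 1)` times the Dirichlet series. -/
theorem eq_truncated_of_pos_re {a : ℕ → ℂ} (ha : ∀ n, ‖a n‖ ≤ 1) {c : ℂ} {C : ℝ}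
    (hA : ∀ N : ℕ, ‖∑ n ∈ Finset.Icc 1 N, a n - c * N‖ ≤ C) {V : ℂ → ℂ} (hV : Differentiable ℂ V)
    (hVe : ∀ s : ℂ, 1 < s.re → V s = (s - 1) * LSeries a s) {N : ℕ} (hN : 1 ≤ N) {s : ℂ}
    (hs : 0 < s.re) :
    V s = (s - 1) * ∑ n ∈ Finset.Icc 1 N, a n * (n : ℂ) ^ (-s)
      + c * (N : ℂ) ^ (1 - s) + s * (s - 1) * mellin (partialSumRemainder a c N) (-s) := by
  have hopen : IsOpen {s : ℂ | 0 < s.re} := isOpen_lt continuous_const Complex.continuous_re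
  have hconv : Convex ℝ {s : ℂ | 0 < s.re} := convex_halfSpace_re_gt 0
  set T : ℂ → ℂ := fun s => (s - 1) * ∑ n ∈ Finset.Icc 1 N, a n * (n : ℂ) ^ (-s)
      + c * (N : ℂ) ^ (1 - s) + s * (s - 1) * mellin (partialSumRemainder a c N) (-s) with hT
  have hN' : (N : ℂ) ≠ 0 := by exact_mod_cast (by omega : N ≠ 0)
  have hTd : DifferentiableOn ℂ T {s : ℂ | 0 < s.re} := by
    intro s hs
    refine DifferentiableAt.differentiableWithinAt ?_
    have h1 : DifferentiableAt ℂ (fun s => mellin (partialSumRemainder a c N) (-s)) s :=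
      (differentiableAt_mellin_remainder hA hN hs).comp s differentiableAt_id.neg
    have h2 : DifferentiableAt ℂ (fun s : ℂ => ∑ n ∈ Finset.Icc 1 N, a n * (n : ℂ) ^ (-s)) s := by
      refine DifferentiableAt.fun_sum fun n hn => ?_
      have : (n : ℂ) ≠ 0 := by
        have := (Finset.mem_Icc.1 hn).1
        exact_mod_cast (by omega : n ≠ 0)
      exact (differentiableAt_id.neg.const_cpow (Or.inl this)).const_mul _
    have h3 : DifferentiableAt ℂ (fun s : ℂ => (N : ℂ) ^ (1 - s)) s :=
      DifferentiableAt.const_cpow (by fun_prop) (Or.inl hN')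
    exact (((differentiableAt_id.sub_const 1).mul h2).add (h3.const_mul c)).add
      ((differentiableAt_id.mul (differentiableAt_id.sub_const 1)).mul h1)
  have heq := AnalyticOnNhd.eqOn_of_preconnected_of_eventuallyEq
    (hV.differentiableOn.analyticOnNhd hopen) (hTd.analyticOnNhd hopen) hconv.isPreconnected
    (z₀ := 2) (by simp) ?_
  · exact heq hs
  · have : {s : ℂ | 1 < s.re} ∈ 𝓝 (2 : ℂ) :=
      (isOpen_lt continuous_const Complex.continuous_re).mem_nhds (by simp)
    filter_upwards [this] with s hs
    rw [hVe s hs, LSeries_eq_truncated ha hA hN hs]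

theorem sum_rpow_sub_one_le {b : ℝ} (hb : 0 < b) (hb1 : b ≤ 1) (N : ℕ) :
    ∑ n ∈ Finset.Icc 1 N, (n : ℝ) ^ (b - 1) ≤ (N : ℝ) ^ b / b := by
  induction N with
  | zero => simp [hb.ne']
  | succ N ih =>
    rw [Finset.sum_Icc_succ_top (by omega)]
    have hpos : (0 : ℝ) < ((N + 1 : ℕ) : ℝ) := by positivity
    have h1 : (N : ℝ) ^ b ≤ ((N + 1 : ℕ) : ℝ) ^ b * (1 - b / ((N + 1 : ℕ) : ℝ)) := by
      have h2 : (N : ℝ) = ((N + 1 : ℕ) : ℝ) * (1 + -(1 / ((N + 1 : ℕ) : ℝ))) := by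
        field_simp
        push_cast
        ring
      have h3 : 1 / ((N + 1 : ℕ) : ℝ) ≤ 1 := by
        rw [div_le_one hpos]; push_cast; linarith [Nat.cast_nonneg (α := ℝ) N]
      have h4 := rpow_one_add_le_one_add_mul_self (s := -(1 / ((N + 1 : ℕ) : ℝ)))
        (by linarith) hb.le hb1
      calc (N : ℝ) ^ b = (((N + 1 : ℕ) : ℝ) * (1 + -(1 / ((N + 1 : ℕ) : ℝ)))) ^ b := by rw [← h2]
        _ = ((N + 1 : ℕ) : ℝ) ^ b * (1 + -(1 / ((N + 1 : ℕ) : ℝ))) ^ b :=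
          Real.mul_rpow hpos.le (by linarith)
        _ ≤ ((N + 1 : ℕ) : ℝ) ^ b * (1 + b * -(1 / ((N + 1 : ℕ) : ℝ))) := by gcongr
        _ = _ := by ring
    have h5 : ((N + 1 : ℕ) : ℝ) ^ (b - 1) = ((N + 1 : ℕ) : ℝ) ^ b / ((N + 1 : ℕ) : ℝ) := by
      rw [Real.rpow_sub hpos, Real.rpow_one]
    calc _ ≤ (N : ℝ) ^ b / b + ((N + 1 : ℕ) : ℝ) ^ (b - 1) := by gcongr
      _ ≤ ((N + 1 : ℕ) : ℝ) ^ b * (1 - b / ((N + 1 : ℕ) : ℝ)) / b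
          + ((N + 1 : ℕ) : ℝ) ^ b / ((N + 1 : ℕ) : ℝ) := by rw [h5]; gcongr
      _ = _ := by field_simp; ring

open MeasureTheory in
/-- The remainder vanishes up to `N` and is bounded beyond `N`. -/
theorem norm_mellin_remainder_le {a : ℕ → ℂ} {c : ℂ} {C : ℝ}
    (hA : ∀ N : ℕ, ‖∑ n ∈ Finset.Icc 1 N, a n - c * N‖ ≤ C) {N : ℕ} (hN : 1 ≤ N) {s : ℂ}
    (hs : 0 < s.re) :
    ‖mellin (partialSumRemainder a c N) (-s)‖ ≤ (2 * C + ‖c‖) * ((N : ℝ) ^ (-s.re) / s.re) := by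
  have hN0 : (0 : ℝ) < N := by exact_mod_cast hN
  have h1 : mellin (partialSumRemainder a c N) (-s) =
      ∫ t in Set.Ioi (N : ℝ), (t : ℂ) ^ (-s - 1) • partialSumRemainder a c N t := by
    rw [mellin]
    refine setIntegral_eq_of_subset_of_forall_sdiff_eq_zero measurableSet_Ioi
      (Set.Ioi_subset_Ioi hN0.le) ?_
    rintro t ⟨-, ht⟩
    have : ¬ (N : ℝ) < t := ht
    simp [partialSumRemainder, this]
  rw [h1]
  have h2 : ∫ t in Set.Ioi (N : ℝ), (2 * C + ‖c‖) * t ^ (-s.re - 1) =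
      (2 * C + ‖c‖) * ((N : ℝ) ^ (-s.re) / s.re) := by
    rw [integral_const_mul, integral_Ioi_rpow_of_lt (by linarith) hN0]
    rw [show -s.re - 1 + 1 = -s.re by ring, neg_div_neg_eq]
  rw [← h2]
  refine norm_integral_le_of_norm_le ?_ ?_
  · exact (integrableOn_Ioi_rpow_of_lt (by linarith) hN0).const_mul _
  · refine (ae_restrict_iff' measurableSet_Ioi).2 (Eventually.of_forall fun t ht => ?_)
    rw [norm_smul, Complex.norm_cpow_eq_rpow_re_of_pos (hN0.trans ht), mul_comm]
    have : 0 ≤ t := (hN0.trans ht).le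
    have h3 : (-s - 1).re = -s.re - 1 := by simp
    rw [h3]
    gcongr
    exact norm_partialSumRemainder_le hA N t

/-- A Dirichlet series whose coefficients are bounded and have partial sums `c N + O(1)` grows more
slowly than any given power of `im s` on a suitable half-plane containing `re s = 1`; the factor
`s - 1` removes its possible pole. -/
theorem exists_norm_le_of_partial_sums {a : ℕ → ℂ} (ha : ∀ n, ‖a n‖ ≤ 1) {c : ℂ} {C : ℝ}
    (hA : ∀ N : ℕ, ‖∑ n ∈ Finset.Icc 1 N, a n - c * N‖ ≤ C) {V : ℂ → ℂ} (hV : Differentiable ℂ V)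
    (hVe : ∀ s : ℂ, 1 < s.re → V s = (s - 1) * LSeries a s) {b : ℝ} (hb : 0 < b)
    (hb1 : b ≤ 1 / 2) :
    ∃ K : ℝ, 0 < K ∧ ∀ s : ℂ, 1 - b ≤ s.re → s.re ≤ 3 →
      ‖V s‖ ≤ K * (1 + |s.im|) * (1 + |s.im|) ^ b := by
  have hC : 0 ≤ C := (norm_nonneg _).trans (hA 0)
  refine ⟨4 / b + 2 * ‖c‖ + 12 * (2 * C + ‖c‖), by positivity, fun s hs1 hs2 => ?_⟩
  set τ : ℝ := 1 + |s.im| with hτ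
  have hτ1 : 1 ≤ τ := by simp [hτ]
  have hτ0 : 0 < τ := by linarith
  -- truncating at height `N ≈ 1 + |im s|` makes the factor `s` in front of the remainder integral
  -- harmless, as this integral is of order `N ^ (-re s)`
  set N : ℕ := ⌈τ⌉₊ with hNdef
  have hNτ : τ ≤ N := Nat.le_ceil τ
  have hNτ' : (N : ℝ) ≤ 2 * τ := by
    have := Nat.ceil_lt_add_one hτ0.le
    linarith
  have hN1 : (1 : ℝ) ≤ N := hτ1.trans hNτ
  have hN : 1 ≤ N := by exact_mod_cast hN1
  have hN0 : (0 : ℝ) < N := by linarith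
  have hsre : 1 / 2 ≤ s.re := by linarith
  have hns : ‖s‖ ≤ 3 * τ := by
    have := Complex.norm_le_abs_re_add_abs_im s
    rw [abs_of_nonneg (by linarith : 0 ≤ s.re)] at this
    linarith [abs_nonneg s.im]
  have hns1 : ‖s - 1‖ ≤ 2 * τ := by
    have := Complex.norm_le_abs_re_add_abs_im (s - 1)
    simp only [Complex.sub_re, Complex.one_re, Complex.sub_im, Complex.one_im, sub_zero] at this
    have h2 : |s.re - 1| ≤ 2 := abs_le.2 ⟨by linarith, by linarith⟩
    linarith [abs_nonneg s.im]
  have hNb : (N : ℝ) ^ b ≤ 2 * τ ^ b := by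
    calc (N : ℝ) ^ b ≤ (2 * τ) ^ b := by gcongr
      _ = 2 ^ b * τ ^ b := Real.mul_rpow (by norm_num) hτ0.le
      _ ≤ 2 ^ (1 : ℝ) * τ ^ b := by
        gcongr
        · norm_num
        · linarith
      _ = _ := by rw [Real.rpow_one]
  have t1 : ‖∑ n ∈ Finset.Icc 1 N, a n * (n : ℂ) ^ (-s)‖ ≤ 2 * τ ^ b / b := by
    calc _ ≤ ∑ n ∈ Finset.Icc 1 N, ‖a n * (n : ℂ) ^ (-s)‖ := norm_sum_le _ _
      _ ≤ ∑ n ∈ Finset.Icc 1 N, (n : ℝ) ^ (b - 1) := by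
        refine Finset.sum_le_sum fun n hn => ?_
        have hn1 := (Finset.mem_Icc.1 hn).1
        rw [norm_mul, Complex.norm_natCast_cpow_of_pos (by omega), Complex.neg_re]
        have hn1' : (1 : ℝ) ≤ n := by exact_mod_cast hn1
        calc _ ≤ 1 * (n : ℝ) ^ (b - 1) := by
              gcongr
              · exact ha n
              · linarith
          _ = _ := one_mul _
      _ ≤ (N : ℝ) ^ b / b := sum_rpow_sub_one_le hb (by linarith) N
      _ ≤ _ := by gcongr
  have t2 : ‖(N : ℂ) ^ (1 - s)‖ ≤ 2 * τ ^ b := by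
    rw [Complex.norm_natCast_cpow_of_pos (by omega)]
    refine le_trans ?_ hNb
    refine Real.rpow_le_rpow_of_exponent_le hN1 ?_
    simp; linarith
  have t3 : ‖mellin (partialSumRemainder a c N) (-s)‖ ≤ (2 * C + ‖c‖) * (2 * (τ ^ b / τ)) := by
    refine (norm_mellin_remainder_le hA hN (by linarith)).trans ?_
    have h1 : (N : ℝ) ^ (-s.re) ≤ τ ^ b / τ := by
      calc (N : ℝ) ^ (-s.re) ≤ τ ^ (-s.re) :=
            Real.rpow_le_rpow_of_nonpos hτ0 hNτ (by linarith)
        _ ≤ τ ^ (b - 1) := Real.rpow_le_rpow_of_exponent_le hτ1 (by linarith)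
        _ = τ ^ b / τ := by rw [Real.rpow_sub hτ0, Real.rpow_one]
    have h2 : (N : ℝ) ^ (-s.re) / s.re ≤ (τ ^ b / τ) / (1 / 2) := by gcongr
    have h3 : (τ ^ b / τ) / (1 / 2) = 2 * (τ ^ b / τ) := by ring
    rw [h3] at h2
    gcongr
  rw [eq_truncated_of_pos_re ha hA hV hVe hN (by linarith : 0 < s.re)]
  have hτb : 0 ≤ τ ^ b := by positivity
  calc _ ≤ ‖s - 1‖ * ‖∑ n ∈ Finset.Icc 1 N, a n * (n : ℂ) ^ (-s)‖ + ‖c‖ * ‖(N : ℂ) ^ (1 - s)‖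
        + ‖s‖ * ‖s - 1‖ * ‖mellin (partialSumRemainder a c N) (-s)‖ := by
        refine (norm_add_le _ _).trans (add_le_add ((norm_add_le _ _).trans ?_) ?_)
        · rw [norm_mul, norm_mul]
        · rw [norm_mul, norm_mul]
    _ ≤ 2 * τ * (2 * τ ^ b / b) + ‖c‖ * (2 * τ ^ b)
        + 3 * τ * (2 * τ) * ((2 * C + ‖c‖) * (2 * (τ ^ b / τ))) := by gcongr
    _ = (4 / b + 12 * (2 * C + ‖c‖)) * τ * τ ^ b + 2 * ‖c‖ * 1 * τ ^ b := by
        field_simp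
        ring
    _ ≤ (4 / b + 12 * (2 * C + ‖c‖)) * τ * τ ^ b + 2 * ‖c‖ * τ * τ ^ b := by gcongr
    _ = _ := by ring

/-! ### Bounds from Cauchy's estimate and from the inequality `3 + 4 cos θ + cos 2θ ≥ 0` -/

/-- Cauchy's estimate in a vertical strip for functions of polynomial growth. -/
theorem norm_deriv_le_of_strip {f : ℂ → ℂ} {α β ρ T K e : ℝ} (hρ : 0 < ρ) (hρ1 : ρ ≤ 1)
    (he : 0 ≤ e) (he2 : e ≤ 2) (hK : 0 ≤ K)
    (hd : ∀ z : ℂ, α - ρ ≤ z.re → z.re ≤ β + ρ → T - ρ ≤ |z.im| → DifferentiableAt ℂ f z)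
    (hb : ∀ z : ℂ, α - ρ ≤ z.re → z.re ≤ β + ρ → T - ρ ≤ |z.im| → ‖f z‖ ≤ K * (1 + |z.im|) ^ e)
    {s : ℂ} (h1 : α ≤ s.re) (h2 : s.re ≤ β) (h3 : T ≤ |s.im|) :
    ‖deriv f s‖ ≤ 4 * K / ρ * (1 + |s.im|) ^ e := by
  have hball : ∀ z ∈ Metric.closedBall s ρ,
      (α - ρ ≤ z.re ∧ z.re ≤ β + ρ ∧ T - ρ ≤ |z.im|) ∧ 1 + |z.im| ≤ 2 * (1 + |s.im|) := by
    intro z hz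
    have hz' : ‖z - s‖ ≤ ρ := by simpa [dist_eq_norm] using hz
    have hre := (Complex.abs_re_le_norm (z - s)).trans hz'
    have him := (Complex.abs_im_le_norm (z - s)).trans hz'
    rw [Complex.sub_re, abs_le] at hre
    rw [Complex.sub_im] at him
    have him1 := abs_sub_abs_le_abs_sub z.im s.im
    have him2 := abs_sub_abs_le_abs_sub s.im z.im
    rw [abs_sub_comm] at him2
    refine ⟨⟨by linarith, by linarith, by linarith⟩, ?_⟩
    linarith [abs_nonneg s.im]
  have hdiff : DifferentiableOn ℂ f (Metric.closedBall s ρ) := fun z hz =>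
    (hd z (hball z hz).1.1 (hball z hz).1.2.1 (hball z hz).1.2.2).differentiableWithinAt
  have hτ : 0 ≤ 1 + |s.im| := by positivity
  have := Complex.norm_deriv_le_of_forall_mem_sphere_norm_le (C := K * (4 * (1 + |s.im|) ^ e)) hρ
    (hdiff.diffContOnCl_ball subset_rfl) ?_
  · refine this.trans (le_of_eq (by ring))
  · intro z hz
    have hz' := hball z (Metric.sphere_subset_closedBall hz)
    refine (hb z hz'.1.1 hz'.1.2.1 hz'.1.2.2).trans ?_
    gcongr
    calc (1 + |z.im|) ^ e ≤ (2 * (1 + |s.im|)) ^ e := by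
          gcongr
          exact hz'.2
      _ = 2 ^ e * (1 + |s.im|) ^ e := Real.mul_rpow (by norm_num) hτ
      _ ≤ 2 ^ (2 : ℝ) * (1 + |s.im|) ^ e := by
          gcongr
          norm_num
      _ = _ := by norm_num

theorem convex_reProdIm {S T : Set ℝ} (hS : Convex ℝ S) (hT : Convex ℝ T) : Convex ℝ (S ×ℂ T) :=
  (hS.linear_preimage Complex.reLm).inter (hT.linear_preimage Complex.imLm)

/-- A quantitative form of the classical nonvanishing argument: an upper bound for the derivative
and the inequality `1 ≤ A x⁻³ ‖f‖⁴ τ ^ b` (where `τ = 1 + |t|`) yield a lower bound for `f` that is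
uniform up to the line `re s = 1`. -/
theorem exists_lower_bound_of_three_four_one {f : ℂ → ℂ} {A K b : ℝ} (hb : 0 < b) (hA : 0 < A)
    (hd : ∀ s : ℂ, 1 ≤ s.re → s.re ≤ 2 → 2 ≤ |s.im| → DifferentiableAt ℂ f s)
    (hK : ∀ s : ℂ, 1 ≤ s.re → s.re ≤ 2 → 2 ≤ |s.im| → ‖deriv f s‖ ≤ K * (1 + |s.im|) ^ b)
    (h341 : ∀ x t : ℝ, 0 < x → x ≤ 1 → 2 ≤ |t| →
      x ^ 3 ≤ A * (1 + |t|) ^ b * ‖f (1 + x + Complex.I * t)‖ ^ 4) :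
    ∃ k : ℝ, 0 < k ∧ ∀ s : ℂ, 1 < s.re → s.re ≤ 2 → 2 ≤ |s.im| →
      k ≤ ‖f s‖ * ((1 + |s.im|) ^ b) ^ 4 := by
  set α : ℝ := 1 + A with hα
  have hα1 : 1 ≤ α := by linarith
  have hαA : A ≤ α ^ 4 := by
    calc A ≤ α := by linarith
      _ = α ^ 1 := (pow_one α).symm
      _ ≤ α ^ 4 := pow_le_pow_right₀ hα1 (by norm_num)
  set L : ℝ := 1 + |K| with hL
  have hL1 : 1 ≤ L := by simp [hL]
  have hKL : K ≤ L := by linarith [le_abs_self K]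
  set θ : ℝ := 1 / (2 * α * L) with hθ
  have hθ0 : 0 < θ := by positivity
  have hθ1 : θ ≤ 1 := by
    rw [hθ, div_le_one (by positivity)]
    nlinarith
  have hθL : L * θ ^ 4 = θ ^ 3 / (2 * α) := by
    have : L * θ = 1 / (2 * α) := by rw [hθ]; field_simp
    calc L * θ ^ 4 = (L * θ) * θ ^ 3 := by ring
      _ = _ := by rw [this]; ring
  refine ⟨θ ^ 3 / (2 * α), by positivity, fun s hs1 hs2 ht => ?_⟩
  set M : ℝ := (1 + |s.im|) ^ b with hM
  have hM1 : 1 ≤ M := Real.one_le_rpow (by linarith [abs_nonneg s.im]) hb.le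
  have hM0 : 0 < M := by linarith
  -- At distance `x ≥ η` from the line `re s = 1` the assumption `h341` bounds `‖f‖ M ^ 4` from
  -- below by a constant multiple of `θ ^ 3`; over a distance `η` the derivative bound `L M` changes
  -- it by `L θ ^ 4` at most, which is half as much because of the choice of `θ`.
  set η : ℝ := θ ^ 4 / M ^ 5 with hη
  have hη0 : 0 < η := by positivity
  have hη1 : η ≤ 1 := by
    rw [hη, div_le_one (by positivity)]
    exact (pow_le_one₀ hθ0.le hθ1).trans (one_le_pow₀ hM1)
  have key : ∀ x : ℝ, η ≤ x → x ≤ 1 → θ ^ 3 / α ≤ ‖f (1 + x + Complex.I * s.im)‖ * M ^ 4 := by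
    intro x hx hx1
    have h1 := h341 x s.im (hη0.trans_le hx) hx1 ht
    set F := ‖f (1 + x + Complex.I * s.im)‖ with hF
    have hF0 : 0 ≤ F := norm_nonneg _
    have h2 : η ^ 3 ≤ α ^ 4 * M * F ^ 4 := by
      calc η ^ 3 ≤ x ^ 3 := by gcongr
        _ ≤ A * M * F ^ 4 := h1
        _ ≤ _ := by gcongr
    have h3 : (θ ^ 3 / α) ^ 4 ≤ (F * M ^ 4) ^ 4 := by
      rw [hη, div_pow, div_le_iff₀ (by positivity)] at h2
      rw [div_pow, div_le_iff₀ (by positivity)]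
      calc (θ ^ 3) ^ 4 = (θ ^ 4) ^ 3 := by ring
        _ ≤ _ := h2
        _ = _ := by ring
    exact (pow_le_pow_iff_left₀ (by positivity) (by positivity) (by norm_num)).1 h3
  have hs : s = 1 + ((s.re - 1 : ℝ) : ℂ) + Complex.I * s.im := by
    apply Complex.ext <;> simp
  have hhalf : θ ^ 3 / (2 * α) = θ ^ 3 / α / 2 := by field_simp
  rcases le_or_gt η (s.re - 1) with hx | hx
  · have := key (s.re - 1) hx (by linarith)
    rw [← hs] at this
    rw [hhalf]
    have h0 : 0 < θ ^ 3 / α := by positivity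
    linarith
  · set s' : ℂ := 1 + (η : ℂ) + Complex.I * s.im with hs'
    have hre' : s'.re = 1 + η := by simp [hs']
    have him' : s'.im = s.im := by simp [hs']
    have h1 := key η le_rfl hη1
    set R : Set ℂ := (Set.Icc (1 : ℝ) 2) ×ℂ ({s.im} : Set ℝ) with hR
    have hRc : Convex ℝ R := convex_reProdIm (convex_Icc _ _) (convex_singleton _)
    have hmem : ∀ z ∈ R, 1 ≤ z.re ∧ z.re ≤ 2 ∧ z.im = s.im := by
      intro z hz
      rw [hR, Complex.mem_reProdIm] at hz
      exact ⟨hz.1.1, hz.1.2, hz.2⟩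
    have h2 := hRc.norm_image_sub_le_of_norm_deriv_le (f := f) (C := L * M) (x := s) (y := s')
      (fun z hz => hd z (hmem z hz).1 (hmem z hz).2.1 (by rw [(hmem z hz).2.2]; exact ht))
      (fun z hz => by
        have h3 := hK z (hmem z hz).1 (hmem z hz).2.1 (by rw [(hmem z hz).2.2]; exact ht)
        rw [(hmem z hz).2.2] at h3
        exact h3.trans (by gcongr))
      (by rw [hR, Complex.mem_reProdIm]; exact ⟨⟨hs1.le, hs2⟩, rfl⟩)
      (by rw [hR, Complex.mem_reProdIm, hre', him']; exact ⟨⟨by linarith, by linarith⟩, rfl⟩)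
    have h3 : ‖s' - s‖ ≤ η := by
      have : s' - s = ((1 + η - s.re : ℝ) : ℂ) := by
        apply Complex.ext <;> simp [hs']
      rw [this, Complex.norm_real, Real.norm_eq_abs, abs_le]
      constructor <;> linarith
    have h4 : ‖f s'‖ - ‖f s‖ ≤ L * M * η :=
      (norm_sub_norm_le _ _).trans (h2.trans (by gcongr))
    have h5 : L * M * η * M ^ 4 = θ ^ 3 / (2 * α) := by
      rw [hη, ← hθL]
      field_simp
    have h6 : ‖f s'‖ * M ^ 4 - ‖f s‖ * M ^ 4 ≤ θ ^ 3 / (2 * α) := by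
      rw [← h5, ← sub_mul]
      gcongr
    rw [hhalf] at h6 ⊢
    linarith

/-! ### The two `L`-functions modulo `4` -/

open DirichletCharacter

theorem sum_chi4 (N : ℕ) :
    ∑ n ∈ Finset.Icc 1 N, chi4 n = if N % 4 = 1 ∨ N % 4 = 2 then 1 else 0 := by
  induction N with
  | zero => simp
  | succ N ih =>
    rw [Finset.sum_Icc_succ_top (by omega), ih, chi4_apply]
    have : N % 4 = 0 ∨ N % 4 = 1 ∨ N % 4 = 2 ∨ N % 4 = 3 := by omega
    rcases this with h | h | h | h
    · have h1 : (N + 1) % 4 = 1 := by omega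
      have h2 : (N + 1) % 2 = 1 := by omega
      simp [h, h1, h2]
    · have h1 : (N + 1) % 4 = 2 := by omega
      have h2 : (N + 1) % 2 = 0 := by omega
      simp [h, h1, h2]
    · have h1 : (N + 1) % 4 = 3 := by omega
      have h2 : (N + 1) % 2 = 1 := by omega
      simp [h, h1, h2]
    · have h1 : (N + 1) % 4 = 0 := by omega
      have h2 : (N + 1) % 2 = 0 := by omega
      simp [h, h1, h2]

theorem sum_one_four (N : ℕ) :
    ∑ n ∈ Finset.Icc 1 N, (1 : DirichletCharacter ℂ 4) n = ((N + 1) / 2 : ℕ) := by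
  induction N with
  | zero => simp
  | succ N ih =>
    rw [Finset.sum_Icc_succ_top (by omega), ih, one_apply_four]
    split_ifs with h
    · rw [add_zero]; congr 1; omega
    · rw [show (N + 1 + 1) / 2 = (N + 1) / 2 + 1 by omega]; push_cast; ring

/-- The coefficients of `L(s, χ₀)` modulo `4` have mean value `1 / 2`; Mathlib's
`LFunctionTrivChar₁` is `(s - 1) L(s, χ₀)`, continued to `s = 1`. -/
theorem exists_norm_trivChar_le {b : ℝ} (hb : 0 < b) (hb1 : b ≤ 1 / 2) :
    ∃ K : ℝ, 0 < K ∧ ∀ s : ℂ, 1 - b ≤ s.re → s.re ≤ 3 →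
      ‖LFunctionTrivChar₁ 4 s‖ ≤ K * (1 + |s.im|) * (1 + |s.im|) ^ b := by
  refine exists_norm_le_of_partial_sums (a := fun n => (1 : DirichletCharacter ℂ 4) n)
    (fun n => DirichletCharacter.norm_le_one _ _) (c := 1 / 2) (C := 1) ?_
    (differentiable_LFunctionTrivChar₁ 4) ?_ hb hb1
  · intro N
    rw [sum_one_four]
    have h1 : ((((N + 1) / 2 : ℕ) : ℂ) - 1 / 2 * N) =
        (((((N + 1) / 2 : ℕ) : ℝ) - 1 / 2 * N : ℝ) : ℂ) := by
      push_cast; ring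
    rw [h1, Complex.norm_real, Real.norm_eq_abs, abs_le]
    have h2 : ((N + 1) / 2 : ℕ) * 2 ≤ N + 1 := Nat.div_mul_le_self _ _
    have h3 : N ≤ ((N + 1) / 2 : ℕ) * 2 := by omega
    have h2' : ((((N + 1) / 2 : ℕ) : ℝ)) * 2 ≤ N + 1 := by exact_mod_cast h2
    have h3' : (N : ℝ) ≤ (((N + 1) / 2 : ℕ) : ℝ) * 2 := by exact_mod_cast h3
    constructor <;> linarith
  · intro s hs
    have hs1 : s ≠ 1 := by rintro rfl; simp at hs
    rw [LFunctionTrivChar₁, Function.update_of_ne hs1, LFunctionTrivChar, LFunction_eq_LSeries _ hs]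

theorem exists_norm_chi4_le {b : ℝ} (hb : 0 < b) (hb1 : b ≤ 1 / 2) :
    ∃ K : ℝ, 0 < K ∧ ∀ s : ℂ, 1 - b ≤ s.re → s.re ≤ 3 →
      ‖LFunction chi4 s‖ ≤ K * (1 + |s.im|) ^ b := by
  have hd : Differentiable ℂ (LFunction chi4) := differentiable_LFunction chi4_ne_one
  obtain ⟨K, hK, h⟩ := exists_norm_le_of_partial_sums (a := fun n => chi4 n)
    (fun n => DirichletCharacter.norm_le_one _ _) (c := 0) (C := 1)
    (V := fun s => (s - 1) * LFunction chi4 s) (by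
      intro N
      rw [sum_chi4]
      split_ifs <;> simp) ((differentiable_id.sub_const 1).mul hd)
    (fun s hs => by rw [LFunction_eq_LSeries _ hs]) hb hb1
  -- the factor `s - 1` can be divided out away from the real axis only; near it, the bound follows
  -- from compactness
  have hcomp : IsCompact ((Set.Icc (1 - b) 3 : Set ℝ) ×ℂ (Set.Icc (-1) 1 : Set ℝ)) :=
    isCompact_Icc.reProdIm isCompact_Icc
  obtain ⟨K', hK'⟩ := hcomp.exists_bound_of_continuousOn hd.continuous.continuousOn
  refine ⟨2 * K + |K'|, by positivity, fun s hs1 hs2 => ?_⟩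
  have hτ : 1 ≤ (1 + |s.im|) ^ b := Real.one_le_rpow (by linarith [abs_nonneg s.im]) hb.le
  rcases le_or_gt |s.im| 1 with ht | ht
  · have h1 := hK' s (by rw [Complex.mem_reProdIm]; exact ⟨⟨hs1, hs2⟩, abs_le.1 ht⟩)
    calc ‖LFunction chi4 s‖ ≤ |K'| := h1.trans (le_abs_self _)
      _ = |K'| * 1 := (mul_one _).symm
      _ ≤ (2 * K + |K'|) * (1 + |s.im|) ^ b := by gcongr; linarith
  · have h1 := h s hs1 hs2
    have h2 : |s.im| ≤ ‖s - 1‖ := by simpa using Complex.abs_im_le_norm (s - 1)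
    rw [norm_mul] at h1
    have h3 : (1 + |s.im|) / 2 * ‖LFunction chi4 s‖ ≤ K * (1 + |s.im|) * (1 + |s.im|) ^ b := by
      refine le_trans ?_ h1
      gcongr
      linarith
    have h4 : ‖LFunction chi4 s‖ ≤ 2 * K * (1 + |s.im|) ^ b := by
      have : 0 < (1 + |s.im|) / 2 := by positivity
      refine le_of_mul_le_mul_left (h3.trans (le_of_eq (by ring))) this
    refine h4.trans ?_
    gcongr
    linarith [abs_nonneg K']

theorem exists_norm_LFunctionTrivChar_le {b : ℝ} (hb : 0 < b) (hb1 : b ≤ 1 / 2) :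
    ∃ K : ℝ, 0 < K ∧ ∀ s : ℂ, 1 - b ≤ s.re → s.re ≤ 3 → 1 ≤ |s.im| →
      ‖LFunctionTrivChar 4 s‖ ≤ K * (1 + |s.im|) ^ b := by
  obtain ⟨K, hK, h⟩ := exists_norm_trivChar_le hb hb1
  refine ⟨2 * K, by positivity, fun s hs1 hs2 ht => ?_⟩
  have h1 := h s hs1 hs2
  have hs : s ≠ 1 := by rintro rfl; simp at ht; linarith
  rw [LFunctionTrivChar₁, Function.update_of_ne hs, norm_mul] at h1
  have h2 : |s.im| ≤ ‖s - 1‖ := by simpa using Complex.abs_im_le_norm (s - 1)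
  have h3 : (1 + |s.im|) / 2 * ‖LFunctionTrivChar 4 s‖ ≤ K * (1 + |s.im|) * (1 + |s.im|) ^ b := by
    refine le_trans ?_ h1
    gcongr
    linarith
  have : 0 < (1 + |s.im|) / 2 := by positivity
  exact le_of_mul_le_mul_left (h3.trans (le_of_eq (by ring))) this

/-- Lower bounds near the line `re s = 1`, away from the real axis, for the `L`-function of a real
character modulo `4`. -/
theorem exists_LFunction_lower {χ : DirichletCharacter ℂ 4} (hχ : χ ^ 2 = 1) {b K : ℝ} (hb : 0 < b)
    (hb1 : b ≤ 1 / 2) (hK0 : 0 < K) (hK : ∀ s : ℂ, 1 - b ≤ s.re → s.re ≤ 3 → 1 ≤ |s.im| →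
      ‖LFunction χ s‖ ≤ K * (1 + |s.im|) ^ b) :
    ∃ k : ℝ, 0 < k ∧ ∀ s : ℂ, 1 < s.re → s.re ≤ 2 → 2 ≤ |s.im| →
      k ≤ ‖LFunction χ s‖ * ((1 + |s.im|) ^ b) ^ 4 := by
  obtain ⟨K1, hK1, h1⟩ := exists_norm_trivChar_le hb hb1
  obtain ⟨K2, hK2, h2⟩ := exists_norm_LFunctionTrivChar_le hb hb1
  have hd : ∀ s : ℂ, 1 ≤ |s.im| → DifferentiableAt ℂ (LFunction χ) s := by
    intro s hs
    refine differentiableAt_LFunction χ s (Or.inl ?_)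
    rintro rfl
    simp at hs
    linarith
  refine exists_lower_bound_of_three_four_one (A := 2 * K1 ^ 3 * K2) (K := 4 * K / b) hb
    (by positivity)
    (fun s _ _ hs => hd s (by linarith)) ?_ ?_
  · intro s hs1 hs2 hs3
    refine norm_deriv_le_of_strip (α := 1) (β := 2) (T := 2) hb (by linarith) hb.le (by linarith)
      hK0.le (fun z _ _ hz => hd z (by linarith)) (fun z hz1 hz2 hz3 => ?_) hs1 hs2 hs3
    exact hK z hz1 (by linarith) (by linarith)
  · intro x t hx hx1 ht
    have h3 := norm_LFunction_product_ge_one χ hx t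
    rw [hχ, norm_mul, norm_mul, norm_pow, norm_pow] at h3
    have h4 : x * ‖LFunctionTrivChar 4 (1 + x)‖ ≤ K1 := by
      have h5 := h1 (1 + x) (by simp; linarith) (by simp; linarith)
      have hne : (1 + x : ℂ) ≠ 1 := by
        simp only [ne_eq, add_eq_left, Complex.ofReal_eq_zero]; exact hx.ne'
      rw [LFunctionTrivChar₁, Function.update_of_ne hne] at h5
      simp only [add_sub_cancel_left, norm_mul, Complex.norm_real, Real.norm_eq_abs,
        abs_of_pos hx, Complex.add_im, Complex.one_im, Complex.ofReal_im, add_zero, abs_zero,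
        Real.one_rpow, mul_one] at h5
      exact h5
    have h6 : ‖LFunctionTrivChar 4 (1 + x + 2 * Complex.I * t)‖ ≤ K2 * (2 * (1 + |t|) ^ b) := by
      have him : (1 + x + 2 * Complex.I * t : ℂ).im = 2 * t := by simp
      have hre : (1 + x + 2 * Complex.I * t : ℂ).re = 1 + x := by simp
      have h7 := h2 (1 + x + 2 * Complex.I * t) (by rw [hre]; linarith) (by rw [hre]; linarith)
        (by rw [him, abs_mul, abs_two]; linarith)
      refine h7.trans ?_
      rw [him, abs_mul, abs_two]
      gcongr
      calc (1 + 2 * |t|) ^ b ≤ (2 * (1 + |t|)) ^ b := by gcongr; linarith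
        _ = 2 ^ b * (1 + |t|) ^ b := Real.mul_rpow (by norm_num) (by positivity)
        _ ≤ 2 ^ (1 : ℝ) * (1 + |t|) ^ b := by
          gcongr
          · norm_num
          · linarith
        _ = _ := by norm_num
    set a := ‖LFunctionTrivChar 4 (1 + x)‖
    set c := ‖LFunction χ (1 + x + Complex.I * t)‖
    have h8 : ‖LFunction 1 (1 + x + 2 * Complex.I * t)‖ ≤ K2 * (2 * (1 + |t|) ^ b) := h6
    calc x ^ 3 = x ^ 3 * 1 := (mul_one _).symm
      _ ≤ x ^ 3 * (a ^ 3 * c ^ 4 * ‖LFunction 1 (1 + x + 2 * Complex.I * t)‖) := by gcongr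
      _ = (x * a) ^ 3 * c ^ 4 * ‖LFunction 1 (1 + x + 2 * Complex.I * t)‖ := by ring
      _ ≤ K1 ^ 3 * c ^ 4 * (K2 * (2 * (1 + |t|) ^ b)) := by gcongr
      _ = _ := by ring

/-! ### The regular part of the square of the Dirichlet series -/

/-- The analytic continuation to `1 / 2 < re s` of `(s - 1)` times the square of the Dirichlet
series of the sums of two squares. -/
noncomputable def regularPart (s : ℂ) : ℂ :=
  LFunctionTrivChar₁ 4 s * LFunction chi4 s * ((1 - (2 : ℂ) ^ (-s))⁻¹) ^ 2 *
    LSeries threeModFour (2 * s)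

theorem regularPart_eq {s : ℂ} (hs : 1 < s.re) :
    regularPart s = (s - 1) * sosSeries s ^ 2 := by
  have hs1 : s ≠ 1 := by rintro rfl; simp at hs
  rw [sosSeries_sq hs, regularPart, LFunctionTrivChar₁, Function.update_of_ne hs1]
  ring

theorem norm_two_cpow_neg_le {s : ℂ} (hs : 1 / 2 ≤ s.re) : ‖(2 : ℂ) ^ (-s)‖ ≤ 3 / 4 := by
  have h : ‖(2 : ℂ) ^ (-s)‖ = (2 : ℝ) ^ (-s.re) := by
    have := Complex.norm_natCast_cpow_of_pos (n := 2) (by norm_num) (-s)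
    simpa using this
  rw [h]
  calc (2 : ℝ) ^ (-s.re) ≤ 2 ^ (-(1 / 2) : ℝ) :=
        Real.rpow_le_rpow_of_exponent_le (by norm_num) (by linarith)
    _ = (√2)⁻¹ := by rw [Real.rpow_neg (by norm_num), ← Real.sqrt_eq_rpow]
    _ ≤ (4 / 3)⁻¹ := by
        gcongr
        exact Real.le_sqrt_of_sq_le (by norm_num)
    _ = 3 / 4 := by norm_num

theorem one_sub_two_cpow_ne_zero {s : ℂ} (hs : 1 / 2 ≤ s.re) : (1 : ℂ) - 2 ^ (-s) ≠ 0 := by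
  intro h
  have h1 := norm_two_cpow_neg_le hs
  rw [← sub_eq_zero.1 h] at h1
  norm_num at h1

theorem differentiableAt_threeModFour {s : ℂ} (hs : 1 / 2 < s.re) :
    DifferentiableAt ℂ (fun s => LSeries threeModFour (2 * s)) s := by
  have h1 : LSeries.abscissaOfAbsConv threeModFour < (2 * s).re :=
    (abscissaOfAbsConv_le_one norm_threeModFour_le_one).trans_lt (by
      have : (1 : ℝ) < (2 * s).re := by simp; linarith
      exact_mod_cast this)
  exact (LSeries_hasDerivAt h1).differentiableAt.comp s (differentiableAt_id.const_mul (2 : ℂ))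

theorem differentiableAt_regularPart {s : ℂ} (hs : 1 / 2 < s.re) :
    DifferentiableAt ℂ regularPart s := by
  have h1 : DifferentiableAt ℂ (fun s : ℂ => ((1 - (2 : ℂ) ^ (-s))⁻¹) ^ 2) s := by
    have h2 : DifferentiableAt ℂ (fun s : ℂ => 1 - (2 : ℂ) ^ (-s)) s :=
      (differentiableAt_id.neg.const_cpow (Or.inl two_ne_zero)).const_sub 1
    exact (h2.fun_inv (one_sub_two_cpow_ne_zero hs.le)).fun_pow 2
  exact (((differentiable_LFunctionTrivChar₁ 4 s).mul
    (differentiable_LFunction chi4_ne_one s)).mul h1).mul (differentiableAt_threeModFour hs)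

/-- On `2 ≤ re w` the values at `w` of the series over integers composed of primes `3` modulo `4`
are within `ζ(2) - 1 < 2 / 3` of `1`. -/
theorem norm_threeModFour_sub_one_le {w : ℂ} (hw : 2 ≤ w.re) :
    ‖LSeries threeModFour w - 1‖ ≤ 2 / 3 := by
  have hsum := LSeriesSummable_of_norm_le_one norm_threeModFour_le_one
    (by linarith : 1 < w.re)
  have h1 : HasSum (fun n : ℕ => if n = 1 then (1 : ℂ) else 0) 1 := hasSum_ite_eq 1 1
  have h2 := hsum.hasSum.sub h1
  have h3 : HasSum (fun n : ℕ => 1 / (n : ℝ) ^ 2 - if n = 1 then (1 : ℝ) else 0)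
      (Real.pi ^ 2 / 6 - 1) := hasSum_zeta_two.sub (hasSum_ite_eq 1 1)
  have h4 : ∀ n : ℕ, ‖LSeries.term threeModFour w n - (if n = 1 then (1 : ℂ) else 0)‖ ≤
      1 / (n : ℝ) ^ 2 - if n = 1 then (1 : ℝ) else 0 := by
    intro n
    rcases eq_or_ne n 0 with rfl | hn
    · simp
    by_cases hn1 : n = 1
    · subst hn1
      simp [LSeries.term_of_ne_zero]
    · simp only [hn1, if_false, sub_zero]
      rw [LSeries.term_of_ne_zero hn, norm_div, Complex.norm_natCast_cpow_of_pos (by omega)]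
      have hn' : (1 : ℝ) ≤ n := by exact_mod_cast (by omega : 1 ≤ n)
      gcongr
      · exact norm_threeModFour_le_one n
      · calc (n : ℝ) ^ 2 = (n : ℝ) ^ (2 : ℝ) := by norm_cast
          _ ≤ _ := Real.rpow_le_rpow_of_exponent_le hn' hw
  have h5 : ‖LSeries threeModFour w - 1‖ ≤ Real.pi ^ 2 / 6 - 1 := by
    rw [LSeries, ← h2.tsum_eq]
    exact tsum_of_norm_bounded h3 h4
  have h6 := Real.pi_lt_d2
  have h7 := Real.pi_pos
  nlinarith

theorem exists_norm_threeModFour_le :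
    ∃ K : ℝ, 0 < K ∧ ∀ w : ℂ, 3 / 2 ≤ w.re → ‖LSeries threeModFour w‖ ≤ K := by
  have hsum : Summable fun n : ℕ => 1 / (n : ℝ) ^ (3 / 2 : ℝ) :=
    Real.summable_one_div_nat_rpow.2 (by norm_num)
  refine ⟨1 + |∑' n : ℕ, 1 / (n : ℝ) ^ (3 / 2 : ℝ)|, by positivity, fun w hw => ?_⟩
  refine (tsum_of_norm_bounded hsum.hasSum fun n => ?_).trans
    ((le_abs_self _).trans (by linarith))
  rcases eq_or_ne n 0 with rfl | hn
  · simp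
  rw [LSeries.term_of_ne_zero hn, norm_div, Complex.norm_natCast_cpow_of_pos (by omega)]
  have hn' : (1 : ℝ) ≤ n := by exact_mod_cast (by omega : 1 ≤ n)
  gcongr
  exact norm_threeModFour_le_one n

theorem exists_norm_regularPart_le {b : ℝ} (hb : 0 < b) (hb1 : b ≤ 1 / 4) :
    ∃ K : ℝ, 0 < K ∧ ∀ s : ℂ, 1 - b ≤ s.re → s.re ≤ 3 →
      ‖regularPart s‖ ≤ K * (1 + |s.im|) ^ (1 + 2 * b) := by
  obtain ⟨K1, hK1, h1⟩ := exists_norm_trivChar_le hb (by linarith)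
  obtain ⟨K2, hK2, h2⟩ := exists_norm_chi4_le hb (by linarith)
  obtain ⟨K3, hK3, h3⟩ := exists_norm_threeModFour_le
  refine ⟨K1 * K2 * 4 ^ 2 * K3, by positivity, fun s hs1 hs2 => ?_⟩
  have hτ : 0 < 1 + |s.im| := by positivity
  have h4 : ‖((1 : ℂ) - 2 ^ (-s))⁻¹‖ ≤ 4 := by
    have h5 := norm_two_cpow_neg_le (s := s) (by linarith)
    have h6 : 1 / 4 ≤ ‖(1 : ℂ) - 2 ^ (-s)‖ := by
      have := norm_sub_norm_le (1 : ℂ) (2 ^ (-s))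
      rw [norm_one] at this
      linarith
    rw [norm_inv]
    calc _ ≤ (1 / 4 : ℝ)⁻¹ := by gcongr
      _ = 4 := by norm_num
  rw [regularPart, norm_mul, norm_mul, norm_mul, norm_pow]
  calc _ ≤ K1 * (1 + |s.im|) * (1 + |s.im|) ^ b * (K2 * (1 + |s.im|) ^ b) * 4 ^ 2 * K3 := by
        gcongr
        · exact h1 s hs1 hs2
        · exact h2 s hs1 hs2
        · exact h3 _ (by simp; linarith)
    _ = _ := by
        rw [Real.rpow_add hτ, Real.rpow_one, two_mul, Real.rpow_add hτ]
        ring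

/-- With `b` arbitrarily small, `‖W(s)‖` is at least of order `(1 + |im s|) ^ (1 - 8 b)`, uniformly
up to the line `re s = 1`. -/
theorem exists_regularPart_lower {b : ℝ} (hb : 0 < b) (hb1 : b ≤ 1 / 8) :
    ∃ k : ℝ, 0 < k ∧ ∀ s : ℂ, 1 < s.re → s.re ≤ 2 →
      k * (1 + |s.im|) ≤ ‖regularPart s‖ * ((1 + |s.im|) ^ b) ^ 8 := by
  obtain ⟨K1, hK1, h1⟩ := exists_norm_LFunctionTrivChar_le hb (by linarith)
  obtain ⟨K2, hK2, h2⟩ := exists_norm_chi4_le hb (by linarith)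
  obtain ⟨k1, hk1, h3⟩ := exists_LFunction_lower (χ := 1) (one_pow 2) hb (by linarith) hK1 h1
  obtain ⟨k2, hk2, h4⟩ := exists_LFunction_lower chi4_sq hb (by linarith) hK2
    (fun s hs1 hs2 _ => h2 s hs1 hs2)
  -- near the real axis: compactness and nonvanishing
  have hcomp : IsCompact ((Set.Icc 1 2 : Set ℝ) ×ℂ (Set.Icc (-2) 2 : Set ℝ)) :=
    isCompact_Icc.reProdIm isCompact_Icc
  have hcont : Continuous fun s : ℂ => ‖LFunctionTrivChar₁ 4 s * LFunction chi4 s‖ :=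
    ((differentiable_LFunctionTrivChar₁ 4).continuous.mul
      (differentiable_LFunction chi4_ne_one).continuous).norm
  obtain ⟨k3, hk3, h5⟩ : ∃ k : ℝ, 0 < k ∧ ∀ s ∈ ((Set.Icc 1 2 : Set ℝ) ×ℂ (Set.Icc (-2) 2 : Set ℝ)),
      k ≤ ‖LFunctionTrivChar₁ 4 s * LFunction chi4 s‖ := by
    have hne : ((Set.Icc 1 2 : Set ℝ) ×ℂ (Set.Icc (-2) 2 : Set ℝ)).Nonempty :=
      ⟨1, by rw [Complex.mem_reProdIm]; norm_num⟩
    obtain ⟨s0, hs0, hmin⟩ := hcomp.exists_isMinOn hne hcont.continuousOn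
    refine ⟨_, norm_pos_iff.2 (mul_ne_zero ?_ ?_), fun s hs => hmin hs⟩
    · rcases eq_or_ne s0 1 with rfl | hne1
      · exact LFunctionTrivChar₁_apply_one_ne_zero 4
      · rw [LFunctionTrivChar₁, Function.update_of_ne hne1]
        exact mul_ne_zero (sub_ne_zero.2 hne1) (LFunction_ne_zero_of_one_le_re _ (Or.inr hne1)
          (Complex.mem_reProdIm.1 hs0).1.1)
    · exact LFunction_ne_zero_of_one_le_re _ (Or.inl chi4_ne_one)
          (Complex.mem_reProdIm.1 hs0).1.1
  have hmain : ∃ k : ℝ, 0 < k ∧ ∀ s : ℂ, 1 < s.re → s.re ≤ 2 → k * (1 + |s.im|) ≤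
      ‖LFunctionTrivChar₁ 4 s * LFunction chi4 s‖ * ((1 + |s.im|) ^ b) ^ 8 := by
    refine ⟨min (k1 * k2 / 2) (k3 / 3), by positivity, fun s hs1 hs2 => ?_⟩
    have hτ : 1 ≤ 1 + |s.im| := by simp
    have hM1 : 1 ≤ (1 + |s.im|) ^ b := Real.one_le_rpow hτ hb.le
    rcases le_or_gt |s.im| 2 with ht | ht
    · have h6 := h5 s (by rw [Complex.mem_reProdIm]; exact ⟨⟨hs1.le, hs2⟩, abs_le.1 ht⟩)
      calc _ ≤ k3 / 3 * 3 := by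
            gcongr
            · exact min_le_right _ _
            · linarith
        _ = k3 * 1 := by ring
        _ ≤ _ := by
            gcongr
            exact one_le_pow₀ hM1
    · have h6 := h3 s hs1 hs2 ht.le
      have h7 := h4 s hs1 hs2 ht.le
      have hs : s ≠ 1 := by rintro rfl; simp at ht; linarith
      have h8 : |s.im| ≤ ‖s - 1‖ := by simpa using Complex.abs_im_le_norm (s - 1)
      have h9 : (1 + |s.im|) / 2 ≤ ‖s - 1‖ := by linarith
      rw [LFunctionTrivChar₁, Function.update_of_ne hs, norm_mul, norm_mul]
      calc _ ≤ k1 * k2 / 2 * (1 + |s.im|) := by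
            gcongr
            exact min_le_left _ _
        _ = (1 + |s.im|) / 2 * k1 * k2 := by ring
        _ ≤ ‖s - 1‖ * (‖LFunctionTrivChar 4 s‖ * ((1 + |s.im|) ^ b) ^ 4) *
            (‖LFunction chi4 s‖ * ((1 + |s.im|) ^ b) ^ 4) := by gcongr
        _ = _ := by ring
  obtain ⟨k, hk, h6⟩ := hmain
  refine ⟨k * (1 / 2) ^ 2 * (1 / 3), by positivity, fun s hs1 hs2 => ?_⟩
  -- the two remaining factors are bounded below by constants
  have h7 : 1 / 2 ≤ ‖((1 : ℂ) - 2 ^ (-s))⁻¹‖ := by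
    have h8 := norm_two_cpow_neg_le (s := s) (by linarith)
    have h9 : ‖(1 : ℂ) - 2 ^ (-s)‖ ≤ 2 := by
      have := norm_sub_le (1 : ℂ) (2 ^ (-s))
      rw [norm_one] at this
      linarith
    have h10 : 0 < ‖(1 : ℂ) - 2 ^ (-s)‖ := norm_pos_iff.2 (one_sub_two_cpow_ne_zero (by linarith))
    rw [norm_inv, one_div]
    gcongr
  have h8 : 1 / 3 ≤ ‖LSeries threeModFour (2 * s)‖ := by
    have h9 := norm_threeModFour_sub_one_le (w := 2 * s) (by simp; linarith)
    have h10 := norm_sub_norm_le (1 : ℂ) (1 - LSeries threeModFour (2 * s))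
    rw [norm_one, sub_sub_cancel, norm_sub_rev] at h10
    linarith
  rw [regularPart, norm_mul, norm_mul _ ((_ : ℂ) ^ 2), norm_pow]
  calc _ = k * (1 + |s.im|) * (1 / 2) ^ 2 * (1 / 3) := by ring
    _ ≤ (‖LFunctionTrivChar₁ 4 s * LFunction chi4 s‖ * ((1 + |s.im|) ^ b) ^ 8) *
        ‖((1 : ℂ) - 2 ^ (-s))⁻¹‖ ^ 2 * ‖LSeries threeModFour (2 * s)‖ := by
      exact mul_le_mul (mul_le_mul (h6 s hs1 hs2) (by gcongr) (by positivity) (by positivity)) h8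
        (by norm_num) (by positivity)
    _ = _ := by ring

/-- Polynomial bounds for the regular part and its first two derivatives. -/
theorem exists_regularPart_bounds {b : ℝ} (hb : 0 < b) (hb1 : b ≤ 1 / 4) :
    ∃ K : ℝ, 0 < K ∧ ∀ s : ℂ, 1 ≤ s.re → s.re ≤ 2 →
      ‖regularPart s‖ ≤ K * (1 + |s.im|) ^ (1 + 2 * b) ∧
      ‖deriv regularPart s‖ ≤ K * (1 + |s.im|) ^ (1 + 2 * b) ∧
      ‖deriv (deriv regularPart) s‖ ≤ K * (1 + |s.im|) ^ (1 + 2 * b) := by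
  obtain ⟨K, hK, h⟩ := exists_norm_regularPart_le hb hb1
  have hopen : IsOpen {s : ℂ | 1 / 2 < s.re} := isOpen_lt continuous_const Complex.continuous_re
  have hd2 : ∀ s : ℂ, 1 / 2 < s.re → DifferentiableAt ℂ (deriv regularPart) s := by
    intro s hs
    have h1 : DifferentiableOn ℂ regularPart {s : ℂ | 1 / 2 < s.re} := fun z hz =>
      (differentiableAt_regularPart hz).differentiableWithinAt
    exact ((h1.deriv hopen) s hs).differentiableAt (hopen.mem_nhds hs)
  have h1 : ∀ s : ℂ, 1 - b / 2 ≤ s.re → s.re ≤ 5 / 2 →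
      ‖deriv regularPart s‖ ≤ (4 * K / (b / 2)) * (1 + |s.im|) ^ (1 + 2 * b) := by
    intro s hs1 hs2
    refine norm_deriv_le_of_strip (T := 0) (by linarith) (by linarith) (by linarith) (by linarith)
      hK.le (fun z hz1 hz2 _ => differentiableAt_regularPart (by linarith))
      (fun z hz1 hz2 _ => h z (by linarith) (by linarith)) hs1 hs2 (abs_nonneg _)
  have h2 : ∀ s : ℂ, 1 ≤ s.re → s.re ≤ 2 → ‖deriv (deriv regularPart) s‖ ≤
      (4 * (4 * K / (b / 2)) / (b / 2)) * (1 + |s.im|) ^ (1 + 2 * b) := by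
    intro s hs1 hs2
    refine norm_deriv_le_of_strip (T := 0) (by linarith) (by linarith) (by linarith) (by linarith)
      (by positivity) (fun z hz1 hz2 _ => hd2 z (by linarith))
      (fun z hz1 hz2 _ => h1 z (by linarith) (by linarith)) hs1 hs2 (abs_nonneg _)
  refine ⟨K + 4 * K / (b / 2) + 4 * (4 * K / (b / 2)) / (b / 2), by positivity,
    fun s hs1 hs2 => ⟨?_, ?_, ?_⟩⟩
  · refine (h s (by linarith) (by linarith)).trans ?_
    gcongr
    rw [add_assoc]
    exact le_add_of_nonneg_right (by positivity)
  · refine (h1 s (by linarith) (by linarith)).trans ?_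
    gcongr
    have : 0 ≤ 4 * (4 * K / (b / 2)) / (b / 2) := by positivity
    linarith
  · refine (h2 s (by linarith) (by linarith)).trans ?_
    gcongr
    exact le_add_of_nonneg_left (by positivity)

/-! ### The second derivative of the Dirichlet series -/

theorem differentiableAt_sosSeries {s : ℂ} (hs : 1 < s.re) : DifferentiableAt ℂ sosSeries s :=
  (LSeries_hasDerivAt ((abscissaOfAbsConv_le_one norm_sos_le_one).trans_lt
    (by exact_mod_cast hs))).differentiableAt

theorem isOpen_one_lt_re : IsOpen {s : ℂ | 1 < s.re} :=
  isOpen_lt continuous_const Complex.continuous_re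

theorem differentiableAt_deriv_sosSeries {s : ℂ} (hs : 1 < s.re) :
    DifferentiableAt ℂ (deriv sosSeries) s := by
  have h1 : DifferentiableOn ℂ sosSeries {s : ℂ | 1 < s.re} := fun z hz =>
    (differentiableAt_sosSeries hz).differentiableWithinAt
  exact ((h1.deriv isOpen_one_lt_re) s hs).differentiableAt (isOpen_one_lt_re.mem_nhds hs)

theorem deriv_regularPart {s : ℂ} (hs : 1 < s.re) :
    deriv regularPart s = sosSeries s ^ 2 + 2 * (s - 1) * sosSeries s * deriv sosSeries s := by
  have h1 : regularPart =ᶠ[𝓝 s] fun z => (z - 1) * sosSeries z ^ 2 := by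
    filter_upwards [isOpen_one_lt_re.mem_nhds hs] with z hz using regularPart_eq hz
  have h2 := (differentiableAt_sosSeries hs).hasDerivAt
  have h4 : HasDerivAt (fun z => (z - 1) * sosSeries z ^ 2) _ s :=
    ((hasDerivAt_id s).sub_const 1).fun_mul (h2.fun_pow 2)
  rw [h1.deriv_eq, h4.deriv]
  simp
  ring

theorem deriv_deriv_regularPart {s : ℂ} (hs : 1 < s.re) :
    deriv (deriv regularPart) s = 4 * sosSeries s * deriv sosSeries s +
      2 * (s - 1) * (deriv sosSeries s ^ 2 + sosSeries s * deriv (deriv sosSeries) s) := by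
  have h1 : deriv regularPart =ᶠ[𝓝 s]
      fun z => sosSeries z ^ 2 + 2 * (z - 1) * sosSeries z * deriv sosSeries z := by
    filter_upwards [isOpen_one_lt_re.mem_nhds hs] with z hz using deriv_regularPart hz
  have h2 := (differentiableAt_sosSeries hs).hasDerivAt
  have h3 := (differentiableAt_deriv_sosSeries hs).hasDerivAt
  have h4 : HasDerivAt (fun z => sosSeries z ^ 2 + 2 * (z - 1) * sosSeries z * deriv sosSeries z)
      _ s := (h2.fun_pow 2).fun_add
    (((((hasDerivAt_id s).sub_const 1).const_mul 2).fun_mul h2).fun_mul h3)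
  rw [h1.deriv_eq, h4.deriv]
  simp
  ring

/-- The second derivative in terms of the regular part `W`. The leading term
`3 / 4 * F / (s - 1) ^ 2` comes from the factor `(s - 1) ^ (-1 / 2)` of `F`. -/
theorem deriv_deriv_sosSeries_sub {s : ℂ} (hs : 1 < s.re) (h0 : sosSeries s ≠ 0) :
    deriv (deriv sosSeries) s - 3 / 4 * (sosSeries s / (s - 1) ^ 2) =
      (-(deriv regularPart s / (2 * (s - 1) ^ 2)) + deriv (deriv regularPart) s / (2 * (s - 1))
        - deriv regularPart s ^ 2 / (4 * regularPart s * (s - 1))) / sosSeries s := by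
  have hp : s - 1 ≠ 0 := fun h => by rw [sub_eq_zero.1 h] at hs; simp at hs
  rw [deriv_deriv_regularPart hs, deriv_regularPart hs, regularPart_eq hs]
  field_simp
  ring

/-- The positive square root of the value of the regular part at `1`, which is a positive real
number (`regularPart_one`). -/
noncomputable def leadingCoeff : ℝ := √(regularPart 1).re

theorem sosSeries_ofReal (x : ℝ) :
    ∃ r : ℝ, 0 ≤ r ∧ sosSeries x = r := by
  refine ⟨∑' n : ℕ, sos n / (n : ℝ) ^ x, tsum_nonneg fun n =>
    div_nonneg (sos_nonneg n) (by positivity), ?_⟩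
  rw [sosSeries, LSeries, Complex.ofReal_tsum]
  refine tsum_congr fun n => ?_
  rcases eq_or_ne n 0 with rfl | hn
  · simp
  rw [LSeries.term_of_ne_zero hn, Complex.ofReal_div, Complex.ofReal_cpow (Nat.cast_nonneg n)]
  simp

theorem regularPart_one_ne_zero : regularPart 1 ≠ 0 := by
  have h1 := norm_threeModFour_sub_one_le (w := 2 * 1) (by simp)
  have h2 : LSeries threeModFour (2 * 1) ≠ 0 := by
    intro h
    rw [h] at h1
    norm_num at h1
  refine mul_ne_zero (mul_ne_zero (mul_ne_zero
    (DirichletCharacter.LFunctionTrivChar₁_apply_one_ne_zero 4)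
    (DirichletCharacter.LFunction_apply_one_ne_zero chi4_ne_one)) (pow_ne_zero 2 (inv_ne_zero
      (one_sub_two_cpow_ne_zero (by norm_num))))) h2

theorem tendsto_one_add_ofReal :
    Tendsto (fun ε : ℝ => (1 + ε : ℂ)) (𝓝[>] 0) (𝓝 1) := by
  have : Continuous fun ε : ℝ => (1 + ε : ℂ) := by fun_prop
  simpa using (this.tendsto 0).mono_left nhdsWithin_le_nhds

theorem tendsto_regularPart :
    Tendsto (fun ε : ℝ => regularPart (1 + ε)) (𝓝[>] 0) (𝓝 (regularPart 1)) :=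
  ((differentiableAt_regularPart (by norm_num)).continuousAt.tendsto).comp tendsto_one_add_ofReal

theorem regularPart_one_add {ε : ℝ} (hε : 0 < ε) :
    ∃ r : ℝ, 0 ≤ r ∧ sosSeries (1 + ε) = r ∧ regularPart (1 + ε) = ((ε * r ^ 2 : ℝ) : ℂ) := by
  obtain ⟨r, hr, h⟩ := sosSeries_ofReal (1 + ε)
  push_cast at h
  refine ⟨r, hr, h, ?_⟩
  rw [regularPart_eq (by simpa using hε), h]
  push_cast
  ring

/-- The value at `1` is the limit of the nonnegative numbers `ε F(1 + ε) ^ 2`, and it is not zero.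
-/
theorem regularPart_one : 0 < leadingCoeff ∧ regularPart 1 = (leadingCoeff : ℂ) ^ 2 := by
  have hre : Tendsto (fun ε : ℝ => (regularPart (1 + ε)).re) (𝓝[>] 0) (𝓝 (regularPart 1).re) :=
    (Complex.continuous_re.tendsto _).comp tendsto_regularPart
  have him : Tendsto (fun ε : ℝ => (regularPart (1 + ε)).im) (𝓝[>] 0) (𝓝 (regularPart 1).im) :=
    (Complex.continuous_im.tendsto _).comp tendsto_regularPart
  have h1 : 0 ≤ (regularPart 1).re := by
    refine ge_of_tendsto hre ?_
    filter_upwards [self_mem_nhdsWithin] with ε hε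
    obtain ⟨r, -, -, h⟩ := regularPart_one_add hε
    rw [h, Complex.ofReal_re]
    have : (0 : ℝ) < ε := hε
    positivity
  have h2 : (regularPart 1).im = 0 := by
    refine tendsto_nhds_unique him (Tendsto.congr' ?_ tendsto_const_nhds)
    filter_upwards [self_mem_nhdsWithin] with ε hε
    obtain ⟨r, -, -, h⟩ := regularPart_one_add hε
    rw [h, Complex.ofReal_im]
  have h3 : regularPart 1 = ((regularPart 1).re : ℂ) := by
    apply Complex.ext <;> simp [h2]
  have h4 : 0 < (regularPart 1).re := by
    refine lt_of_le_of_ne h1 fun h => regularPart_one_ne_zero ?_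
    rw [h3, ← h, Complex.ofReal_zero]
  refine ⟨Real.sqrt_pos.2 h4, ?_⟩
  rw [h3, ← Complex.ofReal_pow, leadingCoeff, Real.sq_sqrt h1]

/-- The Dirichlet series with its square root singularity removed. -/
noncomputable def desingularized (s : ℂ) : ℂ := sosSeries s * (s - 1) ^ (1 / 2 : ℂ)

theorem sub_one_mem_slitPlane {s : ℂ} (hs : 1 < s.re) : s - 1 ∈ Complex.slitPlane :=
  Or.inl (by simpa using hs)

theorem desingularized_sq {s : ℂ} (hs : 1 < s.re) : desingularized s ^ 2 = regularPart s := by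
  rw [desingularized, mul_pow, regularPart_eq hs, ← Complex.cpow_nat_mul]
  norm_num
  ring

theorem differentiableAt_desingularized {s : ℂ} (hs : 1 < s.re) :
    DifferentiableAt ℂ desingularized s :=
  (differentiableAt_sosSeries hs).mul
    ((differentiableAt_id.sub_const 1).cpow_const (sub_one_mem_slitPlane hs))

theorem deriv_desingularized {s : ℂ} (hs : 1 < s.re) :
    2 * desingularized s * deriv desingularized s = deriv regularPart s := by
  have h1 : (fun z => desingularized z ^ 2) =ᶠ[𝓝 s] regularPart := by
    filter_upwards [isOpen_one_lt_re.mem_nhds hs] with z hz using desingularized_sq hz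
  rw [← h1.deriv_eq, ((differentiableAt_desingularized hs).hasDerivAt.fun_pow 2).deriv]
  simp

theorem tendsto_desingularized :
    Tendsto (fun ε : ℝ => desingularized (1 + ε)) (𝓝[>] 0) (𝓝 leadingCoeff) := by
  have hre : Tendsto (fun ε : ℝ => (regularPart (1 + ε)).re) (𝓝[>] 0) (𝓝 (regularPart 1).re) :=
    (Complex.continuous_re.tendsto _).comp tendsto_regularPart
  have h1 : Tendsto (fun ε : ℝ => ((√(regularPart (1 + ε)).re : ℝ) : ℂ)) (𝓝[>] 0)
      (𝓝 ((√(regularPart 1).re : ℝ) : ℂ)) :=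
    (Complex.continuous_ofReal.tendsto _).comp ((Real.continuous_sqrt.tendsto _).comp hre)
  refine h1.congr' ?_
  filter_upwards [self_mem_nhdsWithin] with ε hε
  have hε' : (0 : ℝ) < ε := hε
  obtain ⟨r, hr, h2, h3⟩ := regularPart_one_add hε
  rw [h3, Complex.ofReal_re, desingularized, h2, add_sub_cancel_left, Real.sqrt_mul hε'.le,
    Real.sqrt_sq hr, Real.sqrt_eq_rpow, Complex.ofReal_mul, Complex.ofReal_cpow hε'.le]
  push_cast
  ring

/-- Near `1` the function `F(s) √(s - 1)` satisfies a Lipschitz condition, since its square `W` is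
bounded away from zero and has a bounded derivative there. -/
theorem exists_desingularized_sub_le :
    ∃ C : ℝ, 0 < C ∧ ∀ s : ℂ, 1 < s.re → s.re ≤ 2 → |s.im| ≤ 1 →
      ‖desingularized s - leadingCoeff‖ ≤ C * ‖s - 1‖ := by
  obtain ⟨K, hK, h1⟩ := exists_regularPart_bounds (b := 1 / 64) (by norm_num) (by norm_num)
  obtain ⟨k, hk, h2⟩ := exists_regularPart_lower (b := 1 / 64) (by norm_num) (by norm_num)
  have hlow : ∀ s : ℂ, 1 < s.re → s.re ≤ 2 → |s.im| ≤ 1 → √(k / 2) ≤ ‖desingularized s‖ := by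
    intro s hs1 hs2 ht
    have h3 := h2 s hs1 hs2
    have h4 : ((1 + |s.im|) ^ (1 / 64 : ℝ)) ^ 8 ≤ 2 := by
      rw [← Real.rpow_natCast, ← Real.rpow_mul (by positivity)]
      calc (1 + |s.im|) ^ (1 / 64 * ((8 : ℕ) : ℝ)) ≤ (1 + |s.im|) ^ (1 : ℝ) :=
            Real.rpow_le_rpow_of_exponent_le (by linarith [abs_nonneg s.im]) (by norm_num)
        _ = 1 + |s.im| := Real.rpow_one _
        _ ≤ 2 := by linarith
    rw [← desingularized_sq hs1, norm_pow] at h3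
    refine Real.sqrt_le_iff.2 ⟨norm_nonneg _, ?_⟩
    have h5 : k * 1 ≤ ‖desingularized s‖ ^ 2 * 2 := by
      calc k * 1 ≤ k * (1 + |s.im|) := by gcongr; linarith [abs_nonneg s.im]
        _ ≤ _ := h3
        _ ≤ _ := by gcongr
    linarith
  have hk2 : 0 < √(k / 2) := by positivity
  set C : ℝ := K * 2 ^ (1 + 2 * (1 / 64) : ℝ) / (2 * √(k / 2)) with hC
  have hC0 : 0 < C := by positivity
  have hderiv : ∀ s : ℂ, 1 < s.re → s.re ≤ 2 → |s.im| ≤ 1 → ‖deriv desingularized s‖ ≤ C := by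
    intro s hs1 hs2 ht
    have h3 := congrArg norm (deriv_desingularized hs1)
    rw [norm_mul, norm_mul, Complex.norm_ofNat] at h3
    have h4 := (h1 s hs1.le hs2).2.1
    have h5 : (1 + |s.im|) ^ (1 + 2 * (1 / 64) : ℝ) ≤ 2 ^ (1 + 2 * (1 / 64) : ℝ) := by
      gcongr
      linarith
    rw [hC, le_div_iff₀ (by positivity)]
    calc ‖deriv desingularized s‖ * (2 * √(k / 2)) ≤
          ‖deriv desingularized s‖ * (2 * ‖desingularized s‖) := by
          gcongr; exact hlow s hs1 hs2 ht
      _ = ‖deriv regularPart s‖ := by rw [← h3]; ring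
      _ ≤ _ := h4.trans (by gcongr)
  refine ⟨C, hC0, fun s hs1 hs2 ht => ?_⟩
  have hconv : Convex ℝ ((Set.Ioc 1 2 : Set ℝ) ×ℂ (Set.Icc (-1) 1 : Set ℝ)) :=
    convex_reProdIm (convex_Ioc _ _) (convex_Icc _ _)
  -- the function is not defined at `1`, so that the mean value inequality is applied between `s`
  -- and `1 + ε`, and `ε` tends to zero
  have hlip : ∀ᶠ ε : ℝ in 𝓝[>] 0,
      ‖desingularized s - desingularized (1 + ε)‖ ≤ C * ‖s - (1 + ε)‖ := by
    have : Set.Ioc (0 : ℝ) 1 ∈ 𝓝[>] (0 : ℝ) := Ioc_mem_nhdsGT one_pos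
    filter_upwards [this] with ε hε
    refine hconv.norm_image_sub_le_of_norm_deriv_le (f := desingularized) ?_ ?_ ?_ ?_
    · intro z hz
      exact differentiableAt_desingularized (Complex.mem_reProdIm.1 hz).1.1
    · intro z hz
      have := Complex.mem_reProdIm.1 hz
      exact hderiv z this.1.1 this.1.2 (abs_le.2 this.2)
    · rw [Complex.mem_reProdIm]
      simp only [Complex.add_re, Complex.one_re, Complex.ofReal_re, Complex.add_im, Complex.one_im,
        Complex.ofReal_im, Set.mem_Ioc, Set.mem_Icc]
      refine ⟨⟨by linarith [hε.1], by linarith [hε.2]⟩, by norm_num, by norm_num⟩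
    · rw [Complex.mem_reProdIm]
      exact ⟨⟨hs1, hs2⟩, abs_le.1 ht⟩
  refine le_of_tendsto_of_tendsto ((tendsto_const_nhds.sub tendsto_desingularized).norm)
    ((tendsto_const_nhds.sub tendsto_one_add_ofReal).norm.const_mul C) hlip

set_option maxHeartbeats 1000000 in
/-- The second derivative of the Dirichlet series has the singularity
`3 / 4 * c * (s - 1) ^ (-5 / 2)` at `1`, up to an error of order `|s - 1| ^ (-3 / 2)`, and grows
slowly in vertical strips. -/
theorem exists_deriv_deriv_sosSeries_bound :
    ∃ C : ℝ, 0 < C ∧ ∀ s : ℂ, 1 < s.re → s.re ≤ 2 →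
      ‖deriv (deriv sosSeries) s - 3 / 4 * leadingCoeff * (s - 1) ^ (-5 / 2 : ℂ)‖ ≤
        C * (1 / √‖s - 1‖ ^ 3 + (1 + |s.im|) ^ (1 / 4 : ℝ)) := by
  obtain ⟨K, hK, h1⟩ := exists_regularPart_bounds (b := 1 / 64) (by norm_num) (by norm_num)
  obtain ⟨k, hk, h2⟩ := exists_regularPart_lower (b := 1 / 64) (by norm_num) (by norm_num)
  obtain ⟨C0, hC0, h3⟩ := exists_desingularized_sub_le
  have hg := regularPart_one.1
  -- With `F = √W / √(s - 1)`, all quantities are measured by the square roots `z` of `τ = 1 + |im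
  -- s|`, `r` of `‖s - 1‖` and `q` of `‖W s‖`, so that only integral exponents occur; `M = τ ^ (1 /
  -- 64)` is the loss in the bounds for `W`, and `M ^ 16 = τ ^ (1 / 4)`.
  set κ : ℝ := √k with hκ
  have hκ0 : 0 < κ := Real.sqrt_pos.2 hk
  set D : ℝ := K / κ + K ^ 2 / κ ^ 3 with hD
  have hD0 : 0 < D := by positivity
  refine ⟨8 * D + C0 + 16 * √K + leadingCoeff, by positivity, fun s hs1 hs2 => ?_⟩
  set τ : ℝ := 1 + |s.im| with hτ
  have hτ1 : 1 ≤ τ := by simp [hτ]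
  have hτ0 : 0 < τ := by linarith
  set M : ℝ := τ ^ (1 / 64 : ℝ) with hM
  have hM1 : 1 ≤ M := Real.one_le_rpow hτ1 (by norm_num)
  have hM0 : 0 < M := by linarith
  have hM16 : M ^ 16 = τ ^ (1 / 4 : ℝ) := by
    rw [hM, ← Real.rpow_natCast, ← Real.rpow_mul hτ0.le]; norm_num
  set z : ℝ := √τ with hz
  have hz1 : 1 ≤ z := Real.one_le_sqrt.2 hτ1
  have hz0 : 0 < z := by linarith
  have hzτ : z ^ 2 = τ := Real.sq_sqrt hτ0.le
  have hU : τ ^ (1 + 2 * (1 / 64) : ℝ) = z ^ 2 * M ^ 2 := by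
    rw [Real.rpow_add hτ0, Real.rpow_one, hzτ, hM, ← Real.rpow_natCast, ← Real.rpow_mul hτ0.le]
    norm_num
  have hp : s - 1 ≠ 0 := fun h => by rw [sub_eq_zero.1 h] at hs1; simp at hs1
  set r : ℝ := √‖s - 1‖ with hr
  have hr0 : 0 < r := Real.sqrt_pos.2 (norm_pos_iff.2 hp)
  have hr2 : ‖s - 1‖ = r ^ 2 := (Real.sq_sqrt (norm_nonneg _)).symm
  set q : ℝ := ‖desingularized s‖ with hq
  have hqW : ‖regularPart s‖ = q ^ 2 := by rw [← desingularized_sq hs1, norm_pow]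
  have hqlow : κ * z ≤ q * M ^ 4 := by
    have h4 := h2 s hs1 hs2
    rw [hqW] at h4
    have h5 : (κ * z) ^ 2 ≤ (q * M ^ 4) ^ 2 := by
      rw [mul_pow, hzτ, hκ, Real.sq_sqrt hk.le]
      refine h4.trans (le_of_eq (by ring))
    exact (pow_le_pow_iff_left₀ (by positivity) (by positivity) (by norm_num)).1 h5
  have hq0 : 0 < q := by
    by_contra hcon
    have : q = 0 := le_antisymm (not_lt.1 hcon) (norm_nonneg _)
    rw [this, zero_mul] at hqlow
    have : 0 < κ * z := by positivity
    linarith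
  have hF : ‖sosSeries s‖ = q / r := by
    have h4 : q ^ 2 = (‖sosSeries s‖ * r) ^ 2 := by
      rw [← hqW, regularPart_eq hs1, norm_mul, norm_pow, hr2]
      ring
    have h5 := (pow_left_inj₀ hq0.le (by positivity) two_ne_zero).1 h4
    rw [h5]
    field_simp
  have hF0 : sosSeries s ≠ 0 := norm_pos_iff.1 (by rw [hF]; positivity)
  obtain ⟨hb0, hb1, hb2⟩ := h1 s hs1.le hs2
  rw [hU] at hb0 hb1 hb2
  have hqinv : 1 / q ≤ M ^ 4 / (κ * z) := by
    rw [div_le_div_iff₀ hq0 (by positivity)]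
    linarith
  -- the part that vanishes to lower order at `1`
  have hA : ‖deriv (deriv sosSeries) s - 3 / 4 * (sosSeries s / (s - 1) ^ 2)‖ ≤
      D * (z * M ^ 16) * (1 / r ^ 3 + 1 / r) := by
    rw [deriv_deriv_sosSeries_sub hs1 hF0, norm_div, hF]
    have n1 : ‖deriv regularPart s / (2 * (s - 1) ^ 2)‖ ≤ K * (z ^ 2 * M ^ 2) / (2 * r ^ 4) := by
      rw [norm_div, norm_mul, norm_pow, hr2, Complex.norm_ofNat,
        show (r ^ 2) ^ 2 = r ^ 4 by ring]
      gcongr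
    have n2 : ‖deriv (deriv regularPart) s / (2 * (s - 1))‖ ≤
        K * (z ^ 2 * M ^ 2) / (2 * r ^ 2) := by
      rw [norm_div, norm_mul, hr2, Complex.norm_ofNat]
      gcongr
    have n3 : ‖deriv regularPart s ^ 2 / (4 * regularPart s * (s - 1))‖ ≤
        (K * (z ^ 2 * M ^ 2)) ^ 2 / (4 * q ^ 2 * r ^ 2) := by
      rw [norm_div, norm_mul, norm_mul, norm_pow, hr2, hqW, Complex.norm_ofNat]
      gcongr
    have n4 := norm_sub_le_of_le (norm_add_le_of_le ((norm_neg _).le.trans n1) n2) n3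
    have e1 : (K * (z ^ 2 * M ^ 2) / (2 * r ^ 4) + K * (z ^ 2 * M ^ 2) / (2 * r ^ 2) +
        (K * (z ^ 2 * M ^ 2)) ^ 2 / (4 * q ^ 2 * r ^ 2)) / (q / r) =
        K * (z ^ 2 * M ^ 2) / 2 * (1 / q) * (1 / r ^ 3)
          + K * (z ^ 2 * M ^ 2) / 2 * (1 / q) * (1 / r)
          + (K * (z ^ 2 * M ^ 2)) ^ 2 / 4 * (1 / q) ^ 3 * (1 / r) := by
      field_simp
    calc _ ≤ _ := div_le_div_of_nonneg_right n4 (by positivity)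
      _ = _ := e1
      _ ≤ K * (z ^ 2 * M ^ 2) / 2 * (M ^ 4 / (κ * z)) * (1 / r ^ 3)
          + K * (z ^ 2 * M ^ 2) / 2 * (M ^ 4 / (κ * z)) * (1 / r)
          + (K * (z ^ 2 * M ^ 2)) ^ 2 / 4 * (M ^ 4 / (κ * z)) ^ 3 * (1 / r) := by gcongr
      _ = (1 / 2) * (K / κ) * (z * M ^ 6) * (1 / r ^ 3 + 1 / r)
          + (1 / 4) * (K ^ 2 / κ ^ 3) * (z * M ^ 16) * (0 + 1 / r) := by
          field_simp
          ring
      _ ≤ 1 * (K / κ) * (z * M ^ 16) * (1 / r ^ 3 + 1 / r)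
          + 1 * (K ^ 2 / κ ^ 3) * (z * M ^ 16) * (1 / r ^ 3 + 1 / r) := by
          gcongr <;> first | assumption | positivity | norm_num
      _ = _ := by rw [hD]; ring
  have hsplit : ‖deriv (deriv sosSeries) s - 3 / 4 * leadingCoeff * (s - 1) ^ (-5 / 2 : ℂ)‖ ≤
      D * (z * M ^ 16) * (1 / r ^ 3 + 1 / r) +
      ‖sosSeries s / (s - 1) ^ 2 - leadingCoeff * (s - 1) ^ (-5 / 2 : ℂ)‖ := by
    have e : deriv (deriv sosSeries) s - 3 / 4 * leadingCoeff * (s - 1) ^ (-5 / 2 : ℂ) =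
        (deriv (deriv sosSeries) s - 3 / 4 * (sosSeries s / (s - 1) ^ 2)) +
        3 / 4 * (sosSeries s / (s - 1) ^ 2 - leadingCoeff * (s - 1) ^ (-5 / 2 : ℂ)) := by ring
    rw [e]
    refine norm_add_le_of_le hA ?_
    rw [norm_mul]
    have : ‖(3 / 4 : ℂ)‖ ≤ 1 := by norm_num
    exact mul_le_of_le_one_left (norm_nonneg _) this
  have hpow : ‖(s - 1) ^ (-5 / 2 : ℂ)‖ = 1 / r ^ 5 := by
    rw [show (-5 / 2 : ℂ) = ((-5 / 2 : ℝ) : ℂ) by push_cast; ring, Complex.norm_cpow_real, hr2,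
      ← Real.rpow_natCast r 2, ← Real.rpow_mul hr0.le]
    rw [show ((2 : ℕ) : ℝ) * (-5 / 2) = -((5 : ℕ) : ℝ) by norm_num, Real.rpow_neg hr0.le,
      Real.rpow_natCast, one_div]
  rw [← hM16]
  have him : |s.im| ≤ r ^ 2 := by
    rw [← hr2]; simpa using Complex.abs_im_le_norm (s - 1)
  -- Near the real axis `F` is compared with its leading term. Away from it `√τ ≤ 2 √‖s - 1‖`, both
  -- terms of the difference are bounded by a power of `M`, and no cancellation is needed.
  rcases le_or_gt |s.im| 1 with ht | ht
  · have hB : ‖sosSeries s / (s - 1) ^ 2 - leadingCoeff * (s - 1) ^ (-5 / 2 : ℂ)‖ ≤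
        C0 * (1 / r ^ 3) := by
      have h4 := h3 s hs1 hs2 ht
      have e : sosSeries s / (s - 1) ^ 2 - leadingCoeff * (s - 1) ^ (-5 / 2 : ℂ) =
          (desingularized s - leadingCoeff) * (s - 1) ^ (-5 / 2 : ℂ) := by
        have e1 : (s - 1) ^ (1 / 2 : ℂ) * (s - 1) ^ (-5 / 2 : ℂ) = ((s - 1) ^ 2)⁻¹ := by
          rw [← Complex.cpow_add _ _ hp, ← Complex.cpow_natCast, ← Complex.cpow_neg]
          norm_num
        rw [desingularized, sub_mul, mul_assoc, e1, div_eq_mul_inv]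
      rw [e, norm_mul, hpow]
      calc _ ≤ C0 * ‖s - 1‖ * (1 / r ^ 5) := by gcongr
        _ = _ := by rw [hr2]; field_simp
    have hz2 : z * M ^ 16 ≤ 2 := by
      have hτ2 : τ ≤ 2 := by linarith
      calc z * M ^ 16 = τ ^ (1 / 2 : ℝ) * τ ^ (1 / 4 : ℝ) := by rw [hM16, hz, Real.sqrt_eq_rpow]
        _ = τ ^ (3 / 4 : ℝ) := by rw [← Real.rpow_add hτ0]; norm_num
        _ ≤ τ ^ (1 : ℝ) := Real.rpow_le_rpow_of_exponent_le hτ1 (by norm_num)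
        _ ≤ 2 := by rwa [Real.rpow_one]
    have hrr : 1 / r ≤ 2 * (1 / r ^ 3) := by
      have h5 : r ^ 2 ≤ 2 := by
        rw [← hr2]
        have := Complex.norm_le_abs_re_add_abs_im (s - 1)
        simp only [Complex.sub_re, Complex.one_re, Complex.sub_im, Complex.one_im, sub_zero] at this
        rw [abs_of_pos (by linarith : 0 < s.re - 1)] at this
        linarith
      rw [mul_one_div, div_le_div_iff₀ hr0 (by positivity)]
      nlinarith
    have hpos : 0 < 1 / r ^ 3 := by positivity
    calc _ ≤ _ := hsplit
      _ ≤ D * 2 * (1 / r ^ 3 + 2 * (1 / r ^ 3)) + C0 * (1 / r ^ 3) := by gcongr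
      _ = (6 * D + C0) * (1 / r ^ 3) := by ring
      _ ≤ (8 * D + C0 + 16 * √K + leadingCoeff) * (1 / r ^ 3 + M ^ 16) := by
          have h5 : 0 ≤ √K := Real.sqrt_nonneg _
          have h6 := pow_pos hM0 16
          exact mul_le_mul (by linarith) (by linarith) hpos.le (by positivity)
  · have hrz : z ≤ 2 * r := by
      have h5 : z ^ 2 ≤ (2 * r) ^ 2 := by rw [hzτ]; nlinarith
      exact (pow_le_pow_iff_left₀ hz0.le (by positivity) two_ne_zero).1 h5
    have hr1 : 1 ≤ r := by
      have : 1 ^ 2 ≤ r ^ 2 := by linarith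
      exact (pow_le_pow_iff_left₀ zero_le_one hr0.le two_ne_zero).1 this
    have hqup : q ≤ √K * (z * M) := by
      have h4 : q ^ 2 ≤ (√K * (z * M)) ^ 2 := by
        rw [← hqW, mul_pow, Real.sq_sqrt hK.le, mul_pow]; exact hb0
      exact (pow_le_pow_iff_left₀ hq0.le (by positivity) two_ne_zero).1 h4
    have hB : ‖sosSeries s / (s - 1) ^ 2 - leadingCoeff * (s - 1) ^ (-5 / 2 : ℂ)‖ ≤
        2 * √K * M + leadingCoeff := by
      refine norm_sub_le_of_le ?_ ?_
      · rw [norm_div, hF, norm_pow, hr2]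
        have e : q / r / (r ^ 2) ^ 2 = q / (r * r ^ 4) := by field_simp
        rw [e]
        calc q / (r * r ^ 4) ≤ √K * (2 * r * M) / (r * 1) := by
              gcongr
              · exact hqup.trans (by gcongr)
              · exact one_le_pow₀ hr1
          _ = _ := by field_simp
      · rw [norm_mul, hpow, Complex.norm_real, Real.norm_of_nonneg hg.le]
        refine mul_le_of_le_one_right hg.le ?_
        rw [div_le_one (by positivity)]
        exact one_le_pow₀ hr1
    have h6 : z * (1 / r ^ 3 + 1 / r) ≤ 4 := by
      have : 1 / r ^ 3 ≤ 1 / r := by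
        gcongr
        exact le_self_pow₀ hr1 (by norm_num)
      calc z * (1 / r ^ 3 + 1 / r) ≤ (2 * r) * (1 / r + 1 / r) := by gcongr
        _ = 4 := by field_simp; norm_num
    have hMM : M ≤ M ^ 16 := le_self_pow₀ hM1 (by norm_num)
    have h1M : 1 ≤ M ^ 16 := one_le_pow₀ hM1
    calc _ ≤ _ := hsplit
      _ = D * M ^ 16 * (z * (1 / r ^ 3 + 1 / r)) + ‖sosSeries s / (s - 1) ^ 2 -
          leadingCoeff * (s - 1) ^ (-5 / 2 : ℂ)‖ := by ring
      _ ≤ D * M ^ 16 * 4 + (2 * √K * M + leadingCoeff) := by gcongr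
      _ ≤ D * M ^ 16 * 4 + (2 * √K * M ^ 16 + leadingCoeff * M ^ 16) := by
          gcongr
          exact le_mul_of_one_le_right hg.le h1M
      _ = (4 * D + 2 * √K + leadingCoeff) * M ^ 16 := by ring
      _ ≤ (8 * D + C0 + 16 * √K + leadingCoeff) * (1 / r ^ 3 + M ^ 16) := by
          have h7 : 0 ≤ √K := Real.sqrt_nonneg _
          have h8 : 0 < 1 / r ^ 3 := by positivity
          exact mul_le_mul (by linarith) (by linarith) (by positivity) (by positivity)

/-! ### A Laplace transform and the Perron kernel -/

open MeasureTheory in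
/-- The Laplace transform of a power, at complex arguments: both sides are holomorphic in the
right half plane and they agree on the real axis. -/
theorem integral_rpow_mul_cexp_neg_mul {a : ℝ} (ha : 0 < a) {p : ℂ} (hp : 0 < p.re) :
    ∫ v in Set.Ioi (0 : ℝ), ((v ^ (a - 1) : ℝ) : ℂ) * Complex.exp (-(p * v)) =
      (Real.Gamma a : ℂ) * p ^ (-a : ℂ) := by
  have hmeas : ∀ (b : ℝ) (q : ℂ), AEStronglyMeasurable
      (fun v : ℝ => ((v ^ b : ℝ) : ℂ) * Complex.exp (-(q * v))) (volume.restrict (Set.Ioi 0)) := by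
    intro b q
    exact Measurable.aestronglyMeasurable (by fun_prop)
  have hint : ∀ {b ε : ℝ}, -1 < b → 0 < ε →
      Integrable (fun v : ℝ => v ^ b * Real.exp (-ε * v)) (volume.restrict (Set.Ioi 0)) := by
    intro b ε hb hε
    have := integrableOn_rpow_mul_exp_neg_mul_rpow hb (zero_lt_one) hε
    simpa [IntegrableOn] using this
  have hnorm : ∀ (b : ℝ) {q : ℂ} {ε v : ℝ}, 0 < v → ε ≤ q.re →
      ‖((v ^ b : ℝ) : ℂ) * Complex.exp (-(q * v))‖ ≤ v ^ b * Real.exp (-ε * v) := by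
    intro b q ε v hv hq
    rw [norm_mul, Complex.norm_real, Complex.norm_exp, Real.norm_of_nonneg (by positivity)]
    gcongr
    simp only [Complex.neg_re, Complex.mul_re, Complex.ofReal_re, Complex.ofReal_im, mul_zero,
      sub_zero, neg_mul]
    gcongr
  have hU : IsOpen {q : ℂ | 0 < q.re} := isOpen_lt continuous_const Complex.continuous_re
  have hd : DifferentiableOn ℂ (fun q : ℂ => ∫ v in Set.Ioi (0 : ℝ),
      ((v ^ (a - 1) : ℝ) : ℂ) * Complex.exp (-(q * v))) {q : ℂ | 0 < q.re} := by
    intro q hq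
    have hq' : 0 < q.re := hq
    have hs : {z : ℂ | q.re / 2 < z.re} ∈ 𝓝 q :=
      (isOpen_lt continuous_const Complex.continuous_re).mem_nhds (by
        show q.re / 2 < q.re
        linarith)
    refine (hasDerivAt_integral_of_dominated_loc_of_deriv_le (𝕜 := ℂ)
      (F' := fun z v => -(((v ^ a : ℝ) : ℂ) * Complex.exp (-(z * v))))
      (bound := fun v => v ^ a * Real.exp (-(q.re / 2) * v)) hs
      (Eventually.of_forall fun z => hmeas _ z) ?_ (hmeas a q).neg ?_
      (hint (by linarith) (by linarith)) ?_).2.differentiableAt.differentiableWithinAt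
    · refine (hint (b := a - 1) (ε := q.re) (by linarith) hq').mono' (hmeas _ q) ?_
      filter_upwards [ae_restrict_mem measurableSet_Ioi] with v hv
      exact hnorm _ hv le_rfl
    · filter_upwards [ae_restrict_mem measurableSet_Ioi] with v hv z hz
      rw [norm_neg]
      exact hnorm _ hv (le_of_lt hz)
    · filter_upwards [ae_restrict_mem measurableSet_Ioi] with v hv z hz
      have hv0 : (0 : ℝ) < v := hv
      have h1 : HasDerivAt (fun z : ℂ => -(z * v)) (-(1 * (v : ℂ))) z :=
        ((hasDerivAt_id z).mul_const _).neg
      refine (h1.cexp.const_mul ((v ^ (a - 1) : ℝ) : ℂ)).congr_deriv ?_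
      rw [show v ^ a = v ^ (a - 1) * v by rw [← Real.rpow_add_one hv0.ne', sub_add_cancel]]
      push_cast
      ring
  have hg : DifferentiableOn ℂ (fun q : ℂ => (Real.Gamma a : ℂ) * q ^ (-a : ℂ))
      {q : ℂ | 0 < q.re} := by
    intro q hq
    have : q ∈ Complex.slitPlane := Or.inl hq
    exact ((differentiableAt_id.cpow_const this).const_mul _).differentiableWithinAt
  have hconn : IsPreconnected {q : ℂ | 0 < q.re} :=
    (convex_halfSpace_re_gt 0).isPreconnected
  refine AnalyticOnNhd.eqOn_of_preconnected_of_frequently_eq (hd.analyticOnNhd hU)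
    (hg.analyticOnNhd hU) hconn (z₀ := 1) (by simp) ?_ hp
  have htend : Tendsto (fun r : ℝ => (r : ℂ)) (𝓝[>] 1) (𝓝[≠] 1) := by
    refine tendsto_nhdsWithin_iff.2 ⟨?_, ?_⟩
    · exact (Complex.continuous_ofReal.tendsto' 1 1 (by simp)).mono_left nhdsWithin_le_nhds
    · filter_upwards [self_mem_nhdsWithin] with r hr
      have : (1 : ℝ) < r := hr
      simp only [Set.mem_compl_iff, Set.mem_singleton_iff]
      exact_mod_cast this.ne'
  refine htend.frequently (Eventually.frequently ?_)
  filter_upwards [self_mem_nhdsWithin] with r hr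
  have hr0 : 0 < r := lt_trans zero_lt_one hr
  have h1 := Real.integral_rpow_mul_exp_neg_mul_Ioi ha hr0
  have h2 : ∀ v : ℝ, ((v ^ (a - 1) : ℝ) : ℂ) * Complex.exp (-(r * v)) =
      ((v ^ (a - 1) * Real.exp (-(r * v)) : ℝ) : ℂ) := by intro v; push_cast; rfl
  simp only [h2]
  rw [integral_complex_ofReal, h1, one_div, Real.inv_rpow hr0.le, ← Real.rpow_neg hr0.le,
    mul_comm, Complex.ofReal_mul, Complex.ofReal_cpow hr0.le]
  push_cast
  rfl

theorem integrable_inv_mul_add_one {σ : ℝ} (hσ : 1 ≤ σ) :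
    MeasureTheory.Integrable
      (fun t : ℝ => 1 / ((σ + t * Complex.I : ℂ) * (σ + t * Complex.I + 1))) := by
  refine (integrable_inv_one_add_sq).mono' (Measurable.aestronglyMeasurable (by fun_prop))
    (Eventually.of_forall fun t => ?_)
  have h1 : 1 + t ^ 2 ≤ ‖(σ + t * Complex.I : ℂ)‖ ^ 2 := by
    rw [← Complex.normSq_eq_norm_sq, Complex.normSq_add_mul_I]
    nlinarith
  have h2 : ‖(σ + t * Complex.I : ℂ)‖ ≤ ‖(σ + t * Complex.I + 1 : ℂ)‖ := by
    rw [← pow_le_pow_iff_left₀ (norm_nonneg _) (norm_nonneg _) two_ne_zero,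
      show (σ + t * Complex.I + 1 : ℂ) = ((σ + 1 : ℝ) : ℂ) + t * Complex.I by push_cast; ring,
      ← Complex.normSq_eq_norm_sq, ← Complex.normSq_eq_norm_sq, Complex.normSq_add_mul_I,
      Complex.normSq_add_mul_I]
    nlinarith
  rw [norm_div, norm_one, norm_mul, one_div]
  refine inv_anti₀ (by positivity) ?_
  nlinarith [norm_nonneg (σ + t * Complex.I : ℂ)]

open MeasureTheory in
/-- The Perron kernel: Mellin inversion for the function `max (1 - x) 0`, whose Mellin transform
is `1 / (s (s + 1))`. -/
theorem max_one_sub_eq_integral {σ : ℝ} (hσ : 1 ≤ σ) {x : ℝ} (hx : 0 < x) :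
    ((max (1 - x) 0 : ℝ) : ℂ) = 1 / (2 * Real.pi) * ∫ t : ℝ, (x : ℂ) ^ (-(σ + t * Complex.I)) *
      (1 / ((σ + t * Complex.I) * (σ + t * Complex.I + 1))) := by
  set f : ℝ → ℂ := fun t => Set.indicator (Set.Ioc (0 : ℝ) 1) (fun _ => (1 : ℂ)) t -
    Set.indicator (Set.Ioc (0 : ℝ) 1) (fun t : ℝ => (t : ℂ) ^ (1 : ℂ)) t with hf
  have hm : ∀ s : ℂ, 0 < s.re → HasMellin f s (1 / (s * (s + 1))) := by
    intro s hs
    have h1 := hasMellin_one_Ioc hs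
    have h2 := hasMellin_cpow_Ioc 1 (s := s) (by simp; linarith)
    have h3 := hasMellin_sub h1.1 h2.1
    rw [h1.2, h2.2] at h3
    have hs0 : s ≠ 0 := by rintro rfl; simp at hs
    have hs1 : s + 1 ≠ 0 := by
      intro h
      have := congrArg Complex.re h
      simp at this
      linarith
    rwa [show 1 / (s * (s + 1)) = 1 / s - 1 / (s + 1) by field_simp; ring]
  have hre : ∀ t : ℝ, 0 < (σ + t * Complex.I : ℂ).re := by
    intro t; simp; linarith
  have hfx : ∀ y : ℝ, 0 < y → f y = ((max (1 - y) 0 : ℝ) : ℂ) := by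
    intro y hy
    rcases le_or_gt y 1 with h | h
    · rw [hf, max_eq_left (by linarith)]
      simp [hy, h]
    · rw [hf, max_eq_right (by linarith)]
      simp [h.not_ge]
  have hcont : ContinuousAt f x := by
    have : (fun y : ℝ => ((max (1 - y) 0 : ℝ) : ℂ)) =ᶠ[𝓝 x] f := by
      filter_upwards [lt_mem_nhds hx] with y hy
      exact (hfx y hy).symm
    refine ContinuousAt.congr ?_ this
    fun_prop
  have hvert : Complex.VerticalIntegrable (mellin f) σ := by
    refine (integrable_inv_mul_add_one hσ).congr (Eventually.of_forall fun t => ?_)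
    exact (hm _ (hre t)).2.symm
  have := mellinInv_mellin_eq σ f hx (by
    have := hre 0
    exact (hm σ (by simpa using this)).1) hvert hcont
  rw [← hfx x hx, ← this, mellinInv]
  simp only [(hm _ (hre _)).2, smul_eq_mul]
  rw [Complex.real_smul]
  push_cast
  rfl

open MeasureTheory in
/-- Perron's formula with the weight `max (X - y) 0`, for an arbitrary `σ`-finite superposition
of the frequencies `y`. -/
theorem integral_mul_max_sub_eq {α : Type*} [MeasurableSpace α] {μ : Measure α} [SFinite μ]
    {w y : α → ℝ} (hw : Measurable w) (hy : Measurable y) (hy0 : ∀ a, w a ≠ 0 → 0 < y a)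
    {σ : ℝ} (hσ : 1 ≤ σ) (hint : Integrable (fun a => w a * y a ^ (-σ)) μ) {X : ℝ} (hX : 0 < X) :
    Integrable (fun t : ℝ => (∫ a, (w a : ℂ) * (y a : ℂ) ^ (-(σ + t * Complex.I)) ∂μ) *
      ((X : ℂ) ^ (σ + t * Complex.I + 1) / ((σ + t * Complex.I) * (σ + t * Complex.I + 1)))) ∧
    ((∫ a, w a * max (X - y a) 0 ∂μ : ℝ) : ℂ) = 1 / (2 * Real.pi) *
      ∫ t : ℝ, (∫ a, (w a : ℂ) * (y a : ℂ) ^ (-(σ + t * Complex.I)) ∂μ) *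
      ((X : ℂ) ^ (σ + t * Complex.I + 1) / ((σ + t * Complex.I) * (σ + t * Complex.I + 1))) := by
  set G : α → ℝ → ℂ := fun a t => ((w a : ℂ) * (y a : ℂ) ^ (-(σ + t * Complex.I))) *
      ((X : ℂ) ^ (σ + t * Complex.I + 1) / ((σ + t * Complex.I) * (σ + t * Complex.I + 1))) with hG
  have hGmeas : Measurable (Function.uncurry G) := by
    simp only [hG, Function.uncurry_def]
    fun_prop
  have hGint : Integrable (Function.uncurry G) (μ.prod volume) := by
    have h1 := hint.norm.mul_prod ((integrable_inv_mul_add_one hσ).norm.const_mul (X ^ (σ + 1)))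
    refine h1.mono' hGmeas.aestronglyMeasurable (Eventually.of_forall fun ⟨a, t⟩ => ?_)
    simp only [Function.uncurry_apply_pair, hG]
    by_cases hwa : w a = 0
    · simp only [hwa, Complex.ofReal_zero, zero_mul, norm_zero, le_refl]
    have hya := hy0 a hwa
    rw [norm_mul, norm_mul, norm_div, Complex.norm_cpow_eq_rpow_re_of_pos hya,
      Complex.norm_cpow_eq_rpow_re_of_pos hX, norm_div, norm_mul (w a), norm_one,
      Real.norm_of_nonneg (Real.rpow_nonneg hya.le _), Complex.norm_real]
    simp only [Complex.neg_re, Complex.add_re, Complex.ofReal_re, Complex.mul_re, Complex.I_re,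
      mul_zero, Complex.ofReal_im, Complex.I_im, mul_one, sub_self, add_zero, Complex.one_re]
    rw [mul_one_div]
  have hslice : ∀ a, ∫ t, G a t = ((2 * Real.pi * (w a * max (X - y a) 0) : ℝ) : ℂ) := by
    intro a
    by_cases hwa : w a = 0
    · simp [hG, hwa]
    have hya := hy0 a hwa
    have h1 := max_one_sub_eq_integral hσ (div_pos hya hX)
    have h2 : X - y a = X * (1 - y a / X) := by field_simp
    have h3 : max (X - y a) 0 = X * max (1 - y a / X) 0 := by
      rw [h2, mul_max_of_nonneg _ _ hX.le, mul_zero]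
    have hpi : (Real.pi : ℂ) ≠ 0 := by exact_mod_cast Real.pi_ne_zero
    have hX0 : (X : ℂ) ≠ 0 := by exact_mod_cast hX.ne'
    rw [h3, Complex.ofReal_mul, Complex.ofReal_mul (w a), Complex.ofReal_mul X, h1]
    push_cast
    rw [show (2 * Real.pi : ℂ) * (w a * (X * (1 / (2 * Real.pi) * ∫ t : ℝ,
      ((y a : ℂ) / X) ^ (-(σ + t * Complex.I)) *
      (1 / ((σ + t * Complex.I) * (σ + t * Complex.I + 1)))))) = (w a * X) * ∫ t : ℝ,
      ((y a : ℂ) / X) ^ (-(σ + t * Complex.I)) *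
      (1 / ((σ + t * Complex.I) * (σ + t * Complex.I + 1))) by
        generalize (∫ t : ℝ, ((y a : ℂ) / X) ^ (-(σ + t * Complex.I)) *
          (1 / ((σ + t * Complex.I) * (σ + t * Complex.I + 1)))) = J
        field_simp, ← integral_const_mul]
    congr 1
    funext t
    simp only [hG]
    rw [Complex.cpow_add _ _ hX0, Complex.cpow_one, div_eq_mul_inv (y a : ℂ), ← Complex.ofReal_inv,
      Complex.mul_cpow_ofReal_nonneg hya.le (by positivity), Complex.ofReal_inv,
      Complex.inv_cpow_ofReal_nonneg hX.le, Complex.cpow_neg (X : ℂ), inv_inv]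
    ring
  have hsw := integral_integral_swap hGint
  have e1 : ∀ t, ∫ a, G a t ∂μ = (∫ a, (w a : ℂ) * (y a : ℂ) ^ (-(σ + t * Complex.I)) ∂μ) *
      ((X : ℂ) ^ (σ + t * Complex.I + 1) /
        ((σ + t * Complex.I) * (σ + t * Complex.I + 1))) := fun t => integral_mul_const _ _
  constructor
  · refine hGint.integral_prod_right.congr (Eventually.of_forall fun t => ?_)
    exact e1 t
  · simp only [hslice, e1] at hsw
    rw [← hsw, integral_complex_ofReal, integral_const_mul]
    have hpi : (Real.pi : ℂ) ≠ 0 := by exact_mod_cast Real.pi_ne_zero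
    push_cast
    field_simp

/-! ### Comparing two counting functions through their Dirichlet transforms -/

theorem norm_cpow_add_one_sub_le {x x' : ℝ} (hx : 0 < x) (hxx : x ≤ x') {s : ℂ} (hs : 0 ≤ s.re) :
    ‖(x' : ℂ) ^ (s + 1) - (x : ℂ) ^ (s + 1)‖ ≤ ‖s + 1‖ * x' ^ s.re * (x' - x) := by
  have hs1 : s + 1 ≠ 0 := by
    intro h
    have := congrArg Complex.re h
    simp at this
    linarith
  have h := (convex_Icc x x').norm_image_sub_le_of_norm_hasDerivWithin_le
    (f := fun y : ℝ => (y : ℂ) ^ (s + 1)) (f' := fun y : ℝ => (s + 1) * (y : ℂ) ^ s)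
    (C := ‖s + 1‖ * x' ^ s.re) ?_ ?_ (Set.left_mem_Icc.2 hxx) (Set.right_mem_Icc.2 hxx)
  · rwa [Real.norm_of_nonneg (by linarith)] at h
  · intro y hy
    have hy0 : 0 < y := hx.trans_le hy.1
    have h1 := ((hasDerivAt_id (y : ℂ)).cpow_const (c := s + 1)
      (Complex.ofReal_mem_slitPlane.2 hy0)).comp_ofReal
    simp only [id, add_sub_cancel_right, mul_one] at h1
    exact h1.hasDerivWithinAt
  · intro y hy
    have hy0 : 0 < y := hx.trans_le hy.1
    rw [norm_mul, Complex.norm_cpow_eq_rpow_re_of_pos hy0]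
    gcongr
    exact hy.2

theorem half_add_le_norm {a : ℝ} (z : ℂ) (ha : a ≤ z.re) : (a + |z.im|) / 2 ≤ ‖z‖ := by
  have h1 := (Complex.re_le_norm z)
  have h2 := Complex.abs_im_le_norm z
  linarith

/-- The two bounds for the kernel of the difference quotient of Perron's formula: the trivial one,
and the geometric mean of the bounds `‖s‖⁻¹` (mean value theorem) and `u ‖s‖⁻²` (where the length
`1 / u` of the interval is lost). -/
theorem norm_perron_quotient_le {u v : ℝ} (hu : 1 ≤ u) (hvu : v ≤ u) {s : ℂ}
    (hs : s.re = 1 + 1 / u) :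
    ‖((Real.exp (v + 1 / u) : ℂ) ^ (s + 1) - (Real.exp v : ℂ) ^ (s + 1)) / (s * (s + 1))‖ ≤
    (Real.exp (v + 1 / u) - Real.exp v) * Real.exp (u + 3) *
      min 1 (8 * √u * (1 + |s.im|) ^ (-(3 / 2) : ℝ)) := by
  have hu0 : 0 < u := by linarith
  have hh1 : 1 / u ≤ 1 := by rw [div_le_one hu0]; exact hu
  have hh0 : 0 < 1 / u := by positivity
  set h := 1 / u with hh
  set x := Real.exp v with hx
  set x' := Real.exp (v + h) with hx'
  have hx0 : 0 < x := Real.exp_pos _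
  have hx0' : 0 < x' := Real.exp_pos _
  have hlen : h / 2 * x' ≤ x' - x := by
    have e : x = x' * Real.exp (-h) := by rw [hx, hx', ← Real.exp_add]; congr 1; ring
    have h1 : Real.exp (-h) ≤ 1 - h / 2 := by
      rw [Real.exp_neg, inv_le_comm₀ (Real.exp_pos _) (by linarith)]
      have h2 : 1 + h ≤ Real.exp h := by linarith [Real.add_one_le_exp h]
      refine le_trans ?_ h2
      rw [inv_eq_one_div, div_le_iff₀ (by linarith)]
      nlinarith
    rw [e]
    nlinarith
  have hd0 : 0 < x' - x := lt_of_lt_of_le (by positivity) hlen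
  have hre : 1 ≤ s.re := by linarith
  have hP : x' ^ s.re ≤ Real.exp (u + 3) := by
    rw [hx', ← Real.exp_mul, hs]
    apply Real.exp_le_exp.2
    have e : u * h = 1 := by rw [hh]; field_simp
    have h1 : (v + h) * (1 + h) ≤ (u + h) * (1 + h) := by gcongr
    have h2 : (u + h) * (1 + h) = u + 1 + h + h * h := by linear_combination e
    nlinarith
  have hs1 : 1 ≤ ‖s‖ := hre.trans (Complex.re_le_norm s)
  have hs2 : ‖s‖ ≤ ‖s + 1‖ := by
    rw [← pow_le_pow_iff_left₀ (norm_nonneg _) (norm_nonneg _) two_ne_zero,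
      ← Complex.normSq_eq_norm_sq, ← Complex.normSq_eq_norm_sq, Complex.normSq_apply,
      Complex.normSq_apply]
    simp only [Complex.add_re, Complex.one_re, Complex.add_im, Complex.one_im, add_zero]
    nlinarith
  have hs3 : (1 + |s.im|) / 2 ≤ ‖s‖ := half_add_le_norm s hre
  set E := Real.exp (u + 3) with hE
  have hE0 : 0 < E := Real.exp_pos _
  set N := ‖(x' : ℂ) ^ (s + 1) - (x : ℂ) ^ (s + 1)‖ with hN
  have b1 : N ≤ ‖s + 1‖ * E * (x' - x) :=
    (norm_cpow_add_one_sub_le hx0 (by linarith) (by linarith)).trans (by gcongr)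
  have b2 : N ≤ 4 * u * E * (x' - x) := by
    have h1 : N ≤ x' ^ (s.re + 1) + x ^ (s.re + 1) := by
      refine (norm_sub_le _ _).trans (le_of_eq ?_)
      rw [Complex.norm_cpow_eq_rpow_re_of_pos hx0, Complex.norm_cpow_eq_rpow_re_of_pos hx0']
      simp
    have h2 : x ^ (s.re + 1) ≤ x' ^ (s.re + 1) := by
      gcongr
      linarith
    have h3 : x' ^ (s.re + 1) ≤ E * x' := by
      rw [Real.rpow_add_one hx0'.ne']; gcongr
    have h4 : E * x' ≤ 2 * u * E * (x' - x) := by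
      calc E * x' = 2 * u * E * (h / 2 * x') := by rw [hh]; field_simp
        _ ≤ _ := by gcongr
    linarith
  rw [norm_div, norm_mul]
  set q := N / (‖s‖ * ‖s + 1‖) / (E * (x' - x)) with hq
  have hs0 : 0 < ‖s‖ := by linarith
  have hs0' : 0 < ‖s + 1‖ := by linarith
  have hN0 : 0 ≤ N := norm_nonneg _
  have hq0 : 0 ≤ q := by positivity
  have q1 : q ≤ 1 / ‖s‖ := by
    rw [hq, div_div, div_le_div_iff₀ (by positivity) hs0]
    nlinarith
  have q2 : q ≤ 4 * u / ‖s‖ ^ 2 := by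
    rw [hq, div_div, div_le_div_iff₀ (by positivity) (by positivity)]
    calc N * ‖s‖ ^ 2 ≤ (4 * u * E * (x' - x)) * (‖s‖ * ‖s + 1‖) := by
          gcongr
          nlinarith
      _ = _ := by ring
  have q3 : q ≤ 8 * √u * (1 + |s.im|) ^ (-(3 / 2) : ℝ) := by
    have hT : 0 < 1 + |s.im| := by positivity
    refine (pow_le_pow_iff_left₀ hq0 (by positivity) two_ne_zero).1 ?_
    have e1 : ((1 + |s.im|) ^ (-(3 / 2) : ℝ)) ^ 2 = 1 / (1 + |s.im|) ^ 3 := by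
      rw [← Real.rpow_natCast, ← Real.rpow_mul hT.le, one_div, ← Real.rpow_natCast _ 3,
        ← Real.rpow_neg hT.le]
      norm_num
    calc q ^ 2 = q * q := sq q
      _ ≤ 1 / ‖s‖ * (4 * u / ‖s‖ ^ 2) := by gcongr
      _ = 4 * u * (1 / ‖s‖ ^ 3) := by field_simp
      _ ≤ 4 * u * (1 / ((1 + |s.im|) / 2) ^ 3) := by gcongr
      _ = 32 * u * (1 / (1 + |s.im|) ^ 3) := by
          field_simp
          norm_num
      _ ≤ 64 * u * (1 / (1 + |s.im|) ^ 3) := by gcongr; norm_num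
      _ = _ := by rw [mul_pow, mul_pow, e1, Real.sq_sqrt hu0.le]; norm_num
  have q4 : q ≤ min 1 (8 * √u * (1 + |s.im|) ^ (-(3 / 2) : ℝ)) :=
    le_min (q1.trans (by rw [div_le_one hs0]; exact hs1)) q3
  calc N / (‖s‖ * ‖s + 1‖) = (x' - x) * E * q := by rw [hq]; field_simp
    _ ≤ _ := by gcongr

open MeasureTheory in
/-- The integral of the difference quotient kernel against a function with an integrable
singularity of order `3/2` at `1` and growth of order `1/4`. -/
theorem exists_norm_integral_perron_le (D : ℝ) (hD : 0 ≤ D) : ∃ C, 0 ≤ C ∧ ∀ (E : ℂ → ℂ),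
    (∀ s : ℂ, 1 < s.re → s.re ≤ 2 →
      ‖E s‖ ≤ D * (1 / √‖s - 1‖ ^ 3 + (1 + |s.im|) ^ (1 / 4 : ℝ))) →
    ∀ u v : ℝ, 1 ≤ u → v ≤ u →
    ‖∫ t : ℝ, E ((1 + 1 / u : ℝ) + t * Complex.I) *
      (((Real.exp (v + 1 / u) : ℂ) ^ ((1 + 1 / u : ℝ) + t * Complex.I + 1) -
        (Real.exp v : ℂ) ^ ((1 + 1 / u : ℝ) + t * Complex.I + 1)) /
      (((1 + 1 / u : ℝ) + t * Complex.I) * ((1 + 1 / u : ℝ) + t * Complex.I + 1)))‖ ≤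
    C * (Real.exp (v + 1 / u) - Real.exp v) * (Real.exp u * √u) := by
  have hint : ∀ {r : ℝ}, 1 < r → Integrable (fun t : ℝ => (1 + |t|) ^ (-r)) := fun hr => by
    simpa using integrable_one_add_norm (E := ℝ) (μ := volume) (r := _) (by simpa using hr)
  set I₁ := ∫ t : ℝ, (1 + |t|) ^ (-(3 / 2) : ℝ) with hI₁
  set I₂ := ∫ t : ℝ, (1 + |t|) ^ (-(5 / 4) : ℝ) with hI₂
  have hI₁0 : 0 ≤ I₁ := integral_nonneg fun t => by positivity
  have hI₂0 : 0 ≤ I₂ := integral_nonneg fun t => by positivity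
  refine ⟨D * Real.exp 3 * (3 * I₁ + 8 * I₂), by positivity, fun E hE u v hu hvu => ?_⟩
  have hu0 : 0 < u := by linarith
  have hd0 : 0 ≤ Real.exp (v + 1 / u) - Real.exp v := by
    rw [sub_nonneg, Real.exp_le_exp]
    have : 0 < 1 / u := by positivity
    linarith
  set d := Real.exp (v + 1 / u) - Real.exp v with hd
  have hb : Integrable (fun t : ℝ => D * d * Real.exp (u + 3) *
      (3 * (u * √u * (1 + |u * t|) ^ (-(3 / 2) : ℝ)) +
        8 * √u * (1 + |t|) ^ (-(5 / 4) : ℝ))) := by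
    refine Integrable.const_mul (Integrable.add (Integrable.const_mul (Integrable.const_mul ?_ _) _)
      (Integrable.const_mul (hint (by norm_num)) _)) _
    exact (hint (r := 3 / 2) (by norm_num)).comp_mul_left' hu0.ne'
  refine (norm_integral_le_of_norm_le hb (Eventually.of_forall fun t => ?_)).trans (le_of_eq ?_)
  · set s : ℂ := (1 + 1 / u : ℝ) + t * Complex.I with hs
    have hre : s.re = 1 + 1 / u := by simp [hs]
    have him : s.im = t := by simp [hs]
    have hh : 0 < 1 / u := by positivity
    have hh1 : 1 / u ≤ 1 := by rw [div_le_one hu0]; exact hu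
    have h1 := hE s (by linarith) (by linarith)
    have h2 := norm_perron_quotient_le hu hvu hre
    rw [him] at h1 h2
    -- on the line `re s = 1 + 1 / u` the singularity is a rescaled integrable function of `t`, with
    -- integral of order `√u`
    have h3 : 1 / √‖s - 1‖ ^ 3 ≤ 3 * (u * √u * (1 + |u * t|) ^ (-(3 / 2) : ℝ)) := by
      have h4 : (1 + |u * t|) / (2 * u) ≤ ‖s - 1‖ := by
        have := half_add_le_norm (a := 1 / u) (s - 1) (by simp [hre])
        simp only [Complex.sub_im, him, Complex.one_im, sub_zero] at this
        refine le_trans (le_of_eq ?_) this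
        rw [abs_mul, abs_of_pos hu0]
        field_simp
      have hT : 0 < 1 + |u * t| := by positivity
      have h5 : 1 / √‖s - 1‖ ^ 3 ≤ 1 / √((1 + |u * t|) / (2 * u)) ^ 3 := by gcongr
      refine h5.trans (le_of_sq_le_sq ?_ (by positivity))
      have e1 : ((1 + |u * t|) ^ (-(3 / 2) : ℝ)) ^ 2 = 1 / (1 + |u * t|) ^ 3 := by
        rw [← Real.rpow_natCast, ← Real.rpow_mul hT.le, one_div, ← Real.rpow_natCast _ 3,
          ← Real.rpow_neg hT.le]
        norm_num
      have e2 : (1 / √((1 + |u * t|) / (2 * u)) ^ 3) ^ 2 = 8 * (u ^ 3 / (1 + |u * t|) ^ 3) := by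
        rw [div_pow, ← pow_mul, mul_comm 3 2, pow_mul, Real.sq_sqrt (by positivity)]
        field_simp
        norm_num
      rw [e2, mul_pow, mul_pow, mul_pow, e1, Real.sq_sqrt hu0.le]
      have : 0 ≤ u ^ 3 / (1 + |u * t|) ^ 3 := by positivity
      calc _ ≤ 9 * (u ^ 3 / (1 + |u * t|) ^ 3) := by linarith
        _ = _ := by ring
    have h6 : (1 + |t|) ^ (1 / 4 : ℝ) * (8 * √u * (1 + |t|) ^ (-(3 / 2) : ℝ)) =
        8 * √u * (1 + |t|) ^ (-(5 / 4) : ℝ) := by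
      have hT : 0 < 1 + |t| := by positivity
      rw [show (-(5 / 4) : ℝ) = 1 / 4 + -(3 / 2) by norm_num, Real.rpow_add hT]
      ring
    rw [norm_mul]
    calc _ ≤ (D * (1 / √‖s - 1‖ ^ 3 + (1 + |t|) ^ (1 / 4 : ℝ))) * (d * Real.exp (u + 3) *
          min 1 (8 * √u * (1 + |t|) ^ (-(3 / 2) : ℝ))) := by gcongr
      _ = D * d * Real.exp (u + 3) * (1 / √‖s - 1‖ ^ 3 * min 1 (8 * √u * (1 + |t|) ^ (-(3 / 2) : ℝ))
          + (1 + |t|) ^ (1 / 4 : ℝ) * min 1 (8 * √u * (1 + |t|) ^ (-(3 / 2) : ℝ))) := by ring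
      _ ≤ D * d * Real.exp (u + 3) * (1 / √‖s - 1‖ ^ 3 * 1
          + (1 + |t|) ^ (1 / 4 : ℝ) * (8 * √u * (1 + |t|) ^ (-(3 / 2) : ℝ))) := by
          gcongr
          · exact min_le_left _ _
          · exact min_le_right _ _
      _ ≤ _ := by rw [mul_one, h6]; gcongr
  · rw [integral_const_mul, integral_add, integral_const_mul, integral_const_mul,
      integral_const_mul, Measure.integral_comp_mul_left (fun t => (1 + |t|) ^ (-(3 / 2) : ℝ)) u,
      ← hI₁, ← hI₂, smul_eq_mul, abs_of_pos (inv_pos.2 hu0), Real.exp_add]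
    · field_simp
    · exact ((((hint (r := 3 / 2) (by norm_num)).comp_mul_left' hu0.ne').const_mul _).const_mul _)
    · exact (hint (by norm_num)).const_mul _

open MeasureTheory in
theorem integrable_indicator_of_rpow {α : Type*} [MeasurableSpace α] {μ : Measure α}
    {w y : α → ℝ} (hw : Measurable w) (hy : Measurable y) (hy0 : ∀ a, w a ≠ 0 → 0 < y a)
    {σ : ℝ} (hσ : 0 ≤ σ) (hint : Integrable (fun a => w a * y a ^ (-σ)) μ) {X : ℝ} (hX : 0 < X) :
    Integrable (Set.indicator {a | y a ≤ X} w) μ := by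
  have hS : MeasurableSet {a | y a ≤ X} := measurableSet_le hy measurable_const
  refine (hint.norm.const_mul (X ^ σ)).mono' (hw.indicator hS).aestronglyMeasurable
    (Eventually.of_forall fun a => ?_)
  by_cases ha : w a = 0
  · simp [ha, Set.indicator_apply]
  have hya := hy0 a ha
  by_cases hyX : y a ≤ X
  · rw [Set.indicator_of_mem (by exact hyX), norm_mul, Real.norm_of_nonneg (r := y a ^ (-σ))
      (by positivity), Real.rpow_neg hya.le]
    have : y a ^ σ ≤ X ^ σ := by gcongr
    have h2 : 0 < y a ^ σ := by positivity
    rw [← mul_assoc, mul_comm (X ^ σ), mul_assoc]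
    refine le_mul_of_one_le_right (norm_nonneg _) ?_
    rw [← div_eq_mul_inv, one_le_div h2]
    exact this
  · rw [Set.indicator_of_notMem (by exact hyX), norm_zero]
    positivity

open MeasureTheory in
/-- The increment of `∫ w max (X - y) 0` over `[x, x']` lies between `(x' - x)` times the values of
the counting function at `x` and at `x'`. -/
theorem count_le_increment_le {α : Type*} [MeasurableSpace α] {μ : Measure α}
    {w y : α → ℝ} (hw : Measurable w) (hy : Measurable y) (hw0 : ∀ a, 0 ≤ w a)
    (hy0 : ∀ a, w a ≠ 0 → 0 < y a) {σ : ℝ} (hσ : 0 ≤ σ)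
    (hint : Integrable (fun a => w a * y a ^ (-σ)) μ) {x x' : ℝ} (hx : 0 < x) (hxx : x ≤ x') :
    (x' - x) * (∫ a, Set.indicator {a | y a ≤ x} w a ∂μ) ≤
      (∫ a, w a * max (x' - y a) 0 ∂μ) - ∫ a, w a * max (x - y a) 0 ∂μ ∧
    (∫ a, w a * max (x' - y a) 0 ∂μ) - (∫ a, w a * max (x - y a) 0 ∂μ) ≤
      (x' - x) * (∫ a, Set.indicator {a | y a ≤ x'} w a ∂μ) := by
  have hind : ∀ {X : ℝ}, 0 < X → Integrable (Set.indicator {a | y a ≤ X} w) μ := fun hX =>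
    integrable_indicator_of_rpow hw hy hy0 hσ hint hX
  have hmax : ∀ {X : ℝ}, 0 < X → Integrable (fun a => w a * max (X - y a) 0) μ := by
    intro X hX
    refine ((hind hX).const_mul X).mono' (Measurable.aestronglyMeasurable (by fun_prop))
      (Eventually.of_forall fun a => ?_)
    have h0 : 0 ≤ max (X - y a) 0 := le_max_right _ _
    rw [Real.norm_of_nonneg (mul_nonneg (hw0 a) h0)]
    by_cases ha : w a = 0
    · simp [ha, Set.indicator_apply]
    have hya := hy0 a ha
    by_cases hyX : y a ≤ X
    · rw [Set.indicator_of_mem (by exact hyX), mul_comm]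
      exact mul_le_mul_of_nonneg_right (max_le (by linarith) hX.le) (hw0 a)
    · rw [Set.indicator_of_notMem (by exact hyX), max_eq_right (by linarith)]
      simp
  have hx' := hx.trans_le hxx
  rw [← integral_sub (hmax hx') (hmax hx), ← integral_const_mul, ← integral_const_mul]
  have hsplit : ∀ a, (x' - x) * Set.indicator {a | y a ≤ x} w a ≤
        w a * max (x' - y a) 0 - w a * max (x - y a) 0 ∧
      w a * max (x' - y a) 0 - w a * max (x - y a) 0 ≤
        (x' - x) * Set.indicator {a | y a ≤ x'} w a := by
    intro a
    have h0 := hw0 a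
    simp only [Set.indicator_apply, Set.mem_ofPred_eq]
    rw [← mul_sub]
    rcases le_or_gt (y a) x with h1 | h1
    · have h2 := h1.trans hxx
      rw [if_pos h1, if_pos h2, max_eq_left (by linarith), max_eq_left (by linarith)]
      constructor <;> nlinarith
    · rw [if_neg h1.not_ge, max_eq_right (a := x - y a) (by linarith)]
      rcases le_or_gt (y a) x' with h2 | h2
      · rw [if_pos h2, max_eq_left (by linarith)]
        constructor <;> nlinarith
      · rw [if_neg h2.not_ge, max_eq_right (by linarith)]
        simp
  exact ⟨integral_mono ((hind hx).const_mul _) ((hmax hx').sub (hmax hx)) fun a => (hsplit a).1,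
    integral_mono ((hmax hx').sub (hmax hx)) ((hind hx').const_mul _) fun a => (hsplit a).2⟩

open MeasureTheory in
/-- If two nonnegative weighted systems of frequencies have transforms that differ by little near
the line `re s = 1`, then the counting function of the first is at most that of the second at a
slightly larger argument, up to a small error. Both counting functions are compared with the
difference quotients of their integrals, for which Perron's formula converges absolutely. -/
theorem exists_count_le_count {α β : Type*} [MeasurableSpace α] [MeasurableSpace β]
    {μ : Measure α} {ν : Measure β} [SFinite μ] [SFinite ν] {w y : α → ℝ} {w' y' : β → ℝ}
    (hw : Measurable w) (hy : Measurable y) (hw0 : ∀ a, 0 ≤ w a) (hy0 : ∀ a, w a ≠ 0 → 0 < y a)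
    (hw' : Measurable w') (hy' : Measurable y') (hw0' : ∀ a, 0 ≤ w' a)
    (hy0' : ∀ a, w' a ≠ 0 → 0 < y' a)
    (hint : ∀ σ : ℝ, 1 < σ → Integrable (fun a => w a * y a ^ (-σ)) μ)
    (hint' : ∀ σ : ℝ, 1 < σ → Integrable (fun a => w' a * y' a ^ (-σ)) ν)
    {D : ℝ} (hD : 0 ≤ D)
    (hE : ∀ s : ℂ, 1 < s.re → s.re ≤ 2 →
      ‖(∫ a, (w a : ℂ) * (y a : ℂ) ^ (-s) ∂μ) - (∫ a, (w' a : ℂ) * (y' a : ℂ) ^ (-s) ∂ν)‖ ≤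
        D * (1 / √‖s - 1‖ ^ 3 + (1 + |s.im|) ^ (1 / 4 : ℝ))) :
    ∃ C, 0 ≤ C ∧ ∀ u v : ℝ, 1 ≤ u → v ≤ u →
      (∫ a, Set.indicator {a | y a ≤ Real.exp v} w a ∂μ) ≤
        (∫ a, Set.indicator {a | y' a ≤ Real.exp (v + 1 / u)} w' a ∂ν) +
          C * (Real.exp u * √u) := by
  obtain ⟨C, hC0, hC⟩ := exists_norm_integral_perron_le D hD
  refine ⟨C, hC0, fun u v hu hvu => ?_⟩
  have hu0 : 0 < u := by linarith
  have hh : 0 < 1 / u := by positivity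
  have hσ : 1 < 1 + 1 / u := by linarith
  have key := hC _ hE u v hu hvu
  have hX := Real.exp_pos v
  have hX' := Real.exp_pos (v + 1 / u)
  have hXX : Real.exp v < Real.exp (v + 1 / u) := Real.exp_lt_exp.2 (by linarith)
  obtain ⟨i1, e1⟩ := integral_mul_max_sub_eq hw hy hy0 hσ.le (hint _ hσ) hX
  obtain ⟨i2, e2⟩ := integral_mul_max_sub_eq hw hy hy0 hσ.le (hint _ hσ) hX'
  obtain ⟨i3, e3⟩ := integral_mul_max_sub_eq hw' hy' hy0' hσ.le (hint' _ hσ) hX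
  obtain ⟨i4, e4⟩ := integral_mul_max_sub_eq hw' hy' hy0' hσ.le (hint' _ hσ) hX'
  have h1 := (count_le_increment_le hw hy hw0 hy0 (by linarith) (hint _ hσ) hX hXX.le).1
  have h2 := (count_le_increment_le hw' hy' hw0' hy0' (by linarith) (hint' _ hσ) hX hXX.le).2
  set x := Real.exp v with hx
  set x' := Real.exp (v + 1 / u) with hx'
  set J := ∫ t : ℝ, ((∫ a, (w a : ℂ) * (y a : ℂ) ^ (-((1 + 1 / u : ℝ) + t * Complex.I)) ∂μ) -
      ∫ a, (w' a : ℂ) * (y' a : ℂ) ^ (-((1 + 1 / u : ℝ) + t * Complex.I)) ∂ν) *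
      (((x' : ℂ) ^ ((1 + 1 / u : ℝ) + t * Complex.I + 1) -
        (x : ℂ) ^ ((1 + 1 / u : ℝ) + t * Complex.I + 1)) /
      (((1 + 1 / u : ℝ) + t * Complex.I) * ((1 + 1 / u : ℝ) + t * Complex.I + 1))) with hJ
  have hdiff : ((((∫ a, w a * max (x' - y a) 0 ∂μ) - ∫ a, w a * max (x - y a) 0 ∂μ) -
      ((∫ a, w' a * max (x' - y' a) 0 ∂ν) - ∫ a, w' a * max (x - y' a) 0 ∂ν) : ℝ) : ℂ) =
      1 / (2 * Real.pi) * J := by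
    have e5 := integral_sub (i2.sub i1) (i4.sub i3)
    simp only [Pi.sub_apply] at e5
    rw [Complex.ofReal_sub, Complex.ofReal_sub, Complex.ofReal_sub, e1, e2, e3, e4, ← mul_sub,
      ← mul_sub, ← mul_sub, ← integral_sub i2 i1, ← integral_sub i4 i3, ← e5, hJ]
    congr 2
    funext t
    ring
  have hnorm : ‖(1 / (2 * Real.pi) * J : ℂ)‖ ≤ ‖J‖ := by
    rw [norm_mul, norm_div, norm_one, norm_mul, Complex.norm_ofNat, Complex.norm_real,
      Real.norm_of_nonneg Real.pi_pos.le]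
    refine mul_le_of_le_one_left (norm_nonneg _) ?_
    rw [div_le_one (by positivity)]
    linarith [Real.two_le_pi]
  rw [← hdiff, Complex.norm_real] at hnorm
  have h3 := (Real.le_norm_self _).trans (hnorm.trans key)
  have hd0 : 0 < x' - x := by linarith
  refine le_of_mul_le_mul_left ?_ hd0
  linarith

/-! ### Sums of two squares weighted by the square of the logarithm -/

/-- The constant `c` for which the number of sums of two squares up to `x` is asymptotic to
`c x / √(log x)`. -/
noncomputable def sosDensity : ℝ := leadingCoeff / √Real.pi

theorem sosDensity_pos : 0 < sosDensity :=
  div_pos regularPart_one.1 (Real.sqrt_pos.2 Real.pi_pos)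

theorem term_logMul_logMul_sos (s : ℂ) (n : ℕ) :
    LSeries.term (LSeries.logMul (LSeries.logMul fun n => (sos n : ℂ))) s n =
      ((sos n * Real.log n ^ 2 : ℝ) : ℂ) * ((n : ℝ) : ℂ) ^ (-s) := by
  rcases eq_or_ne n 0 with rfl | hn
  · simp
  · rw [LSeries.term_of_ne_zero hn, LSeries.logMul, LSeries.logMul, Complex.cpow_neg,
      ← Complex.natCast_log]
    push_cast
    ring

theorem abscissaOfAbsConv_sos_lt {s : ℂ} (hs : 1 < s.re) :
    LSeries.abscissaOfAbsConv (fun n => (sos n : ℂ)) < s.re :=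
  (abscissaOfAbsConv_le_one norm_sos_le_one).trans_lt (by exact_mod_cast hs)

theorem deriv_deriv_sosSeries {s : ℂ} (hs : 1 < s.re) :
    deriv (deriv sosSeries) s =
      LSeries (LSeries.logMul (LSeries.logMul fun n => (sos n : ℂ))) s := by
  have := LSeries_iteratedDeriv 2 (abscissaOfAbsConv_sos_lt hs)
  rw [iteratedDeriv_succ, iteratedDeriv_one] at this
  rw [show sosSeries = LSeries fun n => (sos n : ℂ) from rfl]
  simpa using this

theorem summable_term_logMul_logMul_sos {s : ℂ} (hs : 1 < s.re) :
    LSeriesSummable (LSeries.logMul (LSeries.logMul fun n => (sos n : ℂ))) s := by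
  refine LSeriesSummable_logMul_of_lt_re ?_
  rw [LSeries.abscissaOfAbsConv_logMul]
  exact abscissaOfAbsConv_sos_lt hs

/-- The weighted sums of two squares as a superposition of frequencies, with respect to the counting
measure. -/
theorem integrable_count_sos {σ : ℝ} (hσ : 1 < σ) :
    MeasureTheory.Integrable (fun n : ℕ => sos n * Real.log n ^ 2 * (n : ℝ) ^ (-σ))
      MeasureTheory.Measure.count := by
  rw [MeasureTheory.integrable_count_iff]
  have h := (summable_term_logMul_logMul_sos (s := (σ : ℂ)) (by simpa using hσ)).norm
  refine h.congr fun n => ?_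
  rw [term_logMul_logMul_sos, norm_mul, norm_mul, Complex.norm_real, ← Complex.ofReal_neg,
    ← Complex.ofReal_cpow (Nat.cast_nonneg n), Complex.norm_real]

theorem integral_count_sos {s : ℂ} (hs : 1 < s.re) :
    ∫ n : ℕ, ((sos n * Real.log n ^ 2 : ℝ) : ℂ) * ((n : ℝ) : ℂ) ^ (-s)
      ∂MeasureTheory.Measure.count = deriv (deriv sosSeries) s := by
  have h : Summable fun n : ℕ => ((sos n * Real.log n ^ 2 : ℝ) : ℂ) * ((n : ℝ) : ℂ) ^ (-s) := by
    simpa only [LSeriesSummable, funext (term_logMul_logMul_sos s)] using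
      summable_term_logMul_logMul_sos hs
  rw [MeasureTheory.integral_countable (MeasureTheory.integrable_count_iff.2 h.norm),
    deriv_deriv_sosSeries hs, LSeries]
  refine tsum_congr fun n => ?_
  rw [term_logMul_logMul_sos]
  simp

open MeasureTheory in
theorem integral_count_indicator_sos (x : ℝ) (hx : 0 ≤ x) :
    ∫ n : ℕ, Set.indicator {n : ℕ | (n : ℝ) ≤ x} (fun n : ℕ => sos n * Real.log n ^ 2) n
      ∂Measure.count = ∑ n ∈ Finset.Icc 1 ⌊x⌋₊, sos n * Real.log n ^ 2 := by
  have hzero : ∀ n ∉ Finset.Icc 1 ⌊x⌋₊, Set.indicator {n : ℕ | (n : ℝ) ≤ x}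
      (fun n : ℕ => sos n * Real.log n ^ 2) n = 0 := by
    intro n hn
    rw [Set.indicator_apply_eq_zero]
    intro h
    have h1 : n ≤ ⌊x⌋₊ := Nat.le_floor h
    have h2 : n = 0 := by
      by_contra h3
      exact hn (Finset.mem_Icc.2 ⟨Nat.one_le_iff_ne_zero.2 h3, h1⟩)
    simp [h2]
  have hs : Summable fun n : ℕ => ‖Set.indicator {n : ℕ | (n : ℝ) ≤ x}
      (fun n : ℕ => sos n * Real.log n ^ 2) n‖ :=
    summable_of_ne_finset_zero (s := Finset.Icc 1 ⌊x⌋₊) fun n hn => by rw [hzero n hn, norm_zero]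
  rw [integral_countable (integrable_count_iff.2 hs), tsum_eq_sum (s := Finset.Icc 1 ⌊x⌋₊)
    (fun n hn => by rw [hzero n hn, smul_zero])]
  refine Finset.sum_congr rfl fun n hn => ?_
  have : (n : ℝ) ≤ x := (Nat.le_floor_iff hx).1 (Finset.mem_Icc.1 hn).2
  rw [Set.indicator_of_mem (by exact this)]
  simp

/-- The density of the continuous model for the weighted sums of two squares, in the variable
`v = log y`. -/
noncomputable def modelWeight (v : ℝ) : ℝ := sosDensity * max v 0 ^ (3 / 2 : ℝ) * Real.exp v

theorem measurable_modelWeight : Measurable modelWeight := by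
  unfold modelWeight
  fun_prop

theorem modelWeight_nonneg (v : ℝ) : 0 ≤ modelWeight v := by
  have := sosDensity_pos
  have h : 0 ≤ max v 0 := le_max_right _ _
  unfold modelWeight
  positivity

open MeasureTheory in
theorem integrable_modelWeight {σ : ℝ} (hσ : 1 < σ) :
    Integrable (fun v => modelWeight v * Real.exp v ^ (-σ)) (volume.restrict (Set.Ioi 0)) := by
  have h := (integrableOn_rpow_mul_exp_neg_mul_rpow (p := 1) (s := 3 / 2) (b := σ - 1)
    (by norm_num) zero_lt_one (by linarith)).const_mul sosDensity
  refine h.congr ?_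
  filter_upwards [ae_restrict_mem measurableSet_Ioi] with v hv
  have hv0 : (0 : ℝ) < v := hv
  rw [modelWeight, max_eq_left hv0.le, ← Real.exp_mul, Real.rpow_one, mul_assoc, mul_assoc,
    ← Real.exp_add]
  congr 3
  ring

open MeasureTheory in
/-- The transform of the model is the leading singularity of the second derivative of the Dirichlet
series of the sums of two squares. -/
theorem integral_modelWeight {s : ℂ} (hs : 1 < s.re) :
    ∫ v in Set.Ioi (0 : ℝ), (modelWeight v : ℂ) * ((Real.exp v : ℝ) : ℂ) ^ (-s) =
      3 / 4 * leadingCoeff * (s - 1) ^ (-5 / 2 : ℂ) := by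
  have h1 := integral_rpow_mul_cexp_neg_mul (a := 5 / 2) (by norm_num) (p := s - 1) (by simpa)
  have hG : Real.Gamma (5 / 2) = 3 / 4 * √Real.pi := by
    rw [show (5 / 2 : ℝ) = 1 / 2 + 1 + 1 by norm_num, Real.Gamma_add_one (by norm_num),
      Real.Gamma_add_one (by norm_num), Real.Gamma_one_half_eq]
    ring
  have h2 : ∀ v ∈ Set.Ioi (0 : ℝ), (modelWeight v : ℂ) * ((Real.exp v : ℝ) : ℂ) ^ (-s) =
      sosDensity * (((v ^ (5 / 2 - 1 : ℝ) : ℝ) : ℂ) * Complex.exp (-((s - 1) * v))) := by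
    intro v hv
    have hv0 : (0 : ℝ) < v := hv
    have e1 : ((Real.exp v : ℝ) : ℂ) ^ (-s) = Complex.exp (v * -s) := by
      rw [Complex.cpow_def_of_ne_zero (by exact_mod_cast (Real.exp_pos v).ne'),
        ← Complex.ofReal_log (Real.exp_pos v).le, Real.log_exp]
    rw [modelWeight, max_eq_left hv0.le, e1, Complex.ofReal_mul, Complex.ofReal_mul,
      Complex.ofReal_exp, mul_assoc, mul_assoc, ← Complex.exp_add]
    congr 2
    · norm_num
    · congr 1
      ring
  rw [setIntegral_congr_fun measurableSet_Ioi h2, integral_const_mul, h1, hG, sosDensity]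
  have : (√Real.pi : ℂ) ≠ 0 := by
    exact_mod_cast (Real.sqrt_pos.2 Real.pi_pos).ne'
  push_cast
  field_simp

/-- The counting function of the model: integration by parts against `v ^ (3 / 2) * exp v`. -/
theorem setIntegral_indicator_modelWeight {u : ℝ} (hu : 0 ≤ u) :
    (∫ v in Set.Ioi (0 : ℝ), Set.indicator {v | Real.exp v ≤ Real.exp u} modelWeight v) ≤
      sosDensity * (u * √u) * Real.exp u ∧
    sosDensity * (u * √u - 3 / 2 * √u) * Real.exp u ≤
      ∫ v in Set.Ioi (0 : ℝ), Set.indicator {v | Real.exp v ≤ Real.exp u} modelWeight v := by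
  have e : (∫ v in Set.Ioi (0 : ℝ), Set.indicator {v | Real.exp v ≤ Real.exp u} modelWeight v) =
      sosDensity * ∫ v in (0 : ℝ)..u, v ^ (3 / 2 : ℝ) * Real.exp v := by
    have hS : MeasurableSet {v : ℝ | Real.exp v ≤ Real.exp u} :=
      measurableSet_le Real.measurable_exp measurable_const
    rw [MeasureTheory.integral_indicator hS, MeasureTheory.Measure.restrict_restrict hS,
      show {v : ℝ | Real.exp v ≤ Real.exp u} ∩ Set.Ioi 0 = Set.Ioc 0 u by
        ext v
        simp [Real.exp_le_exp, and_comm], ← intervalIntegral.integral_const_mul,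
      intervalIntegral.integral_of_le hu]
    refine MeasureTheory.setIntegral_congr_fun measurableSet_Ioc fun v hv => ?_
    simp only [modelWeight]
    rw [max_eq_left hv.1.le, mul_assoc]
  have hc := sosDensity_pos
  have hd : ∀ v ∈ Set.uIcc 0 u, HasDerivAt (fun v : ℝ => v ^ (3 / 2 : ℝ) * Real.exp v)
      (v ^ (3 / 2 : ℝ) * Real.exp v + 3 / 2 * (v ^ (1 / 2 : ℝ) * Real.exp v)) v := by
    intro v _
    refine ((Real.hasDerivAt_rpow_const (p := 3 / 2) (Or.inr (by norm_num))).mul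
      (Real.hasDerivAt_exp v)).congr_deriv ?_
    norm_num
    ring
  have i1 : IntervalIntegrable (fun v : ℝ => v ^ (3 / 2 : ℝ) * Real.exp v)
      MeasureTheory.volume 0 u :=
    ((Real.continuous_rpow_const (by norm_num)).mul Real.continuous_exp).intervalIntegrable _ _
  have i2 : IntervalIntegrable (fun v : ℝ => v ^ (1 / 2 : ℝ) * Real.exp v)
      MeasureTheory.volume 0 u :=
    ((Real.continuous_rpow_const (by norm_num)).mul Real.continuous_exp).intervalIntegrable _ _
  have hF := intervalIntegral.integral_eq_sub_of_hasDerivAt hd (i1.add (i2.const_mul _))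
  rw [intervalIntegral.integral_add i1 (i2.const_mul _), intervalIntegral.integral_const_mul,
    Real.zero_rpow (by norm_num), zero_mul, sub_zero] at hF
  have hu32 : u ^ (3 / 2 : ℝ) = u * √u := by
    rw [show (3 / 2 : ℝ) = 1 + 1 / 2 by norm_num, Real.rpow_add_of_nonneg hu (by norm_num)
      (by norm_num), Real.rpow_one, Real.sqrt_eq_rpow]
  have b0 : 0 ≤ ∫ v in (0 : ℝ)..u, v ^ (1 / 2 : ℝ) * Real.exp v :=
    intervalIntegral.integral_nonneg hu fun v hv => by have := hv.1; positivity
  have b1 : ∫ v in (0 : ℝ)..u, v ^ (1 / 2 : ℝ) * Real.exp v ≤ √u * Real.exp u := by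
    have h1 : ∫ v in (0 : ℝ)..u, v ^ (1 / 2 : ℝ) * Real.exp v ≤
        ∫ v in (0 : ℝ)..u, √u * Real.exp v := by
      refine intervalIntegral.integral_mono_on hu i2
        ((continuous_const.mul Real.continuous_exp).intervalIntegrable _ _) fun v hv => ?_
      rw [Real.sqrt_eq_rpow]
      gcongr
      exacts [hv.1, hv.2]
    rw [intervalIntegral.integral_const_mul, integral_exp, Real.exp_zero] at h1
    have := Real.sqrt_nonneg u
    nlinarith
  rw [e]
  rw [hu32] at hF
  constructor
  · rw [mul_assoc]
    gcongr
    linarith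
  · rw [mul_assoc]
    gcongr
    nlinarith

/-- The logarithmically weighted count of sums of two squares, with a relative error `1 / log x`.
-/
theorem exists_sum_sos_mul_log_sq :
    ∃ C, 0 ≤ C ∧ ∀ u : ℝ, 1 ≤ u →
      |∑ n ∈ Finset.Icc 1 ⌊Real.exp u⌋₊, sos n * Real.log n ^ 2 -
        sosDensity * (u * √u) * Real.exp u| ≤ C * (Real.exp u * √u) := by
  obtain ⟨D, hD0, hD⟩ := exists_deriv_deriv_sosSeries_bound
  have hc := sosDensity_pos
  have w1 : Measurable fun n : ℕ => sos n * Real.log n ^ 2 := measurable_from_top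
  have y1 : Measurable fun n : ℕ => (n : ℝ) := measurable_from_top
  have p1 : ∀ n : ℕ, 0 ≤ sos n * Real.log n ^ 2 := fun n =>
    mul_nonneg (sos_nonneg n) (sq_nonneg _)
  have q1 : ∀ n : ℕ, sos n * Real.log n ^ 2 ≠ 0 → (0 : ℝ) < n := by
    intro n hn
    rcases Nat.eq_zero_or_pos n with rfl | h
    · simp at hn
    · exact_mod_cast h
  have q2 : ∀ v : ℝ, modelWeight v ≠ 0 → 0 < Real.exp v := fun v _ => Real.exp_pos v
  have hE1 : ∀ s : ℂ, 1 < s.re → s.re ≤ 2 →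
      ‖(∫ n : ℕ, ((sos n * Real.log n ^ 2 : ℝ) : ℂ) * ((n : ℝ) : ℂ) ^ (-s)
        ∂MeasureTheory.Measure.count) -
        ∫ v in Set.Ioi (0 : ℝ), (modelWeight v : ℂ) * ((Real.exp v : ℝ) : ℂ) ^ (-s)‖ ≤
        D * (1 / √‖s - 1‖ ^ 3 + (1 + |s.im|) ^ (1 / 4 : ℝ)) := by
    intro s h1 h2
    rw [integral_count_sos h1, integral_modelWeight h1]
    exact hD s h1 h2
  have hE2 : ∀ s : ℂ, 1 < s.re → s.re ≤ 2 →
      ‖(∫ v in Set.Ioi (0 : ℝ), (modelWeight v : ℂ) * ((Real.exp v : ℝ) : ℂ) ^ (-s)) -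
        (∫ n : ℕ, ((sos n * Real.log n ^ 2 : ℝ) : ℂ) * ((n : ℝ) : ℂ) ^ (-s)
        ∂MeasureTheory.Measure.count)‖ ≤
        D * (1 / √‖s - 1‖ ^ 3 + (1 + |s.im|) ^ (1 / 4 : ℝ)) := by
    intro s h1 h2
    rw [norm_sub_rev]
    exact hE1 s h1 h2
  obtain ⟨C₁, hC₁, h₁⟩ := exists_count_le_count w1 y1 p1 q1 measurable_modelWeight
    Real.measurable_exp modelWeight_nonneg q2 (fun σ hσ => integrable_count_sos hσ)
    (fun σ hσ => integrable_modelWeight hσ) hD0.le hE1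
  obtain ⟨C₂, hC₂, h₂⟩ := exists_count_le_count measurable_modelWeight
    Real.measurable_exp modelWeight_nonneg q2 w1 y1 p1 q1
    (fun σ hσ => integrable_modelWeight hσ) (fun σ hσ => integrable_count_sos hσ) hD0.le hE2
  refine ⟨C₁ + C₂ + 100 * sosDensity, by positivity, fun u hu => ?_⟩
  have hu0 : 0 < u := by linarith
  have hh0 : 0 < 1 / u := by positivity
  have hh1 : 1 / u ≤ 1 := by rw [div_le_one hu0]; exact hu
  -- the sum is caught between the counting functions of the model at `x exp (± 1 / u)`
  have a1 := h₁ u u hu le_rfl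
  have a2 := h₂ u (u - 1 / u) hu (by linarith)
  rw [integral_count_indicator_sos _ (Real.exp_pos _).le] at a1 a2
  have m1 := (setIntegral_indicator_modelWeight (u := u + 1 / u) (by positivity)).1
  have m2 := (setIntegral_indicator_modelWeight (u := u - 1 / u) (by linarith)).2
  rw [sub_add_cancel] at a2
  set A := ∑ n ∈ Finset.Icc 1 ⌊Real.exp u⌋₊, sos n * Real.log n ^ 2
  set h := 1 / u with hh
  have huh : u * h = 1 := by rw [hh]; field_simp
  set r := √u with hr
  have hr2 : r ^ 2 = u := Real.sq_sqrt hu0.le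
  have hr0 : 0 < r := Real.sqrt_pos.2 hu0
  have hX := Real.exp_pos u
  -- the main term at the ends of the interval, relative to its value in the middle
  have up : (u + h) * √(u + h) * Real.exp (u + h) ≤ (u * r + 100 * r) * Real.exp u := by
    have e1 : u + h ≤ u * Real.exp h := by
      have := Real.add_one_le_exp h
      nlinarith
    have e2 : √(u + h) ≤ r * Real.exp h := by
      rw [Real.sqrt_le_left (by positivity), mul_pow, hr2]
      refine e1.trans ?_
      gcongr
      exact le_self_pow₀ (Real.one_le_exp hh0.le) two_ne_zero
    have e3 : Real.exp (3 * h) ≤ 1 + 100 * h := by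
      have h1 : 1 - 3 * h ≤ Real.exp (-(3 * h)) := Real.one_sub_le_exp_neg _
      have h2 : Real.exp (3 * h) ≤ 33 := by
        calc Real.exp (3 * h) ≤ Real.exp 3 := Real.exp_le_exp.2 (by linarith)
          _ = Real.exp 1 ^ 3 := by rw [← Real.exp_nat_mul]; norm_num
          _ ≤ 3 ^ 3 := by
            gcongr
            linarith [Real.exp_one_lt_d9]
          _ ≤ 33 := by norm_num
      have h3 : Real.exp (3 * h) * Real.exp (-(3 * h)) = 1 := by
        rw [← Real.exp_add, add_neg_cancel, Real.exp_zero]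
      have h4 := mul_le_mul_of_nonneg_left h1 (Real.exp_pos (3 * h)).le
      nlinarith
    calc _ ≤ (u * Real.exp h) * (r * Real.exp h) * Real.exp (u + h) := by gcongr
      _ = u * r * Real.exp u * Real.exp (3 * h) := by
        rw [show u * Real.exp h * (r * Real.exp h) * Real.exp (u + h) = u * r * (Real.exp h *
          Real.exp h * Real.exp (u + h)) by ring, mul_assoc (u * r), ← Real.exp_add,
          ← Real.exp_add, ← Real.exp_add]
        congr 2
        ring
      _ ≤ u * r * Real.exp u * (1 + 100 * h) := by gcongr
      _ = _ := by linear_combination 100 * r * Real.exp u * huh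
  have low : (u * r - 100 * r) * Real.exp u ≤
      ((u - h) * √(u - h) - 3 / 2 * √(u - h)) * Real.exp (u - h) := by
    have hw : 0 ≤ u - h := by linarith
    have hq2 : √(u - h) ^ 2 = u - h := Real.sq_sqrt hw
    have hq0 := Real.sqrt_nonneg (u - h)
    have hqr : √(u - h) ≤ r := Real.sqrt_le_sqrt (by linarith)
    set q := √(u - h)
    have hexp : Real.exp (u - h) = Real.exp u * Real.exp (-h) := by
      rw [← Real.exp_add, sub_eq_add_neg]
    have hE1 : 1 - h ≤ Real.exp (-h) := Real.one_sub_le_exp_neg h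
    have hE2 : Real.exp (-h) ≤ 1 := Real.exp_le_one_iff.2 (by linarith)
    have l1 : (u - h) ^ 2 ≤ (u - h) * q * r := by
      have : u - h ≤ q * r := by rw [← hq2, sq]; gcongr
      rw [sq, mul_assoc]
      gcongr
    have l2 : u * r - 3 * r ≤ (u - h) * q * Real.exp (-h) := by
      refine le_of_mul_le_mul_right ?_ hr0
      have l3 : (u - h) ^ 2 * (1 - h) ≤ (u - h) * q * r * Real.exp (-h) :=
        mul_le_mul l1 hE1 (by linarith) (by positivity)
      have l4 : u ^ 2 - 3 * u ≤ (u - h) ^ 2 * (1 - h) := by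
        have l5 : u ^ 2 - 2 ≤ (u - h) ^ 2 := by nlinarith
        have l6 := mul_le_mul_of_nonneg_right l5 (by linarith : 0 ≤ 1 - h)
        have l7 : (u ^ 2 - 2) * (1 - h) = u ^ 2 - 2 - u + 2 * h := by
          linear_combination -u * huh
        linarith
      have l8 : (u * r - 3 * r) * r = u ^ 2 - 3 * u := by
        linear_combination (u - 3) * hr2
      linarith
    have l9 : q * Real.exp (-h) ≤ r :=
      (mul_le_of_le_one_right hq0 hE2).trans hqr
    rw [hexp, show ((u - h) * q - 3 / 2 * q) * (Real.exp u * Real.exp (-h)) =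
      ((u - h) * q * Real.exp (-h) - 3 / 2 * (q * Real.exp (-h))) * Real.exp u by ring]
    refine mul_le_mul_of_nonneg_right ?_ hX.le
    linarith
  have up' := mul_le_mul_of_nonneg_left up hc.le
  have low' := mul_le_mul_of_nonneg_left low hc.le
  have t1 : 0 ≤ C₁ * (Real.exp u * r) := by positivity
  have t2 : 0 ≤ C₂ * (Real.exp u * r) := by positivity
  rw [abs_le]
  constructor
  · nlinarith
  · nlinarith

/-! ### The counting function of the sums of two squares -/

theorem sosCount_nonneg (x : ℝ) : 0 ≤ sosCount x := Finset.sum_nonneg fun n _ => sos_nonneg n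

theorem sosCount_le_self {x : ℝ} (hx : 0 ≤ x) : sosCount x ≤ x := by
  calc sosCount x ≤ ∑ n ∈ Finset.Icc 1 ⌊x⌋₊, (1 : ℝ) := Finset.sum_le_sum fun n _ => sos_le_one n
    _ = (⌊x⌋₊ : ℝ) := by simp
    _ ≤ x := Nat.floor_le hx

theorem sosCount_eq_sum_ite {x y : ℝ} (hy : 0 ≤ y) (hxy : y ≤ x) :
    sosCount y = ∑ n ∈ Finset.Icc 1 ⌊x⌋₊, if (n : ℝ) ≤ y then sos n else 0 := by
  rw [← Finset.sum_filter, sosCount]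
  refine Finset.sum_congr ?_ fun _ _ => rfl
  ext n
  simp only [Finset.mem_Icc, Finset.mem_filter, ← Nat.le_floor_iff hy]
  have := Nat.floor_le_floor hxy
  constructor
  · rintro ⟨h1, h2⟩
    exact ⟨⟨h1, h2.trans this⟩, h2⟩
  · rintro ⟨⟨h1, _⟩, h2⟩
    exact ⟨h1, h2⟩

/-- An upper bound of the right order, by discarding the `n ≤ √x` and using `log n ≥ log x / 2` for
the others. -/
theorem exists_sosCount_le : ∃ C, 0 ≤ C ∧ ∀ u : ℝ, 0 ≤ u →
    sosCount (Real.exp u) ≤ C * (Real.exp u / √(1 + u)) := by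
  obtain ⟨C, hC0, hC⟩ := exists_sum_sos_mul_log_sq
  have hc := sosDensity_pos
  refine ⟨2 + 8 * (C + sosDensity), by positivity, fun u hu => ?_⟩
  have hX := Real.exp_pos u
  have hsq : √(1 + u) ≤ Real.exp (u / 2) := by
    rw [Real.sqrt_le_left (Real.exp_pos _).le, ← Real.exp_nat_mul]
    have := Real.add_one_le_exp u
    rw [show ((2 : ℕ) : ℝ) * (u / 2) = u by push_cast; ring]
    linarith
  have hs0 : 0 < √(1 + u) := Real.sqrt_pos.2 (by linarith)
  rcases lt_or_ge u 1 with h1 | h1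
  · have h2 : √(1 + u) ≤ 2 := by
      rw [Real.sqrt_le_left (by norm_num)]
      linarith
    calc sosCount (Real.exp u) ≤ Real.exp u := sosCount_le_self hX.le
      _ ≤ 2 * (Real.exp u / √(1 + u)) := by
          rw [mul_div_assoc', le_div_iff₀ hs0]
          nlinarith
      _ ≤ _ := by
          gcongr
          linarith
  · have hu0 : 0 < u := by linarith
    have hA := (abs_le.1 (hC u h1)).2
    set A := ∑ n ∈ Finset.Icc 1 ⌊Real.exp u⌋₊, sos n * Real.log n ^ 2 with hAdef
    have hsum : sosCount (Real.exp u) ≤ Real.exp (u / 2) + 4 / u ^ 2 * A := by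
      have h3 : Real.exp (u / 2) ≤ Real.exp u := Real.exp_le_exp.2 (by linarith)
      have h4 := sosCount_le_self (Real.exp_pos (u / 2)).le
      refine le_trans ?_ (add_le_add_left h4 _)
      rw [sosCount_eq_sum_ite (Real.exp_pos (u / 2)).le h3, hAdef, Finset.mul_sum, sosCount,
        ← Finset.sum_add_distrib]
      refine Finset.sum_le_sum fun n hn => ?_
      have hf := sos_nonneg n
      split_ifs with h5
      · have : 0 ≤ 4 / u ^ 2 * (sos n * Real.log n ^ 2) := by positivity
        linarith
      · have h6 : u / 2 ≤ Real.log n := by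
          rw [Real.le_log_iff_exp_le (by exact_mod_cast (Finset.mem_Icc.1 hn).1)]
          exact (not_le.1 h5).le
        have h7 : 1 ≤ 4 / u ^ 2 * Real.log n ^ 2 := by
          rw [div_mul_eq_mul_div, le_div_iff₀ (by positivity)]
          nlinarith
        rw [zero_add, mul_left_comm]
        exact le_mul_of_one_le_right hf h7
    have h8 : Real.exp (u / 2) ≤ Real.exp u / √(1 + u) := by
      rw [le_div_iff₀ hs0]
      calc _ ≤ Real.exp (u / 2) * Real.exp (u / 2) := by gcongr
        _ = Real.exp u := by rw [← Real.exp_add, add_halves]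
    have hr0 : 0 < √u := Real.sqrt_pos.2 hu0
    have hr2 : √u ^ 2 = u := Real.sq_sqrt hu0.le
    have h9 : 4 / u ^ 2 * A ≤ 4 * (C + sosDensity) * (Real.exp u / √u) := by
      have h10 : A ≤ (C + sosDensity) * (u * √u) * Real.exp u := by
        have : C * (Real.exp u * √u) ≤ C * (u * √u) * Real.exp u := by
          calc C * (Real.exp u * √u) = C * (1 * √u) * Real.exp u := by ring
            _ ≤ _ := by gcongr
        linarith
      calc _ ≤ 4 / u ^ 2 * ((C + sosDensity) * (u * √u) * Real.exp u) := by gcongr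
        _ = 4 * (C + sosDensity) * Real.exp u * (√u / u) := by field_simp
        _ = _ := by
          have : √u / u = 1 / √u := by
            rw [div_eq_div_iff hu0.ne' hr0.ne']
            linarith
          rw [this]; ring
    have h11 : Real.exp u / √u ≤ 2 * (Real.exp u / √(1 + u)) := by
      rw [mul_div_assoc', div_le_div_iff₀ hr0 hs0]
      have : √(1 + u) ≤ 2 * √u := by
        rw [Real.sqrt_le_left (by positivity), mul_pow, hr2]
        linarith
      nlinarith
    have h12 : 0 < Real.exp u / √(1 + u) := by positivity
    have h13 := mul_le_mul_of_nonneg_left h11 (by positivity : 0 ≤ 4 * (C + sosDensity))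
    linarith

/-- The sum of `log (x / n)` over the sums of two squares `n ≤ x`, bounded through the counts up to
`x e⁻ᵏ`. -/
theorem exists_sum_sos_mul_log_div_le : ∃ C, 0 ≤ C ∧ ∀ u : ℝ, 0 ≤ u →
    ∑ n ∈ Finset.Icc 1 ⌊Real.exp u⌋₊, sos n * (u - Real.log n) ≤
      C * (Real.exp u / √(1 + u)) := by
  obtain ⟨C, hC0, hC⟩ := exists_sosCount_le
  have hsum : Summable fun k : ℕ => (1 + (k : ℝ)) * Real.exp (-k) := by
    have h1 := Real.summable_pow_mul_exp_neg_nat_mul 0 (r := 1) one_pos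
    have h2 := Real.summable_pow_mul_exp_neg_nat_mul 1 (r := 1) one_pos
    refine (h1.add h2).congr fun k => ?_
    simp
    ring
  refine ⟨C * ∑' k : ℕ, (1 + (k : ℝ)) * Real.exp (-k),
    mul_nonneg hC0 (tsum_nonneg fun k => by positivity), fun u hu => ?_⟩
  have h1u : 0 < 1 + u := by linarith
  have step1 : ∑ n ∈ Finset.Icc 1 ⌊Real.exp u⌋₊, sos n * (u - Real.log n) ≤
      ∑ k ∈ Finset.range (⌊u⌋₊ + 1), sosCount (Real.exp (u - k)) := by
    have e : ∀ k ∈ Finset.range (⌊u⌋₊ + 1), sosCount (Real.exp (u - k)) =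
        ∑ n ∈ Finset.Icc 1 ⌊Real.exp u⌋₊, if (n : ℝ) ≤ Real.exp (u - k) then sos n else 0 :=
      fun k _ => sosCount_eq_sum_ite (Real.exp_pos _).le
        (Real.exp_le_exp.2 (by linarith [Nat.cast_nonneg (α := ℝ) k]))
    rw [Finset.sum_congr rfl e, Finset.sum_comm]
    refine Finset.sum_le_sum fun n hn => ?_
    have hn1 := (Finset.mem_Icc.1 hn).1
    have hn0 : (0 : ℝ) < n := by exact_mod_cast hn1
    have hlog0 : 0 ≤ Real.log n := Real.log_natCast_nonneg n
    rw [← Finset.sum_filter, Finset.sum_const, nsmul_eq_mul, mul_comm]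
    refine mul_le_mul_of_nonneg_right ?_ (sos_nonneg n)
    rcases lt_or_ge (u - Real.log n) 0 with hneg | hpos
    · exact hneg.le.trans (Nat.cast_nonneg _)
    have hsub : Finset.range (⌊u - Real.log n⌋₊ + 1) ⊆ (Finset.range (⌊u⌋₊ + 1)).filter
        (fun k => (n : ℝ) ≤ Real.exp (u - (k : ℝ))) := by
      intro k hk
      have hk1 : k ≤ ⌊u - Real.log n⌋₊ := Nat.lt_succ_iff.1 (Finset.mem_range.1 hk)
      have hk2 : (k : ℝ) ≤ u - Real.log n := (Nat.le_floor_iff hpos).1 hk1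
      rw [Finset.mem_filter, Finset.mem_range, Nat.lt_succ_iff]
      refine ⟨Nat.le_floor (by linarith), ?_⟩
      rw [← Real.log_le_iff_le_exp hn0]
      linarith
    have hcard := Finset.card_le_card hsub
    rw [Finset.card_range] at hcard
    refine (Nat.lt_floor_add_one _).le.trans ?_
    exact_mod_cast hcard
  have step2 : ∀ k ∈ Finset.range (⌊u⌋₊ + 1), sosCount (Real.exp (u - k)) ≤
      C * (Real.exp u / √(1 + u)) * ((1 + (k : ℝ)) * Real.exp (-k)) := by
    intro k hk
    have hk1 : (k : ℝ) ≤ u := (Nat.le_floor_iff hu).1 (Nat.lt_succ_iff.1 (Finset.mem_range.1 hk))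
    have hk0 : (0 : ℝ) ≤ k := Nat.cast_nonneg k
    have h1 := hC (u - k) (by linarith)
    have h2 : √(1 + u) ≤ √(1 + (u - k)) * (1 + k) := by
      rw [Real.sqrt_le_left (by positivity), mul_pow, Real.sq_sqrt (by linarith)]
      have h : 1 + u ≤ (1 + (u - k)) * (1 + k) := by
        nlinarith [mul_nonneg hk0 (sub_nonneg.2 hk1)]
      have h' : (1 + (u - k)) * (1 + k) * 1 ≤ (1 + (u - k)) * (1 + k) * (1 + k) :=
        mul_le_mul_of_nonneg_left (by linarith) (by linarith)
      linarith
    have h3 : 1 / √(1 + (u - k)) ≤ (1 + k) / √(1 + u) := by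
      have : 0 < √(1 + (u - k)) := Real.sqrt_pos.2 (by linarith)
      rw [div_le_div_iff₀ this (Real.sqrt_pos.2 h1u)]
      linarith
    calc _ ≤ _ := h1
      _ = C * Real.exp (u - k) * (1 / √(1 + (u - k))) := by ring
      _ ≤ C * Real.exp (u - k) * ((1 + k) / √(1 + u)) := by gcongr
      _ = _ := by rw [sub_eq_add_neg, Real.exp_add]; ring
  refine step1.trans ((Finset.sum_le_sum step2).trans ?_)
  rw [← Finset.mul_sum]
  calc _ ≤ C * (Real.exp u / √(1 + u)) * ∑' k : ℕ, (1 + (k : ℝ)) * Real.exp (-k) := by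
        gcongr
        exact hsum.sum_le_tsum _ fun k _ => by positivity
    _ = _ := by ring

/-- Landau's theorem with the first error term. -/
theorem exists_abs_sosCount_sub_le : ∃ C, 0 ≤ C ∧ ∀ u : ℝ, 1 ≤ u →
    |sosCount (Real.exp u) - sosDensity * (Real.exp u / √u)| ≤ C * (Real.exp u / (u * √u)) := by
  obtain ⟨C₁, h₁, hC₁⟩ := exists_sum_sos_mul_log_sq
  obtain ⟨C₂, h₂, hC₂⟩ := exists_sum_sos_mul_log_div_le
  refine ⟨C₁ + 2 * C₂, by positivity, fun u hu => ?_⟩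
  have hu0 : 0 < u := by linarith
  have hX := Real.exp_pos u
  have hr0 : 0 < √u := Real.sqrt_pos.2 hu0
  have hr2 : √u * √u = u := Real.mul_self_sqrt hu0.le
  have hA := hC₁ u hu
  have hT := hC₂ u hu0.le
  set A := ∑ n ∈ Finset.Icc 1 ⌊Real.exp u⌋₊, sos n * Real.log n ^ 2 with hAdef
  set T := ∑ n ∈ Finset.Icc 1 ⌊Real.exp u⌋₊, sos n * (u - Real.log n) with hTdef
  have hlog : ∀ n ∈ Finset.Icc 1 ⌊Real.exp u⌋₊, 0 ≤ Real.log n ∧ Real.log n ≤ u := by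
    intro n hn
    refine ⟨Real.log_natCast_nonneg n, ?_⟩
    rw [Real.log_le_iff_le_exp (by exact_mod_cast (Finset.mem_Icc.1 hn).1)]
    exact (Nat.le_floor_iff hX.le).1 (Finset.mem_Icc.1 hn).2
  -- The squared logarithm is compared with its largest value `u ^ 2`, by `u ^ 2 - 2 u (u - log n) ≤
  -- log n ^ 2 ≤ u ^ 2`.
  have b1 : A ≤ u ^ 2 * sosCount (Real.exp u) := by
    rw [hAdef, sosCount, Finset.mul_sum]
    refine Finset.sum_le_sum fun n hn => ?_
    obtain ⟨h3, h4⟩ := hlog n hn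
    rw [mul_comm]
    exact mul_le_mul_of_nonneg_right (by gcongr) (sos_nonneg n)
  have b2 : u ^ 2 * sosCount (Real.exp u) ≤ A + 2 * u * T := by
    rw [hAdef, hTdef, sosCount, Finset.mul_sum, Finset.mul_sum, ← Finset.sum_add_distrib]
    refine Finset.sum_le_sum fun n hn => ?_
    obtain ⟨h3, h4⟩ := hlog n hn
    have : sos n * Real.log n ^ 2 + 2 * u * (sos n * (u - Real.log n)) - u ^ 2 * sos n =
        sos n * (u - Real.log n) ^ 2 := by ring
    have := mul_nonneg (sos_nonneg n) (sq_nonneg (u - Real.log n))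
    linarith
  have b3 : T ≤ C₂ * (Real.exp u / √u) := hT.trans (by gcongr; linarith)
  have e1 : √u * (Real.exp u / √u) = Real.exp u := by field_simp
  set y := Real.exp u / √u with hy
  have hy0 : 0 < y := by positivity
  have e2 : Real.exp u / (u * √u) = y / u := by rw [hy]; field_simp
  have e3 : Real.exp u * √u = y * u := by
    linear_combination (-√u) * e1 + y * hr2
  have e4 : sosDensity * (u * √u) * Real.exp u = u ^ 2 * (sosDensity * y) := by
    rw [show sosDensity * (u * √u) * Real.exp u = sosDensity * u * (Real.exp u * √u) by ring, e3]
    ring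
  rw [e3, e4] at hA
  rw [e2, abs_le]
  obtain ⟨hA1, hA2⟩ := abs_le.1 hA
  have b4 := mul_le_mul_of_nonneg_left b3 (by positivity : 0 ≤ 2 * u)
  have hu2 : 0 < u ^ 2 := by positivity
  have e5 : (C₁ + 2 * C₂) * (y / u) * u ^ 2 = (C₁ + 2 * C₂) * (y * u) := by field_simp
  have t1 : 0 ≤ C₂ * (y * u) := by positivity
  constructor
  · refine le_of_mul_le_mul_right ?_ hu2
    linarith
  · refine le_of_mul_le_mul_right ?_ hu2
    linarith

/-! ### Summation over the greatest common divisor -/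

theorem one_add_log_sq_le {x : ℝ} (hx : 1 ≤ x) : (1 + Real.log x) ^ 2 ≤ 16 * x ^ (1 / 2 : ℝ) := by
  have hx0 : 0 < x := by linarith
  have h1 : Real.log (x ^ (1 / 4 : ℝ)) ≤ x ^ (1 / 4 : ℝ) - 1 :=
    Real.log_le_sub_one_of_pos (by positivity)
  rw [Real.log_rpow hx0] at h1
  have h2 : 0 ≤ Real.log x := Real.log_nonneg hx
  have h3 : (x ^ (1 / 4 : ℝ)) ^ 2 = x ^ (1 / 2 : ℝ) := by
    rw [← Real.rpow_natCast, ← Real.rpow_mul hx0.le]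
    norm_num
  have h4 : 1 + Real.log x ≤ 4 * x ^ (1 / 4 : ℝ) := by linarith
  calc _ ≤ (4 * x ^ (1 / 4 : ℝ)) ^ 2 := by gcongr
    _ = _ := by rw [mul_pow, h3]; norm_num

theorem summable_one_add_log_sq_div_sq :
    Summable fun g : ℕ => (1 + Real.log g) ^ 2 / (g : ℝ) ^ 2 := by
  have h := (Real.summable_nat_rpow (p := -(3 / 2)).2 (by norm_num)).mul_left 16
  refine Summable.of_nonneg_of_le (fun g => by positivity) (fun g => ?_) h
  rcases Nat.eq_zero_or_pos g with rfl | hg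
  · simp
  · have hg0 : (0 : ℝ) < g := by exact_mod_cast hg
    have h1 := one_add_log_sq_le (x := g) (by exact_mod_cast hg)
    rw [div_le_iff₀ (by positivity)]
    refine h1.trans (le_of_eq ?_)
    rw [mul_assoc, ← Real.rpow_natCast (g : ℝ) 2, ← Real.rpow_add hg0]
    norm_num

set_option maxHeartbeats 1000000 in
/-- The square of the count of sums of two squares up to `x / g`, uniformly in `g`. -/
theorem exists_abs_sosCount_sq_sub_le : ∃ C, 0 ≤ C ∧ ∀ u : ℝ, 2 ≤ u → ∀ g : ℕ, 1 ≤ g →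
    |sosCount (Real.exp u / g) ^ 2 - sosDensity ^ 2 * ((Real.exp u / g) ^ 2 / u)| ≤
      C * ((Real.exp u / g) ^ 2 * (1 + Real.log g) ^ 2 / u ^ 2) := by
  obtain ⟨C, hC0, hC⟩ := exists_abs_sosCount_sub_le
  have hc := sosDensity_pos
  set c := sosDensity with hcdef
  refine ⟨4 * (2 * c * C + C ^ 2) + 2 * c ^ 2 + 4 * (1 + c ^ 2), by positivity,
    fun u hu g hg => ?_⟩
  have hu0 : 0 < u := by linarith
  have hg0 : (0 : ℝ) < g := by exact_mod_cast hg
  have hl : 0 ≤ Real.log g := Real.log_natCast_nonneg g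
  set l := Real.log g with hldef
  have hy : Real.exp u / g = Real.exp (u - l) := by
    rw [Real.exp_sub, hldef, Real.exp_log hg0]
  rw [hy]
  set y := Real.exp (u - l) with hydef
  have hy0 : 0 < y := Real.exp_pos _
  set Z := y ^ 2 * (1 + l) ^ 2 / u ^ 2 with hZ
  have hZ0 : 0 ≤ Z := by positivity
  -- For `g ≤ √x` Landau's theorem applies at `x / g`. Otherwise `1 + log g` is at least of order
  -- `log x`, and trivial bounds suffice.
  rcases le_or_gt l (u / 2) with h1 | h1
  · have hv : 1 ≤ u - l := by linarith
    have hS := hC (u - l) hv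
    set v := u - l with hvdef
    have hv0 : 0 < v := by linarith
    have hr0 : 0 < √v := Real.sqrt_pos.2 hv0
    have hr2 : √v ^ 2 = v := Real.sq_sqrt hv0.le
    set S := sosCount y with hSdef
    have e1 : (c * (y / √v)) ^ 2 = c ^ 2 * (y ^ 2 / v) := by
      rw [mul_pow, div_pow, hr2]
    have b1 : |S ^ 2 - c ^ 2 * (y ^ 2 / v)| ≤ (2 * c * C + C ^ 2) * (y ^ 2 / v ^ 2) := by
      have h2 : S ^ 2 - c ^ 2 * (y ^ 2 / v) = (S - c * (y / √v)) *
          ((S - c * (y / √v)) + 2 * (c * (y / √v))) := by rw [← e1]; ring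
      rw [h2, abs_mul]
      have h3 : |S - c * (y / √v) + 2 * (c * (y / √v))| ≤
          C * (y / (v * √v)) + 2 * (c * (y / √v)) := by
        refine (abs_add_le _ _).trans (add_le_add hS (le_of_eq (abs_of_nonneg (by positivity))))
      have h4 : y / (v * √v) ≤ y / √v := by
        gcongr
        nlinarith
      calc _ ≤ C * (y / (v * √v)) * (C * (y / (v * √v)) + 2 * (c * (y / √v))) := by gcongr
        _ ≤ C * (y / (v * √v)) * (C * (y / √v) + 2 * (c * (y / √v))) := by gcongr
        _ = (2 * c * C + C ^ 2) * (y ^ 2 / (v * √v ^ 2)) := by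
          field_simp
          ring
        _ = _ := by rw [hr2, ← sq]
    have b2 : |c ^ 2 * (y ^ 2 / v) - c ^ 2 * (y ^ 2 / u)| ≤ 2 * c ^ 2 * (y ^ 2 * l / u ^ 2) := by
      have h2 : c ^ 2 * (y ^ 2 / v) - c ^ 2 * (y ^ 2 / u) = c ^ 2 * (y ^ 2 * l / (u * v)) := by
        field_simp
        rw [hvdef]
        ring
      rw [h2, abs_of_nonneg (by positivity), mul_comm 2, mul_assoc]
      refine mul_le_mul_of_nonneg_left ?_ (by positivity)
      rw [mul_div_assoc', div_le_div_iff₀ (by positivity) (by positivity)]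
      have : u ≤ 2 * v := by linarith
      have h3 : 0 ≤ y ^ 2 * l * u := by positivity
      nlinarith [mul_le_mul_of_nonneg_left this h3]
    have b3 : y ^ 2 / v ^ 2 ≤ 4 * Z := by
      rw [hZ, mul_div_assoc', div_le_div_iff₀ (by positivity) (by positivity)]
      have h2 : u ^ 2 ≤ 4 * v ^ 2 := by nlinarith
      have h3 : 1 ≤ (1 + l) ^ 2 := by nlinarith
      calc y ^ 2 * u ^ 2 ≤ y ^ 2 * (4 * v ^ 2) := by gcongr
        _ = 4 * (y ^ 2 * 1) * v ^ 2 := by ring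
        _ ≤ _ := by gcongr
    have b4 : y ^ 2 * l / u ^ 2 ≤ Z := by
      rw [hZ]
      gcongr
      nlinarith
    have b5 := abs_add_le (S ^ 2 - c ^ 2 * (y ^ 2 / v)) (c ^ 2 * (y ^ 2 / v) - c ^ 2 * (y ^ 2 / u))
    rw [sub_add_sub_cancel] at b5
    have b6 := mul_le_mul_of_nonneg_left b3 (by positivity : 0 ≤ 2 * c * C + C ^ 2)
    have b7 := mul_le_mul_of_nonneg_left b4 (by positivity : 0 ≤ 2 * c ^ 2)
    have b8 : 0 ≤ 4 * (1 + c ^ 2) * Z := by positivity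
    linarith
  · have h2 : sosCount y ^ 2 ≤ y ^ 2 := by
      have := sosCount_nonneg y
      gcongr
      exact sosCount_le_self hy0.le
    have h3 : c ^ 2 * (y ^ 2 / u) ≤ c ^ 2 * y ^ 2 := by
      gcongr
      exact div_le_self (by positivity) (by linarith)
    have h4 : y ^ 2 ≤ 4 * Z := by
      rw [hZ, mul_div_assoc', le_div_iff₀ (by positivity)]
      have : u ^ 2 ≤ 4 * (1 + l) ^ 2 := by nlinarith
      have := mul_le_mul_of_nonneg_left this (sq_nonneg y)
      linarith
    have h5 : 0 ≤ c ^ 2 * (y ^ 2 / u) := by positivity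
    have h6 : |sosCount y ^ 2 - c ^ 2 * (y ^ 2 / u)| ≤ y ^ 2 + c ^ 2 * y ^ 2 := by
      have := sq_nonneg (sosCount y)
      have : 0 ≤ c ^ 2 * y ^ 2 := by positivity
      have := sq_nonneg y
      rw [abs_le]
      constructor <;> linarith
    have h7 := mul_le_mul_of_nonneg_left h4 (by positivity : 0 ≤ 1 + c ^ 2)
    have h8 : 0 ≤ (4 * (2 * c * C + C ^ 2) + 2 * c ^ 2) * Z := by positivity
    linarith

theorem summable_sosInv_div_sq : Summable fun g : ℕ => sosInv g / (g : ℝ) ^ 2 := by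
  refine Summable.of_norm_bounded (Real.summable_one_div_nat_pow.2 (by norm_num : 1 < 2))
    fun g => ?_
  rw [norm_div, Real.norm_eq_abs, Real.norm_of_nonneg (by positivity : (0 : ℝ) ≤ (g : ℝ) ^ 2)]
  gcongr
  exact abs_sosInv_le_one g

/-- Landau's theorem is inserted into the sum over the greatest common divisor, which is dominated
by the convergent series over `(1 + log g) ^ 2 / g ^ 2`. -/
theorem exists_abs_coprimePairCount_sub_le : ∃ C, 0 ≤ C ∧ ∀ u : ℝ, 2 ≤ u →
    |coprimePairCount ⌊Real.exp u⌋₊ - sosDensity ^ 2 * (∑' g : ℕ, sosInv g / (g : ℝ) ^ 2) *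
      (Real.exp u ^ 2 / u)| ≤ C * (Real.exp u ^ 2 / u ^ 2) := by
  obtain ⟨C, hC0, hC⟩ := exists_abs_sosCount_sq_sub_le
  refine ⟨C * ∑' g : ℕ, (1 + Real.log g) ^ 2 / (g : ℝ) ^ 2,
    mul_nonneg hC0 (tsum_nonneg fun g => by positivity), fun u hu => ?_⟩
  set X := Real.exp u with hX
  have hX0 : 0 < X := Real.exp_pos u
  have hM : HasSum (fun g : ℕ => sosInv g * (sosDensity ^ 2 * ((X / g) ^ 2 / u)))
      (sosDensity ^ 2 * (∑' g : ℕ, sosInv g / (g : ℝ) ^ 2) * (X ^ 2 / u)) := by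
    have e : (fun g : ℕ => sosInv g * (sosDensity ^ 2 * ((X / g) ^ 2 / u))) =
        fun g : ℕ => sosDensity ^ 2 * (X ^ 2 / u) * (sosInv g / (g : ℝ) ^ 2) := by
      funext g
      rw [div_pow]
      ring
    rw [mul_right_comm, e]
    exact summable_sosInv_div_sq.hasSum.mul_left _
  have hb : ∀ g : ℕ, ‖sosInv g * sosCount (X / g) ^ 2 -
      sosInv g * (sosDensity ^ 2 * ((X / g) ^ 2 / u))‖ ≤
      C * (X ^ 2 / u ^ 2) * ((1 + Real.log g) ^ 2 / (g : ℝ) ^ 2) := by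
    intro g
    rcases Nat.eq_zero_or_pos g with rfl | hg
    · simp
    · rw [← mul_sub, norm_mul, Real.norm_eq_abs, Real.norm_eq_abs]
      calc _ ≤ 1 * (C * ((X / g) ^ 2 * (1 + Real.log g) ^ 2 / u ^ 2)) :=
            mul_le_mul (abs_sosInv_le_one g) (hC u hu g hg) (abs_nonneg _) zero_le_one
        _ = _ := by rw [div_pow]; ring
  have hs := summable_one_add_log_sq_div_sq.mul_left (C * (X ^ 2 / u ^ 2))
  have hsd : Summable fun g : ℕ => sosInv g * sosCount (X / g) ^ 2 -
      sosInv g * (sosDensity ^ 2 * ((X / g) ^ 2 / u)) := Summable.of_norm_bounded hs hb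
  have h1 : Summable fun g : ℕ => sosInv g * sosCount (X / g) ^ 2 :=
    (hsd.add hM.summable).congr fun g => by ring
  rw [coprimePairCount_floor_eq_tsum, ← hM.tsum_eq, ← h1.tsum_sub hM.summable, ← Real.norm_eq_abs]
  refine (tsum_of_norm_bounded hs.hasSum hb).trans (le_of_eq ?_)
  rw [tsum_mul_left]
  ring

/-- The sum over the greatest common divisor is the reciprocal of the Dirichlet series of the sums
of two squares at `2`. -/
theorem sosSeries_two_mul_tsum_sosInv :
    sosSeries 2 * ((∑' g : ℕ, sosInv g / (g : ℝ) ^ 2 : ℝ) : ℂ) = 1 := by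
  have hinv : ((∑' g : ℕ, sosInv g / (g : ℝ) ^ 2 : ℝ) : ℂ) =
      LSeries (fun n => (sosInv n : ℂ)) 2 := by
    rw [Complex.ofReal_tsum, LSeries]
    refine tsum_congr fun n => ?_
    rcases eq_or_ne n 0 with rfl | hn
    · simp
    · rw [LSeries.term_of_ne_zero hn]
      push_cast
      norm_cast
  have h2 : (1 : ℝ) < (2 : ℂ).re := by norm_num
  have s1 : LSeriesSummable (fun n => (sos n : ℂ)) 2 :=
    LSeriesSummable_of_norm_le_one norm_sos_le_one h2
  have s2 : LSeriesSummable (fun n => (sosInv n : ℂ)) 2 :=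
    LSeriesSummable_of_norm_le_one (fun n => by
      rw [Complex.norm_real]; exact abs_sosInv_le_one n) h2
  rw [hinv, sosSeries, ← LSeries_convolution' s1 s2, LSeries.convolution_def]
  have e : (fun n : ℕ => ∑ p ∈ n.divisorsAntidiagonal, (sos p.1 : ℂ) * (sosInv p.2 : ℂ)) =
      LSeries.delta := by
    funext n
    have h := congrArg (fun f : ArithmeticFunction ℝ => ((f n : ℝ) : ℂ)) sos_mul_sosInv
    simp only [ArithmeticFunction.mul_apply, ArithmeticFunction.one_apply] at h
    rw [LSeries.delta]
    push_cast at h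
    exact h.trans (by split_ifs <;> simp)
  rw [e, LSeries_delta]
  rfl

/-! ### Convergence of the sum of `χ(p) / p` for the nontrivial character modulo `4` -/

/-- The partial sums of the series `L(1, χ)` converge at the rate `1 / N`. -/
theorem norm_LFunction_one_sub_sum_le {N : ℕ} (hN : 1 ≤ N) :
    ‖LFunction chi4 1 - ∑ n ∈ Finset.Ioc 0 N, chi4 n / n‖ ≤ 2 / N := by
  have hA : ∀ N : ℕ, ‖∑ n ∈ Finset.Icc 1 N, chi4 n - 0 * (N : ℂ)‖ ≤ 1 := by
    intro N
    rw [sum_chi4]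
    split_ifs <;> simp
  have hN0 : (0 : ℝ) < N := by exact_mod_cast hN
  have hIcc : Finset.Ioc 0 N = Finset.Icc 1 N := by
    ext n
    simp only [Finset.mem_Ioc, Finset.mem_Icc]
    omega
  -- the bound to the right of `1`, uniform in `σ`
  have hσ : ∀ σ : ℝ, 1 < σ →
      ‖LFunction chi4 σ - ∑ n ∈ Finset.Icc 1 N, chi4 n * (n : ℂ) ^ (-(σ : ℂ))‖ ≤ 2 / N := by
    intro σ h1
    have hre : 1 < (σ : ℂ).re := by simpa using h1
    have h2 := LSeries_eq_truncated (a := fun n => chi4 n)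
      (fun n => DirichletCharacter.norm_le_one _ _) hA hN hre
    have hne : (σ : ℂ) - 1 ≠ 0 := by
      rw [sub_ne_zero]
      exact_mod_cast h1.ne'
    have h3 : LFunction chi4 σ - ∑ n ∈ Finset.Icc 1 N, chi4 n * (n : ℂ) ^ (-(σ : ℂ)) =
        σ * mellin (partialSumRemainder (fun n => chi4 n) 0 N) (-σ) := by
      rw [LFunction_eq_LSeries _ hre]
      refine mul_left_cancel₀ hne ?_
      linear_combination h2
    have h4 := norm_mellin_remainder_le (a := fun n => chi4 n) hA hN (s := (σ : ℂ))
      (by simp; linarith)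
    rw [h3, norm_mul, Complex.norm_real, Real.norm_of_nonneg (by linarith)]
    rw [Complex.ofReal_re, norm_zero, add_zero, mul_one] at h4
    calc _ ≤ σ * (2 * ((N : ℝ) ^ (-σ) / σ)) := by gcongr
      _ = 2 * (N : ℝ) ^ (-σ) := by field_simp
      _ ≤ 2 * (N : ℝ) ^ (-1 : ℝ) := by
          gcongr
          exact_mod_cast hN
      _ = _ := by rw [Real.rpow_neg_one, div_eq_mul_inv]
  have hcont : Continuous fun σ : ℝ => LFunction chi4 σ := by
    have : Continuous (LFunction chi4) := (differentiable_LFunction chi4_ne_one).continuous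
    fun_prop
  have hcont2 : Continuous fun σ : ℝ =>
      ∑ n ∈ Finset.Icc 1 N, chi4 n * (n : ℂ) ^ (-(σ : ℂ)) := by
    refine continuous_finsetSum _ fun n hn => continuous_const.mul ?_
    have hn0 : (n : ℂ) ≠ 0 := by
      have := (Finset.mem_Icc.1 hn).1
      exact_mod_cast (by omega : n ≠ 0)
    exact Continuous.const_cpow (by fun_prop) (Or.inl hn0)
  have hlim := ((hcont.sub hcont2).norm.tendsto 1).mono_left (nhdsWithin_le_nhds (s := Set.Ioi 1))
  have h5 := le_of_tendsto hlim (by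
    filter_upwards [self_mem_nhdsWithin] with σ h using hσ σ h)
  rw [hIcc]
  simpa [Complex.cpow_neg_one, div_eq_mul_inv] using h5

theorem sum_range_succ_eq_sum_Ioc {M : Type*} [AddCommMonoid M] {f : ℕ → M} (h0 : f 0 = 0) (N : ℕ) :
    ∑ n ∈ Finset.range (N + 1), f n = ∑ n ∈ Finset.Ioc 0 N, f n := by
  induction N with
  | zero => simp [h0]
  | succ N ih => rw [Finset.sum_range_succ, ih, Finset.sum_Ioc_succ_top (by omega)]

/-- Dirichlet's test, for a weight that is antitone from some index on. -/
theorem exists_tendsto_sum_mul_of_bounded {f : ℕ → ℝ} {z : ℕ → ℂ} (k : ℕ)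
    (hf : Antitone fun i => f (k + i)) (hf0 : Tendsto f atTop (𝓝 0)) {b : ℝ}
    (hz : ∀ n, ‖∑ i ∈ Finset.range n, z i‖ ≤ b) :
    ∃ l, Tendsto (fun n => ∑ i ∈ Finset.range n, (f i : ℂ) * z i) atTop (𝓝 l) := by
  have h1 : Tendsto (fun i => f (k + i)) atTop (𝓝 0) := by
    simpa only [add_comm k] using (tendsto_add_atTop_iff_nat k).2 hf0
  have h2 : ∀ n, ‖∑ i ∈ Finset.range n, z (k + i)‖ ≤ b + b := by
    intro n
    have : ∑ i ∈ Finset.range n, z (k + i) =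
        ∑ i ∈ Finset.range (k + n), z i - ∑ i ∈ Finset.range k, z i := by
      rw [Finset.sum_range_add, add_sub_cancel_left]
    rw [this]
    exact norm_sub_le_of_le (hz _) (hz _)
  obtain ⟨l, hl⟩ := cauchySeq_tendsto_of_complete
    (hf.cauchySeq_series_mul_of_tendsto_zero_of_bounded h1 h2)
  refine ⟨∑ i ∈ Finset.range k, (f i : ℂ) * z i + l, (tendsto_add_atTop_iff_nat k).1 ?_⟩
  refine (hl.const_add _).congr fun n => ?_
  rw [add_comm n k, Finset.sum_range_add]
  simp only [Complex.real_smul]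

theorem exists_bound_of_tendsto {s : ℕ → ℂ} {l : ℂ} (h : Tendsto s atTop (𝓝 l)) :
    ∃ C, 0 ≤ C ∧ ∀ n, ‖s n‖ ≤ C := by
  obtain ⟨C, hC⟩ := h.norm.bddAbove_range
  have hC' : ∀ n, ‖s n‖ ≤ C := fun n => hC (Set.mem_range_self n)
  exact ⟨C, (norm_nonneg _).trans (hC' 0), hC'⟩

/-- Dirichlet's test, as `log n / n` is antitone from `n = 3` on and the sums of the character are
bounded. -/
theorem exists_norm_sum_chi4_mul_log_div_le : ∃ C, 0 ≤ C ∧ ∀ N : ℕ,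
    ‖∑ n ∈ Finset.Ioc 0 N, chi4 n * Real.log n / n‖ ≤ C := by
  have hf : Antitone fun i : ℕ => Real.log ((3 + i : ℕ) : ℝ) / ((3 + i : ℕ) : ℝ) := by
    intro i j hij
    have h3 : Real.exp 1 ≤ 3 := by linarith [Real.exp_one_lt_d9]
    refine Real.log_div_self_antitoneOn ?_ ?_ (by exact_mod_cast (by omega : 3 + i ≤ 3 + j))
    · simp only [Set.mem_Ici]
      push_cast
      linarith [Nat.cast_nonneg (α := ℝ) i]
    · simp only [Set.mem_Ici]
      push_cast
      linarith [Nat.cast_nonneg (α := ℝ) j]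
  have hf0 : Tendsto (fun n : ℕ => Real.log n / n) atTop (𝓝 0) :=
    Real.isLittleO_log_id_atTop.tendsto_div_nhds_zero.comp tendsto_natCast_atTop_atTop
  have hz : ∀ n, ‖∑ i ∈ Finset.range n, chi4 i‖ ≤ 1 := by
    intro n
    rcases n with _ | n
    · simp
    · have h0 : chi4 ((0 : ℕ) : ZMod 4) = 0 := by rw [chi4_apply]; simp
      rw [sum_range_succ_eq_sum_Ioc (f := fun i : ℕ => chi4 i) h0,
        show Finset.Ioc 0 n = Finset.Icc 1 n by
          ext; simp only [Finset.mem_Ioc, Finset.mem_Icc]; omega, sum_chi4]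
      split_ifs <;> simp
  obtain ⟨l, hl⟩ := exists_tendsto_sum_mul_of_bounded 3 hf hf0 hz
  obtain ⟨C, hC0, hC⟩ := exists_bound_of_tendsto hl
  refine ⟨C, hC0, fun N => ?_⟩
  rw [← sum_range_succ_eq_sum_Ioc (by simp)]
  refine le_trans (le_of_eq ?_) (hC (N + 1))
  congr 1
  refine Finset.sum_congr rfl fun n _ => ?_
  push_cast
  ring

/-- Mertens' bound for the character: the convolution identity `log = Λ * 1` is summed against
`χ(n) / n`, and `L(1, χ) ≠ 0`. -/
theorem exists_norm_sum_chi4_mul_vonMangoldt_div_le : ∃ C, 0 ≤ C ∧ ∀ N : ℕ,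
    ‖∑ n ∈ Finset.Ioc 0 N, chi4 n * ArithmeticFunction.vonMangoldt n / n‖ ≤ C := by
  obtain ⟨C, hC0, hC⟩ := exists_norm_sum_chi4_mul_log_div_le
  have hL : LFunction chi4 1 ≠ 0 := LFunction_apply_one_ne_zero chi4_ne_one
  set L := LFunction chi4 1 with hLdef
  have hL0 : 0 < ‖L‖ := norm_pos_iff.2 hL
  have hlog4 : 0 < Real.log 4 := Real.log_pos (by norm_num)
  refine ⟨(C + 4 * (Real.log 4 + 4)) / ‖L‖, by positivity, fun N => ?_⟩
  rcases Nat.eq_zero_or_pos N with rfl | hN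
  · simp
    positivity
  have hN0 : (0 : ℝ) < N := by exact_mod_cast hN
  -- `f * g` has the coefficients `χ(n) log n / n`; replacing the inner sums over `g` by `L(1, χ)`
  -- costs a bounded amount, by Chebyshev's bound for `∑ Λ(n)`
  set f : ArithmeticFunction ℂ := ⟨fun n => chi4 n * ArithmeticFunction.vonMangoldt n / n, by simp⟩
    with hf
  set g : ArithmeticFunction ℂ := ⟨fun n => chi4 n / n, by simp⟩ with hg
  have hfg : ∀ n, (f * g) n = chi4 n * Real.log n / n := by
    intro n
    have hsum := Nat.sum_divisorsAntidiagonal (n := n) fun d _ => ArithmeticFunction.vonMangoldt d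
    rw [ArithmeticFunction.mul_apply, ← ArithmeticFunction.vonMangoldt_sum, ← hsum]
    push_cast
    rw [Finset.mul_sum, Finset.sum_div]
    refine Finset.sum_congr rfl fun p hp => ?_
    obtain ⟨h1, h2⟩ := Nat.mem_divisorsAntidiagonal.1 hp
    simp only [hf, hg, ArithmeticFunction.coe_mk]
    rw [← h1]
    push_cast
    rw [map_mul, div_mul_div_comm]
    ring
  have key := ArithmeticFunction.sum_Ioc_mul_eq_sum_sum f g N
  simp only [hfg] at key
  have e : L * ∑ n ∈ Finset.Ioc 0 N, f n = ∑ n ∈ Finset.Ioc 0 N,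
      f n * (L - ∑ m ∈ Finset.Ioc 0 (N / n), g m) +
      ∑ n ∈ Finset.Ioc 0 N, chi4 n * Real.log n / n := by
    rw [key, ← Finset.sum_add_distrib, Finset.mul_sum]
    exact Finset.sum_congr rfl fun n _ => by ring
  have b1 : ‖∑ n ∈ Finset.Ioc 0 N, f n * (L - ∑ m ∈ Finset.Ioc 0 (N / n), g m)‖ ≤
      4 * (Real.log 4 + 4) := by
    have h1 : ∀ n ∈ Finset.Ioc 0 N, ‖f n * (L - ∑ m ∈ Finset.Ioc 0 (N / n), g m)‖ ≤
        4 / N * ArithmeticFunction.vonMangoldt n := by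
      intro n hn
      obtain ⟨hn1, hn2⟩ := Finset.mem_Ioc.1 hn
      have hn0 : (0 : ℝ) < n := by exact_mod_cast hn1
      have hq : 1 ≤ N / n := (Nat.one_le_div_iff hn1).2 hn2
      have hq0 : (0 : ℝ) < (N / n : ℕ) := by exact_mod_cast hq
      have h2 : ‖L - ∑ m ∈ Finset.Ioc 0 (N / n), g m‖ ≤ 2 / ((N / n : ℕ) : ℝ) :=
        norm_LFunction_one_sub_sum_le hq
      have hΛ : 0 ≤ ArithmeticFunction.vonMangoldt n := ArithmeticFunction.vonMangoldt_nonneg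
      have h3 : ‖f n‖ ≤ ArithmeticFunction.vonMangoldt n / n := by
        simp only [hf, ArithmeticFunction.coe_mk]
        rw [norm_div, norm_mul, Complex.norm_natCast, Complex.norm_real, Real.norm_of_nonneg hΛ]
        gcongr
        exact mul_le_of_le_one_left hΛ (DirichletCharacter.norm_le_one _ _)
      have h4 : 2 / ((N / n : ℕ) : ℝ) ≤ 4 * n / N := by
        rw [div_le_div_iff₀ hq0 hN0]
        have h5 : N < (N / n + 1) * n := by
          have := Nat.div_add_mod N n
          have := Nat.mod_lt N hn1
          nlinarith
        have h6 : (N / n + 1) * n ≤ 2 * (N / n) * n := Nat.mul_le_mul_right _ (by omega)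
        have h7 : (N : ℝ) ≤ 2 * (N / n : ℕ) * n := by exact_mod_cast h5.le.trans h6
        linarith
      rw [norm_mul]
      calc _ ≤ ArithmeticFunction.vonMangoldt n / n * (4 * n / N) := by
            gcongr
            exact h2.trans h4
        _ = _ := by field_simp
    refine (norm_sum_le_of_le _ h1).trans ?_
    rw [← Finset.mul_sum]
    have h2 := Chebyshev.psi_le_const_mul_self (x := N) hN0.le
    rw [Chebyshev.psi, Nat.floor_natCast] at h2
    calc _ ≤ 4 / N * ((Real.log 4 + 4) * N) := by gcongr
      _ = _ := by field_simp
  have b2 : ‖L‖ * ‖∑ n ∈ Finset.Ioc 0 N, f n‖ ≤ 4 * (Real.log 4 + 4) + C := by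
    rw [← norm_mul, e]
    exact norm_add_le_of_le b1 (hC N)
  rw [le_div_iff₀ hL0, mul_comm]
  exact b2.trans (le_of_eq (add_comm _ _))

/-- Mertens' bound restricted to the primes: the proper prime powers contribute a bounded amount to
a sum over `Λ(n) / n`. -/
theorem exists_norm_sum_prime_chi4_mul_log_div_le : ∃ C, 0 ≤ C ∧ ∀ N : ℕ,
    ‖∑ n ∈ Finset.range N, if n.Prime then chi4 n * Real.log n / n else 0‖ ≤ C := by
  obtain ⟨C, hC0, hC⟩ := exists_norm_sum_chi4_mul_vonMangoldt_div_le
  have hs := ArithmeticFunction.vonMangoldt.summable_residueClass_non_primes_div (0 : ZMod 1)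
  have hs' : Summable fun n : ℕ =>
      (if n.Prime then 0 else ArithmeticFunction.vonMangoldt n) / (n : ℝ) := by
    refine hs.congr fun n => ?_
    rw [ArithmeticFunction.vonMangoldt.residueClass, Set.indicator_of_mem
      (by exact Subsingleton.elim (α := ZMod 1) _ _)]
  have hpos : ∀ n : ℕ, 0 ≤ (if n.Prime then 0 else ArithmeticFunction.vonMangoldt n) / (n : ℝ) := by
    intro n
    have : 0 ≤ ArithmeticFunction.vonMangoldt n := ArithmeticFunction.vonMangoldt_nonneg
    split_ifs <;> positivity
  refine ⟨C + ∑' n : ℕ, (if n.Prime then 0 else ArithmeticFunction.vonMangoldt n) / (n : ℝ),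
    add_nonneg hC0 (tsum_nonneg hpos), fun N => ?_⟩
  have e : ∑ n ∈ Finset.range N, (if n.Prime then chi4 n * Real.log n / n else 0) =
      ∑ n ∈ Finset.range N, chi4 n * ArithmeticFunction.vonMangoldt n / n -
      ∑ n ∈ Finset.range N,
        chi4 n *
          (((if n.Prime then 0 else ArithmeticFunction.vonMangoldt n) / (n : ℝ) : ℝ) : ℂ) := by
    rw [← Finset.sum_sub_distrib]
    refine Finset.sum_congr rfl fun n _ => ?_
    split_ifs with h
    · rw [ArithmeticFunction.vonMangoldt_apply_prime h]
      simp
    · push_cast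
      ring
  rw [e]
  refine norm_sub_le_of_le ?_ ?_
  · rcases N with _ | N
    · simpa
    · rw [sum_range_succ_eq_sum_Ioc (by simp)]
      exact hC N
  · refine (norm_sum_le_of_le _ fun n _ => ?_).trans
      (hs'.sum_le_tsum (Finset.range N) fun n _ => hpos n)
    rw [norm_mul, Complex.norm_real, Real.norm_of_nonneg (hpos n)]
    exact mul_le_of_le_one_left (hpos n) (DirichletCharacter.norm_le_one _ _)

/-- Dirichlet's test with the weight `1 / log n`. -/
theorem exists_tendsto_sum_prime_chi4_div : ∃ l, Tendsto (fun N : ℕ =>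
    ∑ n ∈ Finset.range N, if n.Prime then chi4 n / n else 0) atTop (𝓝 l) := by
  obtain ⟨C, hC0, hC⟩ := exists_norm_sum_prime_chi4_mul_log_div_le
  have hf : Antitone fun i : ℕ => 1 / Real.log ((2 + i : ℕ) : ℝ) := by
    intro i j hij
    have h1 : (2 : ℝ) ≤ ((2 + i : ℕ) : ℝ) := by push_cast; linarith [Nat.cast_nonneg (α := ℝ) i]
    have h2 : ((2 + i : ℕ) : ℝ) ≤ ((2 + j : ℕ) : ℝ) := by exact_mod_cast (by omega)
    have h3 : 0 < Real.log ((2 + i : ℕ) : ℝ) := Real.log_pos (by linarith)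
    exact one_div_le_one_div_of_le h3 (Real.log_le_log (by linarith) h2)
  have hf0 : Tendsto (fun n : ℕ => 1 / Real.log n) atTop (𝓝 0) := by
    simp only [one_div]
    exact tendsto_inv_atTop_zero.comp (Real.tendsto_log_atTop.comp tendsto_natCast_atTop_atTop)
  obtain ⟨l, hl⟩ := exists_tendsto_sum_mul_of_bounded 2 hf hf0 hC
  refine ⟨l, hl.congr fun N => Finset.sum_congr rfl fun n _ => ?_⟩
  split_ifs with h
  · have h1 : (Real.log n : ℂ) ≠ 0 := by
      exact_mod_cast (Real.log_pos (by exact_mod_cast h.one_lt)).ne'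
    rw [Complex.ofReal_div, Complex.ofReal_one]
    field_simp
  · simp

/-! ### The Euler product of the `L`-function at `1` -/

open MeasureTheory in
/-- Abel's theorem for Dirichlet series, at the boundary point `0`: the series is
`ε ∫₁^∞ A(t) t ^ (-ε - 1) dt` with `A` the partial sums, an average of `A` that moves to infinity
as `ε` tends to zero. -/
theorem tendsto_LSeries_of_tendsto_sum {a : ℕ → ℂ} (h0 : a 0 = 0) {l : ℂ}
    (h : Tendsto (fun N => ∑ n ∈ Finset.range N, a n) atTop (𝓝 l))
    (hs : ∀ ε : ℝ, 0 < ε → LSeriesSummable a ε) :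
    Tendsto (fun ε : ℝ => LSeries a ε) (𝓝[>] 0) (𝓝 l) := by
  obtain ⟨K, hK0, hK⟩ := exists_bound_of_tendsto (h.sub_const l)
  have hIoc : ∀ N, ∑ n ∈ Finset.Icc 1 N, a n = ∑ n ∈ Finset.range (N + 1), a n := by
    intro N
    rw [sum_range_succ_eq_sum_Ioc h0]
    refine Finset.sum_congr ?_ fun _ _ => rfl
    ext n
    simp only [Finset.mem_Ioc, Finset.mem_Icc]
    omega
  have hO : (fun n : ℕ => ∑ k ∈ Finset.Icc 1 n, a k) =O[atTop] fun n : ℕ => (n : ℝ) ^ (0 : ℝ) := by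
    refine IsBigO.of_bound (K + ‖l‖) (Eventually.of_forall fun n => ?_)
    rw [Real.rpow_zero, norm_one, mul_one, hIoc]
    have := norm_add_le_of_le (hK (n + 1)) (le_refl ‖l‖)
    rwa [sub_add_cancel] at this
  have hmeas : Measurable fun t : ℝ => ∑ k ∈ Finset.Icc 1 ⌊t⌋₊, a k :=
    (measurable_from_nat (f := fun n : ℕ => ∑ k ∈ Finset.Icc 1 n, a k)).comp Nat.measurable_floor
  rw [Metric.tendsto_nhdsWithin_nhds]
  intro δ hδ
  obtain ⟨N₀, hN₀⟩ := Metric.tendsto_atTop.1 h (δ / 2) (by positivity)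
  set T : ℝ := N₀ + 1 with hT
  have hT1 : 1 ≤ T := by simp [hT]
  refine ⟨δ / (2 * (K * T + 1)), by positivity, fun {ε} hε hεδ => ?_⟩
  have hε0 : 0 < ε := hε
  rw [Real.dist_eq, sub_zero, abs_of_pos hε0] at hεδ
  have hre : -((ε : ℂ) + 1) = ((-(ε + 1) : ℝ) : ℂ) := by push_cast; ring
  have hcint : IntegrableOn (fun t : ℝ => (t : ℂ) ^ (-((ε : ℂ) + 1))) (Set.Ioi 1) :=
    integrableOn_Ioi_cpow_of_lt (by simp; linarith) one_pos
  have hbd : ∀ t : ℝ, ‖(∑ k ∈ Finset.Icc 1 ⌊t⌋₊, a k) - l‖ ≤ K := fun t => by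
    rw [hIoc]; exact hK _
  have i1 : IntegrableOn (fun t : ℝ => ((∑ k ∈ Finset.Icc 1 ⌊t⌋₊, a k) - l) *
      (t : ℂ) ^ (-((ε : ℂ) + 1))) (Set.Ioi 1) :=
    hcint.bdd_mul (c := K) (hmeas.sub_const l).aestronglyMeasurable (Eventually.of_forall hbd)
  have i2 : IntegrableOn (fun t : ℝ => l * (t : ℂ) ^ (-((ε : ℂ) + 1))) (Set.Ioi 1) :=
    hcint.const_mul l
  have hεc : (ε : ℂ) ≠ 0 := by exact_mod_cast hε0.ne'
  have e1 : LSeries a ε - l = ε * ∫ t in Set.Ioi (1 : ℝ), ((∑ k ∈ Finset.Icc 1 ⌊t⌋₊, a k) - l) *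
      (t : ℂ) ^ (-((ε : ℂ) + 1)) := by
    have h2 : (ε : ℂ) * ∫ t in Set.Ioi (1 : ℝ), l * (t : ℂ) ^ (-((ε : ℂ) + 1)) = l := by
      rw [integral_const_mul, integral_Ioi_cpow_of_lt (by simp; linarith) one_pos]
      simp
      field_simp
    rw [LSeries_eq_mul_integral a le_rfl (by simpa using hε0) (hs ε hε0) hO]
    nth_rewrite 1 [← h2]
    rw [← mul_sub, ← integral_sub ?_ i2]
    · congr 2
      funext t
      ring
    · refine (i1.add i2).congr (Eventually.of_forall fun t => ?_)
      simp only [Pi.add_apply]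
      ring
  have hb1 : IntegrableOn (fun t : ℝ => δ / 2 * t ^ (-(ε + 1))) (Set.Ioi 1) :=
    (integrableOn_Ioi_rpow_of_lt (by linarith) one_pos).const_mul _
  have hb2 : Integrable (Set.indicator (Set.Ioc 1 T) fun _ : ℝ => K)
      (volume.restrict (Set.Ioi 1)) :=
    ((integrable_indicator_iff measurableSet_Ioc).2 (integrableOn_const (by simp))).restrict
  have hbound : ‖∫ t in Set.Ioi (1 : ℝ), ((∑ k ∈ Finset.Icc 1 ⌊t⌋₊, a k) - l) *
      (t : ℂ) ^ (-((ε : ℂ) + 1))‖ ≤ δ / 2 * (1 / ε) + K * T := by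
    refine (norm_integral_le_of_norm_le (hb1.add hb2) ?_).trans ?_
    · filter_upwards [ae_restrict_mem measurableSet_Ioi] with t ht
      have ht1 : (1 : ℝ) < t := ht
      have ht0 : 0 < t := by linarith
      have hp : 0 < t ^ (-(ε + 1)) := by positivity
      rw [norm_mul, hre, ← Complex.ofReal_cpow ht0.le, Complex.norm_real,
        Real.norm_of_nonneg hp.le, Pi.add_apply]
      rcases le_or_gt t T with h3 | h3
      · rw [Set.indicator_of_mem (Set.mem_Ioc.2 ⟨ht1, h3⟩)]
        have h4 : t ^ (-(ε + 1)) ≤ 1 := Real.rpow_le_one_of_one_le_of_nonpos ht1.le (by linarith)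
        have h5 := mul_le_mul (hbd t) h4 hp.le hK0
        have h6 : 0 ≤ δ / 2 * t ^ (-(ε + 1)) := by positivity
        linarith
      · rw [Set.indicator_of_notMem fun hm => h3.not_ge hm.2, add_zero]
        refine mul_le_mul_of_nonneg_right ?_ hp.le
        have h4 : N₀ ≤ ⌊t⌋₊ + 1 := by
          have : N₀ ≤ ⌊t⌋₊ := Nat.le_floor (by linarith)
          omega
        have h5 := hN₀ _ h4
        rw [dist_eq_norm, ← hIoc] at h5
        exact h5.le
    · have h7 : (fun t => (fun t : ℝ => δ / 2 * t ^ (-(ε + 1))) t +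
          Set.indicator (Set.Ioc 1 T) (fun _ : ℝ => K) t) =
          (fun t : ℝ => δ / 2 * t ^ (-(ε + 1))) +
            Set.indicator (Set.Ioc 1 T) (fun _ : ℝ => K) := rfl
      rw [← h7, integral_add hb1 hb2, integral_const_mul,
        integral_Ioi_rpow_of_lt (by linarith) one_pos,
        integral_indicator measurableSet_Ioc, Measure.restrict_restrict measurableSet_Ioc,
        Set.inter_eq_left.2 (fun t ht => ht.1), setIntegral_const]
      simp only [Real.one_rpow, smul_eq_mul, Real.volume_real_Ioc_of_le hT1]
      have : -1 / (-(ε + 1) + 1) = 1 / ε := by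
        rw [show -(ε + 1) + 1 = -ε by ring, neg_div_neg_eq]
      rw [this]
      nlinarith
  rw [dist_eq_norm, e1, norm_mul, Complex.norm_real, Real.norm_of_nonneg hε0.le]
  have h8 : ε * (K * T + 1) < δ / 2 := by
    rw [lt_div_iff₀ (by positivity)] at hεδ
    linarith
  calc _ ≤ ε * (δ / 2 * (1 / ε) + K * T) := by gcongr
    _ = δ / 2 + ε * (K * T) := by field_simp
    _ < δ := by nlinarith

/-- The part of `-log (1 - z)` of order two and higher. -/
noncomputable def logRemainder (z : ℂ) : ℂ := -Complex.log (1 - z) - z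

theorem norm_logRemainder_le {z : ℂ} (hz : ‖z‖ ≤ 1 / 2) : ‖logRemainder z‖ ≤ ‖z‖ ^ 2 := by
  have h := Complex.norm_log_one_add_sub_self_le (z := -z) (by rw [norm_neg]; linarith)
  rw [norm_neg] at h
  have e : logRemainder z = -(Complex.log (1 + -z) - -z) := by
    rw [logRemainder]
    ring_nf
  rw [e, norm_neg]
  have h1 : (1 - ‖z‖)⁻¹ ≤ 2 := by
    rw [inv_le_comm₀ (by linarith) (by norm_num)]
    linarith
  have h2 := mul_le_mul_of_nonneg_left h1 (sq_nonneg ‖z‖)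
  linarith

theorem continuousAt_logRemainder {z : ℂ} (hz : ‖z‖ ≤ 1 / 2) : ContinuousAt logRemainder z := by
  have h1 : 1 - z ∈ Complex.slitPlane := by
    refine Or.inl ?_
    have := Complex.re_le_norm z
    simp only [Complex.sub_re, Complex.one_re]
    linarith
  unfold logRemainder
  exact ((continuousAt_const.sub continuousAt_id).clog h1).neg.sub continuousAt_id

theorem norm_chi4_mul_cpow_le (n : ℕ) {σ : ℝ} (hσ : 1 ≤ σ) (hn : 2 ≤ n) :
    ‖chi4 n * (n : ℂ) ^ (-(σ : ℂ))‖ ≤ 1 / n := by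
  have hn0 : (0 : ℝ) < n := by exact_mod_cast (by omega : 0 < n)
  have hn1 : (1 : ℝ) ≤ n := by exact_mod_cast (by omega : 1 ≤ n)
  rw [norm_mul, Complex.norm_natCast_cpow_of_pos (by omega), Complex.neg_re, Complex.ofReal_re]
  calc _ ≤ 1 * (n : ℝ) ^ (-1 : ℝ) := by
        gcongr
        · exact DirichletCharacter.norm_le_one _ _
    _ = _ := by rw [one_mul, Real.rpow_neg_one, one_div]

theorem norm_chi4_mul_cpow_le_half (n : ℕ) {σ : ℝ} (hσ : 1 ≤ σ) (hn : 2 ≤ n) :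
    ‖chi4 n * (n : ℂ) ^ (-(σ : ℂ))‖ ≤ 1 / 2 :=
  (norm_chi4_mul_cpow_le n hσ hn).trans
    (one_div_le_one_div_of_le (by norm_num) (by exact_mod_cast hn))

theorem norm_ite_logRemainder_le (n : ℕ) {σ : ℝ} (hσ : 1 ≤ σ) :
    ‖if n.Prime then logRemainder (chi4 n * (n : ℂ) ^ (-(σ : ℂ))) else 0‖ ≤ 1 / (n : ℝ) ^ 2 := by
  split_ifs with hp
  · refine (norm_logRemainder_le (norm_chi4_mul_cpow_le_half n hσ hp.two_le)).trans ?_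
    rw [← one_div_pow]
    gcongr
    exact norm_chi4_mul_cpow_le n hσ hp.two_le
  · simp

theorem summable_one_div_natCast_sq : Summable fun n : ℕ => 1 / (n : ℝ) ^ 2 :=
  Real.summable_one_div_nat_pow.2 one_lt_two

/-- The coefficients `χ(p) / p` on the primes. -/
noncomputable def primeChi4 (n : ℕ) : ℂ := if n.Prime then chi4 n / n else 0

theorem term_primeChi4 (ε : ℝ) (n : ℕ) : LSeries.term primeChi4 ε n =
    if n.Prime then chi4 n * (n : ℂ) ^ (-((1 + ε : ℝ) : ℂ)) else 0 := by
  rcases eq_or_ne n 0 with rfl | hn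
  · simp [Nat.not_prime_zero]
  rw [LSeries.term_of_ne_zero hn, primeChi4]
  split_ifs with h
  · have hn' : (n : ℂ) ≠ 0 := by exact_mod_cast hn
    rw [Complex.ofReal_add, neg_add, Complex.cpow_add _ _ hn', Complex.ofReal_one,
      Complex.cpow_neg_one, Complex.cpow_neg]
    field_simp
  · simp

theorem summable_primeChi4 {ε : ℝ} (hε : 0 < ε) : LSeriesSummable primeChi4 ε := by
  refine Summable.of_norm_bounded (Real.summable_nat_rpow.2 (by linarith : -(1 + ε) < -1))
    fun n => ?_
  rw [term_primeChi4]
  split_ifs with h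
  · rw [norm_mul, Complex.norm_natCast_cpow_of_pos h.pos, Complex.neg_re, Complex.ofReal_re]
    exact mul_le_of_le_one_left (by positivity) (DirichletCharacter.norm_le_one _ _)
  · simp
    positivity

/-- The logarithm of the Euler product to the right of `1`. -/
theorem LFunction_chi4_eq_exp {ε : ℝ} (hε : 0 < ε) :
    LFunction chi4 ((1 + ε : ℝ) : ℂ) = Complex.exp (LSeries primeChi4 ε +
      ∑' n : ℕ, if n.Prime then logRemainder (chi4 n * (n : ℂ) ^ (-((1 + ε : ℝ) : ℂ))) else 0) := by
  have hre : 1 < ((1 + ε : ℝ) : ℂ).re := by simpa using hε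
  have hs2 : Summable fun n : ℕ =>
      if n.Prime then logRemainder (chi4 n * (n : ℂ) ^ (-((1 + ε : ℝ) : ℂ))) else 0 :=
    Summable.of_norm_bounded summable_one_div_natCast_sq fun n =>
      norm_ite_logRemainder_le n (by linarith)
  rw [LFunction_eq_LSeries _ hre, ← LSeries_eulerProduct_exp_log chi4 hre, LSeries,
    ← (summable_primeChi4 hε).tsum_add hs2]
  congr 1
  refine (tsum_subtype {p : ℕ | p.Prime} fun p : ℕ =>
    -Complex.log (1 - chi4 p * (p : ℂ) ^ (-((1 + ε : ℝ) : ℂ)))).trans (tsum_congr fun n => ?_)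
  rw [term_primeChi4, Set.indicator_apply]
  by_cases h : n.Prime
  · rw [if_pos (by exact h), if_pos h, if_pos h, logRemainder]
    ring
  · rw [if_neg (by exact h), if_neg h, if_neg h, add_zero]

/-- The Euler product of `L(s, χ)` converges at `s = 1`, to the value of the `L`-function. -/
theorem tendsto_prod_prime_chi4 : Tendsto (fun N : ℕ => ∏ n ∈ Finset.range N,
    if n.Prime then (1 - chi4 n / n)⁻¹ else 1) atTop (𝓝 (LFunction chi4 1)) := by
  obtain ⟨l, hl⟩ := exists_tendsto_sum_prime_chi4_div
  set H : ℂ := ∑' n : ℕ, if n.Prime then logRemainder (chi4 n * (n : ℂ) ^ (-((1 : ℝ) : ℂ))) else 0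
    with hH
  have hlim1 : Tendsto (fun ε : ℝ => LSeries primeChi4 ε) (𝓝[>] 0) (𝓝 l) :=
    tendsto_LSeries_of_tendsto_sum (by simp [primeChi4]) hl fun ε hε => summable_primeChi4 hε
  have hlim2 : Tendsto (fun ε : ℝ => ∑' n : ℕ,
      if n.Prime then logRemainder (chi4 n * (n : ℂ) ^ (-((1 + ε : ℝ) : ℂ))) else 0)
      (𝓝[>] 0) (𝓝 H) := by
    refine tendsto_tsum_of_dominated_convergence summable_one_div_natCast_sq (fun n => ?_) ?_
    · by_cases h : n.Prime
      · simp only [if_pos h]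
        refine (continuousAt_logRemainder
          (norm_chi4_mul_cpow_le_half n le_rfl h.two_le)).tendsto.comp ?_
        have hn' : (n : ℂ) ≠ 0 := by exact_mod_cast h.ne_zero
        have : Continuous fun ε : ℝ => chi4 n * (n : ℂ) ^ (-((1 + ε : ℝ) : ℂ)) :=
          continuous_const.mul (Continuous.const_cpow (by fun_prop) (Or.inl hn'))
        simpa using (this.tendsto 0).mono_left nhdsWithin_le_nhds
      · simp only [if_neg h]
        exact tendsto_const_nhds
    · filter_upwards [self_mem_nhdsWithin] with ε hε n
      have : (0 : ℝ) < ε := hε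
      exact norm_ite_logRemainder_le n (by linarith)
  have hlim3 : Tendsto (fun ε : ℝ => LFunction chi4 ((1 + ε : ℝ) : ℂ)) (𝓝[>] 0)
      (𝓝 (LFunction chi4 1)) := by
    have h1 : Continuous (LFunction chi4) := (differentiable_LFunction chi4_ne_one).continuous
    have : Continuous fun ε : ℝ => LFunction chi4 ((1 + ε : ℝ) : ℂ) := by fun_prop
    simpa using (this.tendsto 0).mono_left nhdsWithin_le_nhds
  -- the limits of both sides of the logarithmic Euler product as the argument tends to `1` from the
  -- right
  have hval : LFunction chi4 1 = Complex.exp (l + H) := by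
    refine tendsto_nhds_unique hlim3 (((hlim1.add hlim2).cexp).congr' ?_)
    filter_upwards [self_mem_nhdsWithin] with ε hε
    exact (LFunction_chi4_eq_exp hε).symm
  have hs : Summable fun n : ℕ =>
      if n.Prime then logRemainder (chi4 n * (n : ℂ) ^ (-((1 : ℝ) : ℂ))) else 0 :=
    Summable.of_norm_bounded summable_one_div_natCast_sq fun n => norm_ite_logRemainder_le n le_rfl
  rw [hval]
  refine ((hl.add hs.hasSum.tendsto_sum_nat).cexp).congr fun N => ?_
  rw [← Finset.sum_add_distrib, Complex.exp_sum]
  refine Finset.prod_congr rfl fun n _ => ?_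
  by_cases h : n.Prime
  · simp only [if_pos h]
    have e : chi4 n * (n : ℂ) ^ (-((1 : ℝ) : ℂ)) = chi4 n / n := by
      rw [Complex.ofReal_one, Complex.cpow_neg_one, div_eq_mul_inv]
    have h1 := norm_chi4_mul_cpow_le_half n le_rfl h.two_le
    rw [e] at h1 ⊢
    have h2 : 1 - chi4 n / n ≠ 0 := by
      intro h3
      rw [← sub_eq_zero.1 h3, norm_one] at h1
      norm_num at h1
    rw [logRemainder, add_sub_cancel, Complex.exp_neg, Complex.exp_log h2]
  · simp only [if_neg h, add_zero, Complex.exp_zero]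

/-! ### The constant -/

/-- Euler products over the primes as limits of the products over the primes `p < N`. -/
theorem HasProd.tendsto_prod_prime {f : ℕ → ℂ} {a : ℂ} (h : HasProd (fun p : Nat.Primes => f p) a) :
    Tendsto (fun N : ℕ => ∏ n ∈ Finset.range N, if n.Prime then f n else 1) atTop (𝓝 a) := by
  have h1 : HasProd (Set.mulIndicator {p : ℕ | p.Prime} f) a := hasProd_subtype_iff_mulIndicator.1 h
  refine h1.tendsto_prod_nat.congr fun N => Finset.prod_congr rfl fun n _ => ?_
  rw [Set.mulIndicator_apply]
  rfl

/-- The local factors of the truncated product: away from `2` each is the factor of `L(1, χ)` times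
the quotient of the factors of the absolutely convergent products at `2`. -/
theorem eulerPartialProduct_eq {n : ℕ} (hn : 2 ≤ n) :
    (eulerPartialProduct n : ℂ) =
      (∏ p ∈ Finset.range (n + 1), if p.Prime then (1 - chi4 p / p)⁻¹ else 1) *
      (∏ p ∈ Finset.range (n + 1),
        if p.Prime then (1 - (if p % 4 = 3 then (p : ℂ) ^ (-(2 : ℂ)) else 0))⁻¹ else 1) /
      (∏ p ∈ Finset.range (n + 1),
        if p.Prime then (if p % 4 = 3 then (1 - ((p : ℂ) ^ (-(2 : ℂ))) ^ 2)⁻¹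
          else (1 - (p : ℂ) ^ (-(2 : ℂ)))⁻¹) else 1) * (4 / 3) := by
  have h2 : (4 / 3 : ℂ) = ∏ p ∈ Finset.range (n + 1), if p = 2 then 4 / 3 else 1 := by
    rw [Finset.prod_ite_eq' (Finset.range (n + 1)) 2, if_pos (Finset.mem_range.2 (by omega))]
  have hsub : Finset.Icc 1 n ⊆ Finset.range (n + 1) := fun m hm =>
    Finset.mem_range.2 (by have := (Finset.mem_Icc.1 hm).2; omega)
  have hE : (eulerPartialProduct n : ℂ) = ∏ p ∈ Finset.range (n + 1),
      ((if p.Prime ∧ p % 4 = 1 then (1 + 1 / (p : ℂ)) else 1) *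
        if p.Prime ∧ p % 4 = 3 then (1 - ((p : ℂ) - 1) / ((p : ℂ) * ((p : ℂ) + 1))) else 1) := by
    rw [eulerPartialProduct, Finset.prod_filter, Finset.prod_filter, ← Finset.prod_mul_distrib,
      Complex.ofReal_prod]
    rw [← Finset.prod_subset hsub]
    · refine Finset.prod_congr rfl fun p _ => ?_
      split_ifs <;> push_cast <;> rfl
    · intro p hp1 hp2
      have : p = 0 := by
        by_contra h0
        exact hp2 (Finset.mem_Icc.2 ⟨Nat.one_le_iff_ne_zero.2 h0,
          Nat.lt_succ_iff.1 (Finset.mem_range.1 hp1)⟩)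
      simp [this, Nat.not_prime_zero]
  rw [hE, h2, ← Finset.prod_mul_distrib, ← Finset.prod_div_distrib, ← Finset.prod_mul_distrib]
  refine Finset.prod_congr rfl fun p _ => ?_
  by_cases hp : p.Prime
  swap
  · have : p ≠ 2 := by
      rintro rfl
      exact hp Nat.prime_two
    simp [hp, this]
  have hx : (p : ℂ) ^ (-(2 : ℂ)) = 1 / (p : ℂ) ^ 2 := by
    rw [Complex.cpow_neg, one_div]
    norm_cast
  simp only [hp, true_and, if_true, hx]
  have hp0 : (p : ℂ) ≠ 0 := by exact_mod_cast hp.ne_zero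
  have hp2 := hp.two_le
  have hm : (p : ℂ) - 1 ≠ 0 := by
    rw [sub_ne_zero]
    exact_mod_cast hp.one_lt.ne'
  have hpl : (p : ℂ) + 1 ≠ 0 := by exact_mod_cast p.succ_ne_zero
  have hsq : (p : ℂ) ^ 2 + 1 ≠ 0 := by exact_mod_cast (p ^ 2).succ_ne_zero
  have hsq' : (p : ℂ) ^ 2 - 1 ≠ 0 := by
    rw [show (p : ℂ) ^ 2 - 1 = (p - 1) * (p + 1) by ring]
    exact mul_ne_zero hm hpl
  have f1 : (1 - 1 / (p : ℂ) ^ 2)⁻¹ = (p : ℂ) ^ 2 / ((p : ℂ) ^ 2 - 1) := by field_simp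
  have f2 : (1 - (1 / (p : ℂ) ^ 2) ^ 2)⁻¹ =
      (p : ℂ) ^ 4 / (((p : ℂ) ^ 2 - 1) * ((p : ℂ) ^ 2 + 1)) := by
    rw [show 1 - (1 / (p : ℂ) ^ 2) ^ 2 = ((p : ℂ) ^ 2 - 1) * ((p : ℂ) ^ 2 + 1) / (p : ℂ) ^ 4 by
      field_simp; ring, inv_div]
  rcases hp.eq_two_or_odd with h | h
  · subst h
    rw [chi4_apply]
    norm_num
  · have hne2 : p ≠ 2 := by omega
    rw [chi4_apply, if_neg (by omega : ¬ p % 2 = 0), if_neg hne2]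
    rcases (by omega : p % 4 = 1 ∨ p % 4 = 3) with h4 | h4
    · simp only [h4, if_true, show ¬ (1 : ℕ) = 3 by norm_num, if_false, sub_zero, inv_one]
      have f3 : (1 - 1 / (p : ℂ))⁻¹ = (p : ℂ) / ((p : ℂ) - 1) := by field_simp
      rw [f1, f3]
      field_simp
      ring
    · simp only [h4, if_true, show ¬ (3 : ℕ) = 1 by norm_num, if_false]
      have f3 : (1 - -1 / (p : ℂ))⁻¹ = (p : ℂ) / ((p : ℂ) + 1) := by
        rw [show 1 - -1 / (p : ℂ) = ((p : ℂ) + 1) / p by field_simp; ring, inv_div]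
      rw [f1, f2, f3]
      field_simp
      ring

/-- The value of `W(1)` is `L(1, χ)` times the residue `1 / 2` of `L(s, χ₀)` at `1`, the factor `4`
at the prime `2`, and an absolutely convergent product at `2`. -/
theorem sosDensity_sq : ((sosDensity ^ 2 : ℝ) : ℂ) =
    2 / Real.pi * (LFunction chi4 1 * LSeries threeModFour 2) := by
  have h1 : LFunctionTrivChar₁ 4 1 = 1 / 2 := by
    rw [LFunctionTrivChar₁, Function.update_self, show (4 : ℕ) = 2 ^ 2 by norm_num,
      Nat.primeFactors_prime_pow two_ne_zero Nat.prime_two]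
    norm_num
  have h2 := regularPart_one.2
  rw [regularPart, h1, mul_one, Complex.cpow_neg_one] at h2
  rw [sosDensity, div_pow, Real.sq_sqrt Real.pi_pos.le]
  push_cast
  rw [← h2]
  ring

theorem tsum_sosInv_div_sq_pos : 0 < ∑' g : ℕ, sosInv g / (g : ℝ) ^ 2 := by
  have h := sosSeries_two_mul_tsum_sosInv
  obtain ⟨r, hr, h2⟩ := sosSeries_ofReal 2
  rw [show (2 : ℂ) = ((2 : ℝ) : ℂ) by norm_num, h2] at h
  have h3 : r * ∑' g : ℕ, sosInv g / (g : ℝ) ^ 2 = 1 := by exact_mod_cast h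
  by_contra hneg
  nlinarith [mul_nonpos_of_nonneg_of_nonpos hr (not_lt.1 hneg)]

/-- The constant of the asymptotic formula is the conditionally convergent Euler product. -/
theorem tendsto_eulerPartialProduct : Tendsto eulerPartialProduct atTop
    (𝓝 (2 * Real.pi / 3 * (sosDensity ^ 2 * ∑' g : ℕ, sosInv g / (g : ℝ) ^ 2))) := by
  set S := ∑' g : ℕ, sosInv g / (g : ℝ) ^ 2 with hS
  have hF := sosSeries_two_mul_tsum_sosInv
  rw [← hS] at hF
  have hF0 : sosSeries 2 ≠ 0 := left_ne_zero_of_mul_eq_one hF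
  have hpi : (Real.pi : ℂ) ≠ 0 := by exact_mod_cast Real.pi_ne_zero
  have h2 : (1 : ℝ) < (2 : ℂ).re := by norm_num
  have t1 := tendsto_prod_prime_chi4
  have t2 := HasProd.tendsto_prod_prime (f := fun p : ℕ =>
    (1 - (if p % 4 = 3 then (p : ℂ) ^ (-(2 : ℂ)) else 0))⁻¹) (threeModFour_hasProd h2)
  have t3 := HasProd.tendsto_prod_prime (f := fun p : ℕ =>
    if p % 4 = 3 then (1 - ((p : ℂ) ^ (-(2 : ℂ))) ^ 2)⁻¹ else (1 - (p : ℂ) ^ (-(2 : ℂ)))⁻¹)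
    (sosSeries_hasProd h2)
  have t4 := (((t1.mul t2).div t3 hF0).mul_const (4 / 3 : ℂ)).comp (tendsto_add_atTop_nat 1)
  have hval : LFunction chi4 1 * LSeries threeModFour 2 / sosSeries 2 * (4 / 3) =
      ((2 * Real.pi / 3 * (sosDensity ^ 2 * S) : ℝ) : ℂ) := by
    rw [Complex.ofReal_mul, Complex.ofReal_mul (sosDensity ^ 2), sosDensity_sq,
      show (S : ℂ) = 1 / sosSeries 2 from eq_one_div_of_mul_eq_one_right hF]
    push_cast
    field_simp
    ring
  rw [hval] at t4
  have t5 : Tendsto (fun n => (eulerPartialProduct n : ℂ)) atTop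
      (𝓝 ((2 * Real.pi / 3 * (sosDensity ^ 2 * S) : ℝ) : ℂ)) := by
    refine t4.congr' ?_
    filter_upwards [eventually_ge_atTop 2] with n hn
    exact (eulerPartialProduct_eq hn).symm
  exact_mod_cast (Complex.continuous_re.tendsto _).comp t5

/-! ### The asymptotic formula -/

theorem mainTheorem5 :
    ∃ κ : ℝ, 0 < κ ∧ Tendsto eulerPartialProduct atTop (𝓝 κ) ∧
      (fun B : ℝ => (sumTwoSquaresCount B : ℝ) -
          3 / (2 * Real.pi) * κ * (B ^ 2 / Real.log B))
        =O[atTop] (fun B : ℝ => B ^ 2 / (Real.log B) ^ 2) := by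
  have hc := sosDensity_pos
  have hS := tsum_sosInv_div_sq_pos
  have hpi := Real.pi_pos
  refine ⟨_, ?_, tendsto_eulerPartialProduct, ?_⟩
  · positivity
  obtain ⟨C, hC0, hC⟩ := exists_abs_coprimePairCount_sub_le
  set S := ∑' g : ℕ, sosInv g / (g : ℝ) ^ 2
  refine IsBigO.of_bound (1 + C) ?_
  filter_upwards [eventually_ge_atTop (Real.exp 2)] with B hB
  have hB0 : 0 < B := (Real.exp_pos 2).trans_le hB
  have hu : 2 ≤ Real.log B := (Real.le_log_iff_exp_le hB0).2 hB
  have hB1 : 1 ≤ B := (Real.one_le_exp (by norm_num)).trans hB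
  have h1 := hC (Real.log B) hu
  rw [Real.exp_log hB0] at h1
  have e : 3 / (2 * Real.pi) * (2 * Real.pi / 3 * (sosDensity ^ 2 * S)) = sosDensity ^ 2 * S := by
    field_simp
  -- the summand `1`, which comes from the rational number `0`, is absorbed by the error term
  have h2 : 1 ≤ B ^ 2 / Real.log B ^ 2 := by
    have h3 := Real.log_le_sub_one_of_pos hB0
    rw [one_le_div (by positivity)]
    gcongr
    linarith
  rw [e, sumTwoSquaresCount_eq hB1, Real.norm_eq_abs, Real.norm_of_nonneg (by positivity),
    add_sub_assoc]
  refine (abs_add_le _ _).trans ?_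
  rw [abs_one]
  linarith
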